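/- Lemma. Notation. For $\xi=(\xi_1,\xi_2)\in\mathbb{R}^2$ put $\|\xi\|=|\xi_1|+|\xi_2|$, $|\xi|=(\xi_1^2+\xi_2^2)^{1/2}$ and $\langle\xi\rangle=(1+|\xi|^2)^{1/2}$. Fourier transforms are $\widehat f(\xi)=\int_{\mathbb{R}^2}e^{-ix\cdot\xi}f(x)\,dx$ and $\widehat u(\tau,\xi)=\int_{\mathbb{R}\times\mathbb{R}^2}e^{-i(t\tau+x\cdot\xi)}u(t,x)\,dt\,dx$, extended to tempered distributions. For $\sigma\ge0$ and $s\in\mathbb{R}$, $G^{\sigma,s}$ is the space of $f\in\mathcal S'(\mathbb{R}^2)$ such that $\widehat f\in L^1_{\mathrm{loc}}$ and $\|f\|_{G^{\sigma,s}}=\|e^{\sigma\|\xi\|}\langle\xi\rangle^s\widehat f(\xi)\|_{L^2_\xi}<\infty$. Let $S_1=(-1,1)$ and $S_{2^n}=(-2^n,-2^{n-1}]\cup[2^{n-1},2^n)$ for $n\ge1$. For a continuous function $h:\mathbb{R}^2\to\mathbb{R}$ of polynomial growth, $s,b\in\mathbb{R}$, $\sigma\ge0$ and $1\le p\le\infty$,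 $X^{\sigma,s,b;p}_{h}$ is the space of $u\in\mathcal S'(\mathbb{R}\times\mathbb{R}^2)$ such that $\widehat u\in L^1_{\mathrm{loc}}$ and $$\|u\|_{X^{\sigma,s,b;p}_{h}}=\Bigl(\sum_{L\in\{1,2,4,\dots\}}L^{bp}\bigl\|e^{\sigma\|\xi\|}\langle\xi\rangle^s\chi_{S_L}(\tau+h(\xi))\widehat u(\tau,\xi)\bigr\|_{L^2_{\tau,\xi}}^p\Bigr)^{1/p}<\infty$$ (with the supremum over $L$ of $L^{b}\|\cdots\|_{L^2_{\tau,\xi}}$ if $p=\infty$). For $\delta>0$, $X^{\sigma,s,b;p}_{h}(\delta)$ is the quotient of $X^{\sigma,s,b;p}_{h}$ by the relation $u=v$ on $(-\delta,\delta)\times\mathbb{R}^2$ (as distributions), with norm $\|u\|_{X^{\sigma,s,b;p}_{h}(\delta)}=\inf\{\|v\|_{X^{\sigma,s,b;p}_{h}}: v\in X^{\sigma,s,b;p}_{h},\ v=u \text{ on } (-\delta,\delta)\times\mathbb{R}^2\}$. Finally $h(D)$ is the Fourier multiplier $\widehat{h(D)u}(\tau,\xi)=h(\xi)\widehat u(\tau,\xi)$.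 Statement. Let $-1/2<b<1/2$. There is a constant $c>0$ depending only on $b$ such that the following holds for every continuous $h:\mathbb{R}^2\to\mathbb{R}$ of polynomial growth, all $\sigma\ge0$, $s\in\mathbb{R}$ and $0<\delta\le1$. For any $f\in G^{\sigma,s}$ and any $F\in X^{\sigma,s,b;\infty}_{h}(\delta)$ there is a unique $u\in X^{\sigma,s,1/2;1}_{h}(\delta)$ satisfying $$(-i\partial_t+h(D))u=F \text{ on } (-\delta,\delta)\times\mathbb{R}^2 \text{ in the sense of distributions},\qquad u(0)=f,$$ where $u(0)$ is the value at $t=0$ of $u$ as an element of $C(\mathbb{R};G^{\sigma,s})$. Moreover, $$\|u\|_{X^{\sigma,s,1/2;1}_{h}(\delta)}\le c\Bigl(\|f\|_{G^{\sigma,s}}+\delta^{1/2+b}\|F\|_{X^{\sigma,s,b;\infty}_{h}(\delta)}\Bigr).$$ -/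

import Mathlib

open MeasureTheory SchwartzMap FourierTransform Filter Topology
open scoped ENNReal LineDeriv

noncomputable section

namespace GevreyBourgain

/-- The space `ℝ²` of the variable `x` (and of its dual variable `ξ`), with the Euclidean norm. -/
abbrev Space := EuclideanSpace ℝ (Fin 2)

/-- Space-time `ℝ × ℝ²`, with the Euclidean norm; points are `(t, x)`, or `(τ, ξ)` on the Fourier
side.  The components of `z` are `z.fst` and `z.snd`. -/
abbrev SpaceTime := WithLp 2 (ℝ × Space)

/-! ### The Fourier transform `û(ζ) = ∫ e^{-i ⟨y, ζ⟩} u(y) dy` -/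

section Fourier

variable {E : Type*} [NormedAddCommGroup E] [InnerProductSpace ℝ E] [FiniteDimensional ℝ E]
  [MeasurableSpace E] [BorelSpace E]

variable (E) in
/-- The dilation `y ↦ (2π)⁻¹ y`. -/
def dilation : E ≃L[ℝ] E :=
  ContinuousLinearEquiv.smulLeft (Units.mk0 ((2 * Real.pi)⁻¹ : ℝ) (by positivity))

variable (E) in
/-- The Fourier transform on Schwartz functions, `φ̂(ζ) = ∫ e^{-i ⟨y, ζ⟩} φ(y) dy`
(see `schwartzHat_apply`). -/
def schwartzHat : 𝓢(E, ℂ) →L[ℂ] 𝓢(E, ℂ) :=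
  (compCLMOfContinuousLinearEquiv ℂ (dilation E)).comp (fourierCLM ℂ 𝓢(E, ℂ))

theorem schwartzHat_apply (φ : 𝓢(E, ℂ)) (ζ : E) :
    schwartzHat E φ ζ = ∫ y, Complex.exp (-(Complex.I * (inner ℝ y ζ : ℝ))) * φ y := by
  have h1 : schwartzHat E φ ζ = 𝓕 (φ : E → ℂ) ((2 * Real.pi)⁻¹ • ζ) := by
    rw [← SchwartzMap.fourier_coe]
    rfl
  rw [h1, Real.fourier_eq']
  congr 1
  ext y
  rw [inner_smul_right, smul_eq_mul]
  congr 2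
  push_cast
  field_simp

/-- The Fourier transform of a tempered distribution, `⟨û, φ⟩ = ⟨u, φ̂⟩`. -/
def hat (u : 𝓢'(E, ℂ)) : 𝓢'(E, ℂ) :=
  PointwiseConvergenceCLM.precomp ℂ (schwartzHat E) u

theorem hat_apply (u : 𝓢'(E, ℂ)) (φ : 𝓢(E, ℂ)) : hat u φ = u (schwartzHat E φ) := rfl

/-- The distribution `T` is the locally integrable function `g`. -/
def IsFunction (T : 𝓢'(E, ℂ)) (g : E → ℂ) : Prop :=
  LocallyIntegrable g ∧ ∀ φ : 𝓢(E, ℂ), HasCompactSupport φ → T φ = ∫ y, φ y * g y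

/-- `û ∈ L¹_loc`. -/
def HatLocInt (u : 𝓢'(E, ℂ)) : Prop := ∃ g, IsFunction (hat u) g

open Classical in
/-- The function `û`, for `u` such that `û ∈ L¹_loc` (and `0` otherwise).  It is determined up to
sets of measure zero. -/
def hatFun (u : 𝓢'(E, ℂ)) : E → ℂ :=
  if hu : HatLocInt u then hu.choose else 0

theorem isFunction_hatFun {u : 𝓢'(E, ℂ)} (hu : HatLocInt u) : IsFunction (hat u) (hatFun u) := by
  unfold hatFun
  rw [dif_pos hu]
  exact hu.choose_spec

end Fourier

/-! ### The analytic Gevrey spaces `G^{σ,s}` on `ℝ²` -/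

/-- The weight `e^{σ‖ξ‖} ⟨ξ⟩^s`, where `‖ξ‖ = |ξ₁| + |ξ₂|` and `⟨ξ⟩ = (1 + |ξ|²)^{1/2}`. -/
def weight (σ s : ℝ) (ξ : Space) : ℝ :=
  Real.exp (σ * (|ξ 0| + |ξ 1|)) * Real.sqrt (1 + ‖ξ‖ ^ 2) ^ s

/-- The norm `‖f‖_{G^{σ,s}} = ‖e^{σ‖ξ‖} ⟨ξ⟩^s f̂(ξ)‖_{L²}`, for `f` with `f̂ ∈ L¹_loc`. -/
def gNorm (σ s : ℝ) (f : 𝓢'(Space, ℂ)) : ℝ≥0∞ :=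
  eLpNorm (fun ξ => (weight σ s ξ : ℂ) * hatFun f ξ) 2 volume

/-- `f ∈ G^{σ,s} = 𝓕⁻¹(e^{-σ‖·‖} ⟨·⟩^{-s} L²)`. -/
def MemG (σ s : ℝ) (f : 𝓢'(Space, ℂ)) : Prop :=
  HatLocInt f ∧ gNorm σ s f < ⊤

/-! ### The spaces `X^{σ,s,b;p}_{h(ξ)}` on `ℝ × ℝ²` -/

/-- The dyadic sets: `S_1 = (-1, 1)` and `S_{2^n} = (-2^n, -2^{n-1}] ∪ [2^{n-1}, 2^n)`, `n ≥ 1`,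
indexed by the exponent `n`. -/
def dyadic : ℕ → Set ℝ
  | 0 => Set.Ioo (-1) 1
  | n + 1 => Set.Ioc (-2 ^ (n + 1)) (-2 ^ n) ∪ Set.Ico (2 ^ n) (2 ^ (n + 1))

/-- The dyadic piece `L^b ‖e^{σ‖ξ‖} ⟨ξ⟩^s χ_{S_L}(τ + h(ξ)) û(τ, ξ)‖_{L²}` with `L = 2^n`. -/
def xPiece (h : Space → ℝ) (σ s b : ℝ) (u : 𝓢'(SpaceTime, ℂ)) (n : ℕ) : ℝ≥0∞ :=
  ENNReal.ofReal (((2 : ℝ) ^ n) ^ b) *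
    eLpNorm (Set.indicator {z : SpaceTime | z.fst + h z.snd ∈ dyadic n}
      fun z => (weight σ s z.snd : ℂ) * hatFun u z) 2 volume

/-- The norm of `X^{σ,s,b;p}_{h(ξ)}`: the `ℓ^p` norm over dyadic `L` of the dyadic pieces. -/
def xNorm (h : Space → ℝ) (σ s b : ℝ) (p : ℝ≥0∞) (u : 𝓢'(SpaceTime, ℂ)) : ℝ≥0∞ :=
  if p = ⊤ then ⨆ n, xPiece h σ s b u n
  else (∑' n, xPiece h σ s b u n ^ p.toReal) ^ (1 / p.toReal)

/-- `u ∈ X^{σ,s,b;p}_{h(ξ)}`. -/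
def MemX (h : Space → ℝ) (σ s b : ℝ) (p : ℝ≥0∞) (u : 𝓢'(SpaceTime, ℂ)) : Prop :=
  HatLocInt u ∧ xNorm h σ s b p u < ⊤

/-! ### Restriction to `(-δ, δ) × ℝ²`

An element of the restriction space `X^{σ,s,b;p}_{h(ξ)}(δ)` is the class of some
`u ∈ X^{σ,s,b;p}_{h(ξ)}` modulo `EqOnSlab δ`. -/

/-- The slab `(-δ, δ) × ℝ²`. -/
def slab (δ : ℝ) : Set SpaceTime := {z | z.fst ∈ Set.Ioo (-δ) δ}

/-- `u = v` on `(-δ, δ) × ℝ²`, in the sense of distributions. -/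
def EqOnSlab (δ : ℝ) (u v : 𝓢'(SpaceTime, ℂ)) : Prop :=
  Distribution.IsVanishingOn (u - v) (slab δ)

/-- The norm of `X^{σ,s,b;p}_{h(ξ)}(δ)`: the infimum of `‖v‖_{X^{σ,s,b;p}_{h(ξ)}}` over the
`v ∈ X^{σ,s,b;p}_{h(ξ)}` with `u = v` on `(-δ, δ) × ℝ²`. -/
def xNormOn (h : Space → ℝ) (σ s b : ℝ) (p : ℝ≥0∞) (δ : ℝ) (u : 𝓢'(SpaceTime, ℂ)) : ℝ≥0∞ :=
  ⨅ (v : 𝓢'(SpaceTime, ℂ)) (_ : MemX h σ s b p v) (_ : EqOnSlab δ u v), xNorm h σ s b p v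

/-! ### The initial value problem -/

/-- `w = h(D) u`: both `û` and `ŵ` are locally integrable functions, and
`ŵ(τ, ξ) = h(ξ) û(τ, ξ)`. -/
def IsMultiplier (h : Space → ℝ) (u w : 𝓢'(SpaceTime, ℂ)) : Prop :=
  HatLocInt u ∧ IsFunction (hat w) (fun z => (h z.snd : ℂ) * hatFun u z)

/-- The time derivative `∂_t u`, in the sense of distributions. -/
def timeDeriv (u : 𝓢'(SpaceTime, ℂ)) : 𝓢'(SpaceTime, ℂ) :=
  ∂_{(WithLp.toLp 2 ((1 : ℝ), (0 : Space)) : SpaceTime)} u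

/-- `(-i ∂_t + h(D)) u = F` on `(-δ, δ) × ℝ²`, in the sense of distributions. -/
def SolvesOn (h : Space → ℝ) (δ : ℝ) (F u : 𝓢'(SpaceTime, ℂ)) : Prop :=
  ∃ w, IsMultiplier h u w ∧ EqOnSlab δ (-Complex.I • timeDeriv u + w) F

/-- The time slice `x ↦ φ(t, x)` of a Schwartz function. -/
def slice (t : ℝ) : 𝓢(SpaceTime, ℂ) →L[ℂ] 𝓢(Space, ℂ) :=
  compCLM ℂ (g := fun x : Space => (WithLp.toLp 2 (t, x) : SpaceTime))
    (by
      have h1 : (fun x : Space => (WithLp.toLp 2 (t, x) : SpaceTime)) =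
          fun x => (WithLp.toLp 2 (t, (0 : Space)) : SpaceTime) +
            ((WithLp.prodContinuousLinearEquiv 2 ℝ ℝ Space).symm.toContinuousLinearMap.comp
              (ContinuousLinearMap.inr ℝ ℝ Space)) x := by
        funext x
        simp [← WithLp.toLp_add]
      rw [h1]
      fun_prop)
    ⟨1, 1, fun x => by
      have h1 : ‖x‖ ≤ ‖(WithLp.toLp 2 (t, x) : SpaceTime)‖ := by
        rw [WithLp.prod_norm_eq_of_L2]
        exact Real.le_sqrt_of_sq_le (by simp; positivity)
      linarith⟩

theorem slice_apply (t : ℝ) (φ : 𝓢(SpaceTime, ℂ)) (x : Space) :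
    slice t φ x = φ (WithLp.toLp 2 (t, x)) := rfl

/-- `u` is the continuous curve `t ↦ U t = u(t)`, `U ∈ C(ℝ; G^{σ,s})`. -/
def IsCurve (σ s : ℝ) (u : 𝓢'(SpaceTime, ℂ)) (U : ℝ → 𝓢'(Space, ℂ)) : Prop :=
  (∀ t, MemG σ s (U t)) ∧
  (∀ t₀, Tendsto (fun t => gNorm σ s (U t - U t₀)) (𝓝 t₀) (𝓝 0)) ∧
  ∀ φ : 𝓢(SpaceTime, ℂ), HasCompactSupport φ → u φ = ∫ t, U t (slice t φ)

/-- `u ∈ C(ℝ; G^{σ,s})` and `u(0) = f`. -/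
def HasInitialValue (σ s : ℝ) (u : 𝓢'(SpaceTime, ℂ)) (f : 𝓢'(Space, ℂ)) : Prop :=
  ∃ U, IsCurve σ s u U ∧ U 0 = f

/-- `u` is a solution on `(-δ, δ) × ℝ²` of `(-i ∂_t + h(D)) u = F`, `u(0) = f`. -/
def SolvesIVP (h : Space → ℝ) (σ s δ : ℝ) (f : 𝓢'(Space, ℂ)) (F u : 𝓢'(SpaceTime, ℂ)) : Prop :=
  SolvesOn h δ F u ∧ HasInitialValue σ s u f

/-- `h` has polynomial growth. -/
def PolynomialGrowth (h : Space → ℝ) : Prop :=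
  ∃ (C : ℝ) (m : ℕ), ∀ ξ, |h ξ| ≤ C * (1 + ‖ξ‖) ^ m

end GevreyBourgain

end

open GevreyBourgain

/-! The equation is solved on the Fourier side, separately at each frequency `ξ`, in the variable
`μ = τ + h(ξ)`. There it reads `μ V(μ) = G(μ)`, when tested against inverse transforms of functions
supported in `(-δ, δ)`, and the initial condition reads `∫ V = 2π f̂(ξ)`. Let `κ` be the transform
of a smooth cutoff equal to `1` on `[-1, 1]` (`kappa`). Then
`V(μ) = 2π f̂(ξ) κ(μ) + ∫ K(μ, ν) G(ν) dν`, with `K(μ, ν) = δ (κ(δ(μ - ν)) - κ(δμ)) / ν`, is a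
solution (`solution`, `integral_id_mul_solution`, `integral_solution`): `K` is the kernel of the
Duhamel operator cut off to times of size `δ`.

The estimate needs to be proved only for `δ = 2^{-k}`. The kernel is bounded by the sum of a product
`δ² (1 + δ|μ|)⁻⁴ (1 + δ|ν|)⁻¹` and a part that lives at `|ν| > δ⁻¹` and is concentrated within
distance of order `δ⁻¹` from the diagonal (`exists_enorm_duhamelKernel_le`). The passage from `ℓ^∞`
on the input side to `ℓ¹` on the output side costs nothing: because `-1/2 < b < 1/2`, there is room
for factors `2^{±η|n - k|}` in the dyadic weights, and with these both norms become weighted `L²`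
norms. Between the weighted `L²` norms the product part is bounded by the Cauchy–Schwarz inequality,
and the diagonal part by Schur's test. The gain is `2^{-k(1 + 2b)}` for the squares
(`outSum_kernel_le`), and it gives the linear estimate `exists_tsum_solutionHat_le` after
integration in `ξ`.

The norm of `X^{σ,s,1/2;1}` controls the weighted norm of `û` in `L²_ξ L¹_τ`
(`lintegral_lintegral_sq_le`), so `u` is a continuous curve in `G^{σ,s}` (`exists_isCurve`), and in
only one way (`IsCurve.eq`). For uniqueness, let `d` be the Fourier transform of the difference of
two solutions. Since `τ d` need not be integrable in `τ`, the equation is averaged in time with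
smooth bumps; at almost every frequency `ξ` the averaged inverse transform `W` of `d` in time
satisfies `-i W' + h(ξ) W = 0` on a slightly smaller interval, hence has constant modulus, and the
limit vanishes at `t = 0` (`integral_exp_mul_eq_zero`, `SolvesIVP.eqOnSlab`).

Uniqueness also yields the bound in the restriction norms: every extension of `F` leads to a
solution that agrees with `u` on the slab, so the infimum over the extensions may be taken in the
estimate. -/

open scoped ContDiff

noncomputable section

set_option linter.unusedSectionVars false

namespace GevreyBourgain

/-! ### Tempered distributions given by functions of polynomially weighted `L²` -/

section General

variable {E : Type*} [NormedAddCommGroup E] [InnerProductSpace ℝ E] [FiniteDimensional ℝ E]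
  [MeasurableSpace E] [BorelSpace E]

/-- `g` is a function in `⟨·⟩^{2M} L²` for some `M`.  Such functions are tempered distributions. -/
def PolyL2 (g : E → ℂ) : Prop :=
  ∃ M : ℕ, MemLp (fun y => (((1 + ‖y‖ ^ 2) ^ M : ℝ) : ℂ)⁻¹ * g y) 2 volume

theorem one_add_norm_sq_pow_ne_zero (M : ℕ) (y : E) : (((1 + ‖y‖ ^ 2) ^ M : ℝ) : ℂ) ≠ 0 := by
  have : (0 : ℝ) < (1 + ‖y‖ ^ 2) ^ M := by positivity
  exact_mod_cast this.ne'

theorem continuous_one_add_norm_sq_pow (M : ℕ) :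
    Continuous fun y : E => (((1 + ‖y‖ ^ 2) ^ M : ℝ) : ℂ) := by
  fun_prop

theorem PolyL2.aestronglyMeasurable {g : E → ℂ} (hg : PolyL2 g) : AEStronglyMeasurable g := by
  obtain ⟨M, hM⟩ := hg
  have h1 := (continuous_one_add_norm_sq_pow (E := E) M).aestronglyMeasurable
    (μ := volume) |>.mul hM.1
  refine h1.congr (Eventually.of_forall fun y => ?_)
  simp only [Pi.mul_apply]
  rw [mul_inv_cancel_left₀ (one_add_norm_sq_pow_ne_zero M y)]

theorem PolyL2.locallyIntegrable {g : E → ℂ} (hg : PolyL2 g) : LocallyIntegrable g := by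
  obtain ⟨M, hM⟩ := hg
  have h1 : LocallyIntegrable (fun y => (((1 + ‖y‖ ^ 2) ^ M : ℝ) : ℂ)⁻¹ * g y) :=
    hM.locallyIntegrable (by norm_num)
  rw [← locallyIntegrableOn_univ] at h1 ⊢
  have h2 := h1.continuousOn_mul (continuous_one_add_norm_sq_pow (E := E) M).continuousOn
    isOpen_univ.isLocallyClosed
  have h3 : (fun y : E => (((1 + ‖y‖ ^ 2) ^ M : ℝ) : ℂ) *
      ((((1 + ‖y‖ ^ 2) ^ M : ℝ) : ℂ)⁻¹ * g y)) = g :=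
    funext fun y => mul_inv_cancel_left₀ (one_add_norm_sq_pow_ne_zero M y) (g y)
  rwa [h3] at h2

theorem PolyL2.congr {g g' : E → ℂ} (hg : PolyL2 g) (h : g =ᵐ[volume] g') : PolyL2 g' := by
  obtain ⟨M, hM⟩ := hg
  refine ⟨M, hM.ae_eq ?_⟩
  filter_upwards [h] with y hy
  rw [hy]

/-- Multiplication by a function of polynomial growth preserves `PolyL2`. -/
theorem PolyL2.of_norm_le {g g' : E → ℂ} (hg : PolyL2 g) (hm : AEStronglyMeasurable g')
    {C : ℝ} {N : ℕ} (hle : ∀ᵐ y, ‖g' y‖ ≤ C * (1 + ‖y‖ ^ 2) ^ N * ‖g y‖) : PolyL2 g' := by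
  obtain ⟨M, hM⟩ := hg
  refine ⟨M + N, hM.of_le_mul (c := C) ?_ ?_⟩
  · refine AEStronglyMeasurable.mul ?_ hm
    exact ((continuous_one_add_norm_sq_pow (E := E) (M + N)).inv₀
      (one_add_norm_sq_pow_ne_zero _)).aestronglyMeasurable
  · filter_upwards [hle] with y hy
    have h0 : (0 : ℝ) < (1 + ‖y‖ ^ 2) ^ M := by positivity
    have h0' : (0 : ℝ) < (1 + ‖y‖ ^ 2) ^ N := by positivity
    rw [norm_mul, norm_mul, norm_inv, norm_inv, Complex.norm_real, Complex.norm_real,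
      Real.norm_of_nonneg (by positivity), Real.norm_of_nonneg (by positivity), pow_add]
    calc ((1 + ‖y‖ ^ 2) ^ M * (1 + ‖y‖ ^ 2) ^ N)⁻¹ * ‖g' y‖
        ≤ ((1 + ‖y‖ ^ 2) ^ M * (1 + ‖y‖ ^ 2) ^ N)⁻¹ * (C * (1 + ‖y‖ ^ 2) ^ N * ‖g y‖) := by gcongr
      _ = C * (((1 + ‖y‖ ^ 2) ^ M)⁻¹ * ‖g y‖) := by field_simp

theorem PolyL2.of_memLp {g : E → ℂ} (hg : MemLp g 2 volume) : PolyL2 g :=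
  ⟨0, by simpa using hg⟩

theorem PolyL2.sub {g g' : E → ℂ} (hg : PolyL2 g) (hg' : PolyL2 g') :
    PolyL2 (fun y => g y - g' y) := by
  have key : ∀ {f : E → ℂ} {M : ℕ} (N : ℕ),
      MemLp (fun y => (((1 + ‖y‖ ^ 2) ^ M : ℝ) : ℂ)⁻¹ * f y) 2 volume →
      MemLp (fun y => (((1 + ‖y‖ ^ 2) ^ (M + N) : ℝ) : ℂ)⁻¹ * f y) 2 volume := by
    intro f M N hf
    have hm : AEStronglyMeasurable f := PolyL2.aestronglyMeasurable ⟨M, hf⟩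
    refine hf.of_le_mul (c := 1) ?_ ?_
    · exact (((continuous_one_add_norm_sq_pow (E := E) (M + N)).inv₀
        (one_add_norm_sq_pow_ne_zero _)).aestronglyMeasurable).mul hm
    · refine Eventually.of_forall fun y => ?_
      have h1 : (1 : ℝ) ≤ (1 + ‖y‖ ^ 2) ^ N := one_le_pow₀ (by nlinarith [sq_nonneg ‖y‖])
      rw [norm_mul, norm_mul, norm_inv, norm_inv, Complex.norm_real, Complex.norm_real,
        Real.norm_of_nonneg (by positivity), Real.norm_of_nonneg (by positivity), pow_add, one_mul]
      gcongr
      exact le_mul_of_one_le_right (by positivity) h1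
  obtain ⟨M, hM⟩ := hg
  obtain ⟨N, hN⟩ := hg'
  refine ⟨M + N, ?_⟩
  have h1 := key N hM
  have h2 := key M hN
  rw [add_comm N M] at h2
  refine (h1.sub h2).ae_eq (Eventually.of_forall fun y => ?_)
  simp only [Pi.sub_apply]
  ring

/-- A function in `PolyL2` defines a tempered distribution. -/
theorem PolyL2.exists_distribution {g : E → ℂ} (hg : PolyL2 g) :
    ∃ T : 𝓢'(E, ℂ), ∀ φ : 𝓢(E, ℂ), T φ = ∫ y, φ y * g y := by
  obtain ⟨M, hM⟩ := hg
  have hT : Function.HasTemperateGrowth (fun y : E => (((1 + ‖y‖ ^ 2) ^ M : ℝ) : ℂ)) := by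
    fun_prop
  refine ⟨TemperedDistribution.smulLeftCLM ℂ (fun y : E => (((1 + ‖y‖ ^ 2) ^ M : ℝ) : ℂ))
    (Lp.toTemperedDistribution (hM.toLp _)), fun φ => ?_⟩
  rw [TemperedDistribution.smulLeftCLM_apply_apply, Lp.toTemperedDistribution_apply]
  refine integral_congr_ae ?_
  filter_upwards [hM.coeFn_toLp] with y hy
  rw [hy, SchwartzMap.smulLeftCLM_apply_apply hT, smul_eq_mul, smul_eq_mul, mul_mul_mul_comm,
    mul_inv_cancel₀ (one_add_norm_sq_pow_ne_zero M y), one_mul]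

theorem PolyL2.integrable_mul {g : E → ℂ} (hg : PolyL2 g) (φ : 𝓢(E, ℂ)) :
    Integrable (fun y => φ y * g y) := by
  obtain ⟨M, hM⟩ := hg
  have hT : Function.HasTemperateGrowth (fun y : E => (((1 + ‖y‖ ^ 2) ^ M : ℝ) : ℂ)) := by
    fun_prop
  have h1 : MemLp (SchwartzMap.smulLeftCLM ℂ (fun y : E => (((1 + ‖y‖ ^ 2) ^ M : ℝ) : ℂ)) φ) 2
    volume := SchwartzMap.memLp _ 2 volume
  refine (h1.integrable_mul hM).congr (Eventually.of_forall fun y => ?_)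
  simp only [Pi.mul_apply]
  rw [SchwartzMap.smulLeftCLM_apply_apply hT, smul_eq_mul, mul_mul_mul_comm,
    mul_inv_cancel₀ (one_add_norm_sq_pow_ne_zero M y), one_mul]

/-! ### Compactly supported test functions are dense in the Schwartz space -/

variable (E) in
/-- A smooth cutoff equal to `1` on the unit ball. -/
def cutoff : E → ℝ := (⟨1, 2, by norm_num, by norm_num⟩ : ContDiffBump (0 : E))

theorem contDiff_cutoff : ContDiff ℝ ∞ (cutoff E) := ContDiffBump.contDiff _

theorem hasCompactSupport_cutoff : HasCompactSupport (cutoff E) := ContDiffBump.hasCompactSupport _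

theorem cutoff_eq_one {x : E} (hx : ‖x‖ ≤ 1) : cutoff E x = 1 :=
  ContDiffBump.one_of_mem_closedBall _ (by simpa using hx)

theorem hasCompactSupport_cutoff_smul (φ : 𝓢(E, ℂ)) (n : ℕ) :
    HasCompactSupport fun x => cutoff E (((n : ℝ) + 1)⁻¹ • x) • φ x := by
  have h1 : HasCompactSupport fun x => cutoff E (((n : ℝ) + 1)⁻¹ • x) :=
    hasCompactSupport_cutoff.comp_smul (by positivity)
  exact h1.smul_right

theorem contDiff_cutoff_comp_smul (n : ℕ) :
    ContDiff ℝ ∞ fun x => cutoff E (((n : ℝ) + 1)⁻¹ • x) :=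
  contDiff_cutoff.comp (contDiff_const_smul _)

/-- The product of `φ` with the cutoff at scale `n + 1`. -/
def truncate (φ : 𝓢(E, ℂ)) (n : ℕ) : 𝓢(E, ℂ) :=
  (hasCompactSupport_cutoff_smul φ n).toSchwartzMap
    ((contDiff_cutoff_comp_smul n).smul (φ.smooth ⊤))

theorem truncate_apply (φ : 𝓢(E, ℂ)) (n : ℕ) (x : E) :
    truncate φ n x = cutoff E (((n : ℝ) + 1)⁻¹ • x) • φ x := rfl

theorem hasCompactSupport_truncate (φ : 𝓢(E, ℂ)) (n : ℕ) : HasCompactSupport (truncate φ n) :=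
  hasCompactSupport_cutoff_smul φ n

/-- The cutoff at scale `n + 1` differs from `1`, in every derivative, by `O(|x| / n)`: one power of
`|x|`, which a Schwartz function absorbs, buys convergence. -/
theorem exists_iteratedFDeriv_one_sub_cutoff_le (j : ℕ) :
    ∃ C : ℝ, 0 ≤ C ∧ ∀ (n : ℕ) (x : E),
      ‖iteratedFDeriv ℝ j (fun x : E => 1 - cutoff E (((n : ℝ) + 1)⁻¹ • x)) x‖ ≤
        C * (‖x‖ / (n + 1)) := by
  have hsm : ContDiff ℝ ∞ (fun x : E => 1 - cutoff E x) := contDiff_const.sub contDiff_cutoff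
  obtain ⟨C, hC⟩ : ∃ C : ℝ, ∀ x, ‖iteratedFDeriv ℝ j (fun x : E => 1 - cutoff E x) x‖ ≤ C := by
    rcases j with _ | j
    · refine ⟨1, fun x => ?_⟩
      rw [norm_iteratedFDeriv_zero, Real.norm_eq_abs, abs_le]
      have h1 : 0 ≤ cutoff E x := ContDiffBump.nonneg _
      have h2 : cutoff E x ≤ 1 := ContDiffBump.le_one _
      constructor <;> linarith
    · have hCs : HasCompactSupport (iteratedFDeriv ℝ (j + 1) (cutoff E)) :=
        hasCompactSupport_cutoff.iteratedFDeriv _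
      have h3 : iteratedFDeriv ℝ (j + 1) (fun x : E => 1 - cutoff E x) =
          -iteratedFDeriv ℝ (j + 1) (cutoff E) := by
        ext1 x
        have h4 := iteratedFDeriv_sub_apply (𝕜 := ℝ) (i := j + 1) (x := x)
          (f := fun _ : E => (1 : ℝ)) (g := cutoff E) contDiffAt_const
          (contDiff_cutoff.contDiffAt.of_le (mod_cast le_top))
        rw [iteratedFDeriv_const_of_ne (by omega), Pi.zero_apply, zero_sub] at h4
        exact h4
      obtain ⟨C, hC⟩ := hCs.exists_bound_of_continuous
        (contDiff_cutoff.continuous_iteratedFDeriv (mod_cast le_top))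
      exact ⟨C, fun x => by rw [h3, Pi.neg_apply, norm_neg]; exact hC x⟩
  have hC0 : 0 ≤ C := (norm_nonneg _).trans (hC 0)
  refine ⟨C, hC0, fun n x => ?_⟩
  have hn : (0 : ℝ) < n + 1 := by positivity
  -- inside the ball of radius `n + 1` the cutoff is locally constant; outside, `|x| / (n + 1) ≥ 1`
  rcases lt_or_ge ‖x‖ (n + 1) with hx | hx
  · have h1 : (fun x : E => 1 - cutoff E (((n : ℝ) + 1)⁻¹ • x)) =ᶠ[𝓝 x] fun _ => 0 := by
      filter_upwards [(isOpen_lt continuous_norm continuous_const).mem_nhds hx] with y hy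
      rw [cutoff_eq_one, sub_self]
      rw [norm_smul, norm_inv, Real.norm_of_nonneg hn.le, inv_mul_le_iff₀ hn, mul_one]
      exact le_of_lt hy
    rw [(h1.iteratedFDeriv ℝ j).eq_of_nhds]
    have h2 : iteratedFDeriv ℝ j (fun _ : E => (0 : ℝ)) x = 0 := by
      rw [iteratedFDeriv_fun_zero]; rfl
    rw [h2, norm_zero]
    positivity
  · have h1 : iteratedFDeriv ℝ j (fun x : E => 1 - cutoff E (((n : ℝ) + 1)⁻¹ • x)) x =
        (((n : ℝ) + 1)⁻¹) ^ j • iteratedFDeriv ℝ j (fun x : E => 1 - cutoff E x)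
          (((n : ℝ) + 1)⁻¹ • x) :=
      congrFun (iteratedFDeriv_comp_const_smul (𝕜 := ℝ) (((n : ℝ) + 1)⁻¹)
        (hsm.of_le (mod_cast le_top))) x
    rw [h1, norm_smul, norm_pow, norm_inv, Real.norm_of_nonneg hn.le]
    have h2 : (((n : ℝ) + 1)⁻¹) ^ j ≤ 1 :=
      pow_le_one₀ (by positivity) (inv_le_one_of_one_le₀ (by linarith [n.cast_nonneg (α := ℝ)]))
    have h3 : 1 ≤ ‖x‖ / (n + 1) := by rwa [le_div_iff₀ hn, one_mul]
    calc (((n : ℝ) + 1)⁻¹) ^ j * ‖iteratedFDeriv ℝ j (fun x : E => 1 - cutoff E x) _‖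
        ≤ 1 * C := by gcongr; exact hC _
      _ ≤ C * (‖x‖ / (n + 1)) := by nlinarith

theorem tendsto_truncate (φ : 𝓢(E, ℂ)) : Tendsto (truncate φ) atTop (𝓝 φ) := by
  rw [(schwartz_withSeminorms ℝ E ℂ).tendsto_nhds]
  rintro ⟨k, N⟩ ε hε
  choose C hC0 hC using fun j => exists_iteratedFDeriv_one_sub_cutoff_le (E := E) j
  set B : ℝ := ∑ j ∈ Finset.range (N + 1),
    (N.choose j : ℝ) * C j * SchwartzMap.seminorm ℝ (k + 1) (N - j) φ with hB
  have hB0 : 0 ≤ B := Finset.sum_nonneg fun j _ => by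
    have := hC0 j
    positivity
  have key : ∀ n, SchwartzMap.seminorm ℝ k N (truncate φ n - φ) ≤ B / (n + 1) := by
    intro n
    refine SchwartzMap.seminorm_le_bound ℝ k N _ (by positivity) fun x => ?_
    have h1 : (⇑(truncate φ n - φ) : E → ℂ) =
        -(fun x => (1 - cutoff E (((n : ℝ) + 1)⁻¹ • x)) • φ x) := by
      ext1 y
      simp only [FunLike.coe_sub, Pi.sub_apply, Pi.neg_apply, truncate_apply, sub_smul, one_smul]
      ring
    rw [h1, iteratedFDeriv_neg, Pi.neg_apply, norm_neg]
    have hsm : ContDiff ℝ ∞ (fun x : E => 1 - cutoff E (((n : ℝ) + 1)⁻¹ • x)) :=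
      contDiff_const.sub (contDiff_cutoff_comp_smul n)
    have h2 := norm_iteratedFDeriv_smul_le (𝕜 := ℝ) hsm (φ.smooth ⊤) x (n := N) (mod_cast le_top)
    calc ‖x‖ ^ k * ‖iteratedFDeriv ℝ N
          (fun x => (1 - cutoff E (((n : ℝ) + 1)⁻¹ • x)) • φ x) x‖
        ≤ ‖x‖ ^ k * ∑ j ∈ Finset.range (N + 1), (N.choose j : ℝ) * (C j * (‖x‖ / (n + 1))) *
            ‖iteratedFDeriv ℝ (N - j) φ x‖ := by
          refine mul_le_mul_of_nonneg_left (h2.trans ?_) (by positivity)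
          gcongr with j _
          exact hC j n x
      _ = ∑ j ∈ Finset.range (N + 1), (N.choose j : ℝ) * C j *
            (‖x‖ ^ (k + 1) * ‖iteratedFDeriv ℝ (N - j) φ x‖) / (n + 1) := by
          rw [Finset.mul_sum]
          refine Finset.sum_congr rfl fun j _ => ?_
          rw [pow_succ]
          ring
      _ ≤ ∑ j ∈ Finset.range (N + 1), (N.choose j : ℝ) * C j *
            SchwartzMap.seminorm ℝ (k + 1) (N - j) φ / (n + 1) := by
          gcongr with j _
          · have := hC0 j
            positivity
          · exact SchwartzMap.le_seminorm ℝ _ _ φ x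
      _ = B / (n + 1) := by rw [hB, Finset.sum_div]
  have hlim : Tendsto (fun n : ℕ => B / ((n : ℝ) + 1)) atTop (𝓝 0) :=
    tendsto_const_nhds.div_atTop (tendsto_natCast_atTop_atTop.atTop_add tendsto_const_nhds)
  filter_upwards [hlim.eventually_lt_const hε] with n hn
  exact (key n).trans_lt hn

/-- A tempered distribution is determined by its values on compactly supported test functions. -/
theorem tempered_ext_of_hasCompactSupport {S T : 𝓢'(E, ℂ)}
    (h : ∀ φ : 𝓢(E, ℂ), HasCompactSupport φ → S φ = T φ) : S = T := by
  ext φ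
  have h1 : Tendsto (fun n => S (truncate φ n)) atTop (𝓝 (S φ)) :=
    (S.continuous.tendsto φ).comp (tendsto_truncate φ)
  have h2 : Tendsto (fun n => T (truncate φ n)) atTop (𝓝 (T φ)) :=
    (T.continuous.tendsto φ).comp (tendsto_truncate φ)
  refine tendsto_nhds_unique h1 (h2.congr fun n => ?_)
  exact (h _ (hasCompactSupport_truncate φ n)).symm

/-! ### The function `û` -/

/-- A real test function, as a complex Schwartz function. -/
def testFunction (θ : E → ℝ) (hθ : ContDiff ℝ ∞ θ) (hc : HasCompactSupport θ) : 𝓢(E, ℂ) :=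
  HasCompactSupport.toSchwartzMap (f := fun x => (θ x : ℂ)) (hc.comp_left Complex.ofReal_zero)
    (Complex.ofRealCLM.contDiff.comp hθ)

theorem testFunction_apply (θ : E → ℝ) (hθ : ContDiff ℝ ∞ θ) (hc : HasCompactSupport θ) (x : E) :
    testFunction θ hθ hc x = θ x := rfl

theorem hasCompactSupport_testFunction (θ : E → ℝ) (hθ : ContDiff ℝ ∞ θ)
    (hc : HasCompactSupport θ) : HasCompactSupport (testFunction θ hθ hc) :=
  hc.comp_left (g := fun r : ℝ => (r : ℂ)) Complex.ofReal_zero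

theorem IsFunction.ae_eq {T : 𝓢'(E, ℂ)} {g g' : E → ℂ} (hg : IsFunction T g)
    (hg' : IsFunction T g') : g =ᵐ[volume] g' := by
  refine ae_eq_of_integral_contDiff_smul_eq hg.1 hg'.1 fun θ hθ hc => ?_
  have h1 := hg.2 _ (hasCompactSupport_testFunction θ hθ hc)
  rw [hg'.2 _ (hasCompactSupport_testFunction θ hθ hc)] at h1
  simpa only [testFunction_apply, Complex.real_smul] using h1.symm

theorem hatFun_ae_eq {u : 𝓢'(E, ℂ)} {g : E → ℂ} (hg : IsFunction (hat u) g) :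
    hatFun u =ᵐ[volume] g :=
  (isFunction_hatFun ⟨g, hg⟩).ae_eq hg

/-- If `T` is a function in `PolyL2`, then the integral formula for `T φ` holds for all Schwartz
functions `φ`, not only for those of compact support. -/
theorem IsFunction.apply_eq {T : 𝓢'(E, ℂ)} {g : E → ℂ} (hT : IsFunction T g) (hg : PolyL2 g)
    (φ : 𝓢(E, ℂ)) : T φ = ∫ y, φ y * g y := by
  obtain ⟨S, hS⟩ := hg.exists_distribution
  rw [tempered_ext_of_hasCompactSupport (S := T) (T := S) fun ψ hψ => by rw [hT.2 ψ hψ, hS], hS]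

/-! ### The inverse Fourier transform -/

variable (E) in
/-- The inverse of `schwartzHat`. -/
def schwartzHatInv : 𝓢(E, ℂ) →L[ℂ] 𝓢(E, ℂ) :=
  (fourierInvCLM ℂ 𝓢(E, ℂ)).comp (compCLMOfContinuousLinearEquiv ℂ (dilation E).symm)

@[simp]
theorem schwartzHat_schwartzHatInv (φ : 𝓢(E, ℂ)) : schwartzHat E (schwartzHatInv E φ) = φ := by
  refine SchwartzMap.ext fun x => ?_
  simp [schwartzHat, schwartzHatInv]

@[simp]
theorem schwartzHatInv_schwartzHat (φ : 𝓢(E, ℂ)) : schwartzHatInv E (schwartzHat E φ) = φ := by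
  have h1 : compCLMOfContinuousLinearEquiv ℂ (dilation E).symm (schwartzHat E φ) = 𝓕 φ := by
    refine SchwartzMap.ext fun x => ?_
    simp [schwartzHat]
  change 𝓕⁻ (compCLMOfContinuousLinearEquiv ℂ (dilation E).symm (schwartzHat E φ)) = φ
  rw [h1]
  simp

theorem dilation_symm_apply (y : E) : (dilation E).symm y = (2 * Real.pi) • y := by
  rw [ContinuousLinearEquiv.symm_apply_eq]
  change y = (2 * Real.pi)⁻¹ • (2 * Real.pi) • y
  rw [smul_smul, inv_mul_cancel₀ (by positivity), one_smul]

theorem schwartzHatInv_apply (φ : 𝓢(E, ℂ)) (ζ : E) :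
    schwartzHatInv E φ ζ = ((2 * Real.pi) ^ Module.finrank ℝ E : ℝ)⁻¹ *
      ∫ y, Complex.exp (Complex.I * (inner ℝ y ζ : ℝ)) * φ y := by
  have h1 : schwartzHatInv E φ ζ = 𝓕⁻ (fun y => φ ((2 * Real.pi) • y)) ζ := by
    change (𝓕⁻ (compCLMOfContinuousLinearEquiv ℂ (dilation E).symm φ)) ζ = _
    rw [SchwartzMap.fourierInv_coe]
    refine congrFun (congrArg _ (funext fun y => congrArg φ ?_)) ζ
    exact dilation_symm_apply y
  rw [h1, Real.fourierInv_eq']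
  have h2 := Measure.integral_comp_smul (volume : Measure E)
    (fun y => Complex.exp (Complex.I * (inner ℝ y ζ : ℝ)) * φ y) (2 * Real.pi)
  rw [abs_of_nonneg (by positivity), Complex.real_smul] at h2
  push_cast at h2 ⊢
  rw [← h2]
  congr 1
  ext1 y
  rw [smul_eq_mul, inner_smul_left]
  congr 2
  simp
  ring

theorem apply_eq_hat (u : 𝓢'(E, ℂ)) (φ : 𝓢(E, ℂ)) : u φ = hat u (schwartzHatInv E φ) := by
  rw [hat_apply, schwartzHat_schwartzHatInv]

theorem hat_injective : Function.Injective (hat : 𝓢'(E, ℂ) → 𝓢'(E, ℂ)) := by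
  intro u v h
  ext φ
  rw [apply_eq_hat, h, ← apply_eq_hat]

theorem apply_eq_integral {u : 𝓢'(E, ℂ)} {g : E → ℂ} (hu : IsFunction (hat u) g) (hg : PolyL2 g)
    (φ : 𝓢(E, ℂ)) : u φ = ∫ y, schwartzHatInv E φ y * g y := by
  rw [apply_eq_hat, hu.apply_eq hg]

/-- Every function in `PolyL2` is the Fourier transform of a tempered distribution. -/
theorem PolyL2.exists_isFunction_hat {g : E → ℂ} (hg : PolyL2 g) :
    ∃ u : 𝓢'(E, ℂ), IsFunction (hat u) g := by
  obtain ⟨T, hT⟩ := hg.exists_distribution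
  refine ⟨PointwiseConvergenceCLM.precomp ℂ (schwartzHatInv E) T, hg.locallyIntegrable,
    fun φ _ => ?_⟩
  rw [← hT, hat_apply]
  change T (schwartzHatInv E (schwartzHat E φ)) = T φ
  rw [schwartzHatInv_schwartzHat]

theorem eq_of_hat_ae_eq {u v : 𝓢'(E, ℂ)} {g g' : E → ℂ} (hu : IsFunction (hat u) g)
    (hv : IsFunction (hat v) g') (h : g =ᵐ[volume] g') : u = v := by
  refine hat_injective (tempered_ext_of_hasCompactSupport fun φ hφ => ?_)
  rw [hu.2 φ hφ, hv.2 φ hφ]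
  refine integral_congr_ae ?_
  filter_upwards [h] with y hy
  rw [hy]

theorem IsFunction.sub {S T : 𝓢'(E, ℂ)} {g g' : E → ℂ} (hS : IsFunction S g)
    (hT : IsFunction T g') : IsFunction (S - T) (fun y => g y - g' y) := by
  refine ⟨hS.1.sub hT.1, fun φ hφ => ?_⟩
  have key : ∀ {f : E → ℂ}, LocallyIntegrable f → Integrable fun y => φ y * f y := by
    intro f hf
    exact hf.integrable_smul_left_of_hasCompactSupport φ.continuous hφ
  simp only [mul_sub]
  rw [integral_sub (key hS.1) (key hT.1), ← hS.2 φ hφ, ← hT.2 φ hφ]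
  rfl

theorem hat_sub (u v : 𝓢'(E, ℂ)) : hat (u - v) = hat u - hat v := by
  ext φ
  rfl

theorem schwartzHatInv_lineDeriv (φ : 𝓢(E, ℂ)) (m ζ : E) :
    schwartzHatInv E (∂_{m} φ) ζ = -(Complex.I * (inner ℝ ζ m : ℝ)) * schwartzHatInv E φ ζ := by
  have hm : (dilation E).symm m = (2 * Real.pi) • m := dilation_symm_apply m
  have h1 := lineDerivOp_compCLMOfContinuousLinearEquiv (𝕜 := ℂ) m (dilation E).symm φ
  rw [hm] at h1
  have h2 : ∂_{(2 * Real.pi) • m} φ = (2 * Real.pi) • ∂_{m} φ := by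
    rw [LineDeriv.lineDerivOp_left_smul]
  have h3 := fourierInv_lineDerivOp_eq (compCLMOfContinuousLinearEquiv ℂ (dilation E).symm φ) m
  rw [h1, h2] at h3
  have h4 := DFunLike.congr_fun h3 ζ
  have hT : (inner ℝ · m : E → ℝ).HasTemperateGrowth := by fun_prop
  have h5 : (𝓕⁻ (compCLMOfContinuousLinearEquiv ℂ (dilation E).symm
      ((2 * Real.pi) • ∂_{m} φ)) : 𝓢(E, ℂ)) =
      ((2 * Real.pi : ℝ) : ℂ) • schwartzHatInv E (∂_{m} φ) := by
    have : ((2 * Real.pi) • ∂_{m} φ : 𝓢(E, ℂ)) = ((2 * Real.pi : ℝ) : ℂ) • ∂_{m} φ := by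
      ext; simp
    rw [this, map_smul, FourierTransform.fourierInv_smul]
    rfl
  rw [h5] at h4
  simp only [smul_apply, smul_eq_mul, SchwartzMap.smulLeftCLM_apply_apply hT,
    Complex.real_smul] at h4
  have hpi : ((2 * Real.pi : ℝ) : ℂ) ≠ 0 := by
    exact_mod_cast (by positivity : (2 * Real.pi : ℝ) ≠ 0)
  refine mul_left_cancel₀ hpi (h4.trans ?_)
  change _ * (_ * schwartzHatInv E φ ζ) = _
  push_cast
  ring

end General

/-! ### Cauchy–Schwarz and Minkowski inequalities for lower integrals -/

theorem rpow_half_sq (x : ℝ≥0∞) : (x ^ (1 / 2 : ℝ)) ^ 2 = x := by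
  rw [← ENNReal.rpow_natCast, ← ENNReal.rpow_mul]
  norm_num

theorem lintegral_mul_sq_le {α : Type*} [MeasurableSpace α] (μ : Measure α) {f g : α → ℝ≥0∞}
    (hf : AEMeasurable f μ) (hg : AEMeasurable g μ) :
    (∫⁻ a, f a * g a ∂μ) ^ 2 ≤ (∫⁻ a, f a ^ 2 ∂μ) * ∫⁻ a, g a ^ 2 ∂μ := by
  have h1 := ENNReal.lintegral_mul_le_Lp_mul_Lq μ Real.HolderConjugate.two_two hf hg
  calc (∫⁻ a, f a * g a ∂μ) ^ 2
      ≤ ((∫⁻ a, f a ^ (2 : ℝ) ∂μ) ^ (1 / 2 : ℝ) * (∫⁻ a, g a ^ (2 : ℝ) ∂μ) ^ (1 / 2 : ℝ)) ^ 2 := by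
        gcongr
        exact h1
    _ = _ := by
        rw [mul_pow, rpow_half_sq, rpow_half_sq]
        simp only [ENNReal.rpow_two]

/-- The Cauchy–Schwarz inequality with a weight `o`. -/
theorem lintegral_mul_sq_le_weight {α : Type*} [MeasurableSpace α] (μ : Measure α)
    {f g o : α → ℝ≥0∞} (hf : AEMeasurable f μ) (hg : AEMeasurable g μ) (ho : AEMeasurable o μ)
    (h0 : ∀ a, o a ≠ 0) (ht : ∀ a, o a ≠ ⊤) :
    (∫⁻ a, f a * g a ∂μ) ^ 2 ≤ (∫⁻ a, (o a)⁻¹ * f a ^ 2 ∂μ) * ∫⁻ a, o a * g a ^ 2 ∂μ := by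
  have h1 := lintegral_mul_sq_le μ (f := fun a => ((o a)⁻¹) ^ (1 / 2 : ℝ) * f a)
    (g := fun a => (o a) ^ (1 / 2 : ℝ) * g a) ((ho.inv.pow_const _).mul hf)
    ((ho.pow_const _).mul hg)
  simp only [mul_pow, rpow_half_sq] at h1
  refine le_trans (le_of_eq ?_) h1
  congr 1
  refine lintegral_congr fun a => ?_
  rw [mul_mul_mul_comm, ← ENNReal.mul_rpow_of_nonneg _ _ (by norm_num),
    ENNReal.inv_mul_cancel (h0 a) (ht a), ENNReal.one_rpow, one_mul]

theorem tsum_mul_sq_le (f g : ℕ → ℝ≥0∞) :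
    (∑' n, f n * g n) ^ 2 ≤ (∑' n, f n ^ 2) * ∑' n, g n ^ 2 := by
  have h := lintegral_mul_sq_le Measure.count (f := f) (g := g)
    (measurable_of_countable _).aemeasurable (measurable_of_countable _).aemeasurable
  simpa only [lintegral_count] using h

theorem add_sq_le_two_mul (a b : ℝ≥0∞) : (a + b) ^ 2 ≤ 2 * (a ^ 2 + b ^ 2) := by
  have h := ENNReal.rpow_add_le_mul_rpow_add_rpow a b (p := 2) (by norm_num)
  norm_num at h
  exact h

/-- Minkowski's inequality for the `L²` norm of a countable sum. -/
theorem lintegral_tsum_sq_le {α : Type*} [MeasurableSpace α] (μ : Measure α) {f : ℕ → α → ℝ≥0∞}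
    (hf : ∀ n, AEMeasurable (f n) μ) {N : ℕ → ℝ≥0∞} (hN : ∀ n, ∫⁻ a, f n a ^ 2 ∂μ ≤ N n ^ 2) :
    ∫⁻ a, (∑' n, f n a) ^ 2 ∂μ ≤ (∑' n, N n) ^ 2 := by
  have h1 : ∀ m n, ∫⁻ a, f m a * f n a ∂μ ≤ N m * N n := by
    intro m n
    have h2 := lintegral_mul_sq_le μ (hf m) (hf n)
    have h3 : (∫⁻ a, f m a * f n a ∂μ) ^ 2 ≤ (N m * N n) ^ 2 := by
      rw [mul_pow]
      exact h2.trans (mul_le_mul' (hN m) (hN n))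
    exact (ENNReal.pow_le_pow_left_iff two_ne_zero).1 h3
  calc ∫⁻ a, (∑' n, f n a) ^ 2 ∂μ = ∫⁻ a, ∑' m, ∑' n, f m a * f n a ∂μ := by
        refine lintegral_congr fun a => ?_
        rw [sq, ← ENNReal.tsum_mul_right]
        exact tsum_congr fun m => ENNReal.tsum_mul_left.symm
    _ = ∑' m, ∑' n, ∫⁻ a, f m a * f n a ∂μ := by
        refine (lintegral_tsum (f := fun m a => ∑' n, f m a * f n a) fun m =>
          AEMeasurable.tsum fun n => (hf m).mul (hf n)).trans ?_
        exact tsum_congr fun m => lintegral_tsum (f := fun n a => f m a * f n a)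
          fun n => (hf m).mul (hf n)
    _ ≤ ∑' m, ∑' n, N m * N n :=
        ENNReal.tsum_le_tsum fun m => ENNReal.tsum_le_tsum fun n => h1 m n
    _ = (∑' n, N n) ^ 2 := by
        rw [sq, ← ENNReal.tsum_mul_right]
        exact tsum_congr fun m => ENNReal.tsum_mul_left

/-! ### The dyadic decomposition of the line -/

theorem mem_dyadic_zero {x : ℝ} : x ∈ dyadic 0 ↔ |x| < 1 := by
  rw [dyadic, Set.mem_Ioo, abs_lt]

theorem mem_dyadic_succ {x : ℝ} {n : ℕ} : x ∈ dyadic (n + 1) → 2 ^ n ≤ |x| ∧ |x| ≤ 2 ^ (n + 1) := by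
  have h0 : (0 : ℝ) < 2 ^ n := by positivity
  rintro (⟨h1, h2⟩ | ⟨h1, h2⟩)
  · rw [abs_of_nonpos (by linarith)]
    constructor <;> linarith
  · rw [abs_of_nonneg (by linarith)]
    exact ⟨h1, h2.le⟩

theorem measurableSet_dyadic (n : ℕ) : MeasurableSet (dyadic n) := by
  cases n with
  | zero => exact measurableSet_Ioo
  | succ n => exact measurableSet_Ioc.union measurableSet_Ico

theorem iUnion_dyadic : ⋃ n, dyadic n = Set.univ := by
  refine Set.eq_univ_of_forall fun x => Set.mem_iUnion.2 ?_
  rcases lt_or_ge |x| 1 with hx | hx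
  · exact ⟨0, mem_dyadic_zero.2 hx⟩
  rcases le_total 0 x with h0 | h0
  · rw [abs_of_nonneg h0] at hx
    obtain ⟨n, h1, h2⟩ := exists_nat_pow_near hx (one_lt_two : (1 : ℝ) < 2)
    exact ⟨n + 1, Or.inr ⟨h1, h2⟩⟩
  · rw [abs_of_nonpos h0] at hx
    obtain ⟨n, h1, h2⟩ := exists_nat_pow_near hx (one_lt_two : (1 : ℝ) < 2)
    exact ⟨n + 1, Or.inl ⟨by linarith, by linarith⟩⟩

theorem pairwise_disjoint_dyadic : Pairwise (Function.onFun Disjoint dyadic) := by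
  have key : ∀ m n : ℕ, m < n → Disjoint (dyadic m) (dyadic n) := by
    intro m n hmn
    obtain ⟨n, rfl⟩ : ∃ l, n = l + 1 := ⟨n - 1, by omega⟩
    have hp : (0 : ℝ) < 2 ^ n := by positivity
    rw [Set.disjoint_left]
    cases m with
    | zero =>
      intro x hx hx'
      have h1 := mem_dyadic_zero.1 hx
      have h2 : (1 : ℝ) ≤ 2 ^ n := one_le_pow₀ (by norm_num)
      linarith [(mem_dyadic_succ hx').1]
    | succ m =>
      have h2 : (2 : ℝ) ^ (m + 1) ≤ 2 ^ n := pow_le_pow_right₀ (by norm_num) (by omega)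
      have h3 : (0 : ℝ) < 2 ^ m := by positivity
      rintro x (⟨h4, h5⟩ | ⟨h4, h5⟩) (⟨h6, h7⟩ | ⟨h6, h7⟩) <;> linarith
  intro m n hmn
  rcases hmn.lt_or_gt with h | h
  · exact key m n h
  · exact (key n m h).symm

theorem abs_le_of_mem_dyadic {x : ℝ} {n : ℕ} (hx : x ∈ dyadic n) : |x| ≤ 2 ^ n := by
  cases n with
  | zero => simpa using (mem_dyadic_zero.1 hx).le
  | succ n => exact (mem_dyadic_succ hx).2

theorem volume_dyadic_le (n : ℕ) : volume (dyadic n) ≤ ENNReal.ofReal (2 * 2 ^ n) := by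
  have h1 : dyadic n ⊆ Set.Icc (-2 ^ n) (2 ^ n) := fun x hx =>
    abs_le.1 (abs_le_of_mem_dyadic hx)
  refine (measure_mono h1).trans (le_of_eq ?_)
  rw [Real.volume_Icc]
  congr 1
  ring

/-- The function equal to `w n` on the dyadic set of index `n`. -/
def dyadicWeight (w : ℕ → ℝ≥0∞) (x : ℝ) : ℝ≥0∞ :=
  ∑' n, (dyadic n).indicator (fun _ => w n) x

theorem dyadicWeight_of_mem (w : ℕ → ℝ≥0∞) {x : ℝ} {n : ℕ} (hx : x ∈ dyadic n) :
    dyadicWeight w x = w n := by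
  rw [dyadicWeight, tsum_eq_single n, Set.indicator_of_mem hx]
  intro m hm
  exact Set.indicator_of_notMem (fun h => Set.disjoint_left.1 (pairwise_disjoint_dyadic hm) h hx) _

theorem exists_mem_dyadic (x : ℝ) : ∃ n, x ∈ dyadic n := by
  have : x ∈ ⋃ n, dyadic n := by rw [iUnion_dyadic]; trivial
  exact Set.mem_iUnion.1 this

theorem measurable_dyadicWeight (w : ℕ → ℝ≥0∞) : Measurable (dyadicWeight w) :=
  Measurable.tsum fun n => measurable_const.indicator (measurableSet_dyadic n)

theorem lintegral_eq_tsum_dyadic (f : ℝ → ℝ≥0∞) :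
    ∫⁻ x, f x = ∑' n, ∫⁻ x in dyadic n, f x := by
  rw [← lintegral_iUnion measurableSet_dyadic pairwise_disjoint_dyadic, iUnion_dyadic,
    Measure.restrict_univ]

theorem lintegral_dyadicWeight_mul (w : ℕ → ℝ≥0∞) {f : ℝ → ℝ≥0∞} (hf : Measurable f) :
    ∫⁻ x, dyadicWeight w x * f x = ∑' n, w n * ∫⁻ x in dyadic n, f x := by
  rw [lintegral_eq_tsum_dyadic]
  refine tsum_congr fun n => ?_
  rw [← lintegral_const_mul _ hf]
  refine setLIntegral_congr_fun (measurableSet_dyadic n) fun x hx => ?_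
  simp only [dyadicWeight_of_mem w hx]

/-! ### The dyadic weights

With `δ = 2^{-k}`, the weights below are of the form `2^{c n} 2^{± η |n - k|}`.  The second factor
makes sums over `n` geometric series, with a bound that does not depend on `k`. -/

theorem two_rpow_le_two_rpow {x y : ℝ} (h : x ≤ y) : (2 : ℝ) ^ x ≤ 2 ^ y :=
  Real.rpow_le_rpow_of_exponent_le (by norm_num) h

/-- Every time scale in `(0, 1]` is comparable to a dyadic one. -/
theorem exists_two_rpow_neg_nat {δ : ℝ} (hδ : 0 < δ) (hδ1 : δ ≤ 1) :
    ∃ k : ℕ, δ ≤ (2 : ℝ) ^ (-(k : ℝ)) ∧ (2 : ℝ) ^ (-(k : ℝ)) ≤ 2 * δ := by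
  obtain ⟨n, h1, h2⟩ := exists_nat_pow_near_of_lt_one hδ hδ1 (by norm_num : (0 : ℝ) < 1 / 2)
    (by norm_num)
  have h3 : (2 : ℝ) ^ (-(n : ℝ)) = (1 / 2) ^ n := by
    rw [Real.rpow_neg (by norm_num), Real.rpow_natCast, one_div, inv_pow]
  refine ⟨n, h3 ▸ h2, ?_⟩
  rw [h3]
  rw [pow_succ] at h1
  linarith

theorem tsum_eq_sum_range_add (f : ℕ → ℝ≥0∞) (k : ℕ) :
    ∑' n, f n = ∑ n ∈ Finset.range k, f (k - 1 - n) + ∑' n, f (n + k) := by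
  rw [Finset.sum_range_reflect f k]
  exact ((ENNReal.summable (f := fun n => f (n + k))).sum_add_tsum_nat_add').symm

theorem tsum_two_rpow_neg_abs_le {η : ℝ} (hη : 0 < η) :
    ∃ C : ℝ≥0∞, C ≠ ⊤ ∧ ∀ k : ℕ,
      ∑' n : ℕ, ENNReal.ofReal ((2 : ℝ) ^ (-(η * |(n : ℝ) - k|))) ≤ C := by
  obtain ⟨r, hr⟩ : ∃ r : ℝ, r = (2 : ℝ) ^ (-η) := ⟨_, rfl⟩
  have hr0 : 0 < r := by rw [hr]; positivity
  have hr1 : r < 1 := by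
    rw [hr]
    exact Real.rpow_lt_one_of_one_lt_of_neg (by norm_num) (by linarith)
  have hpow : ∀ m : ℕ, (2 : ℝ) ^ (-(η * (m : ℝ))) = r ^ m := fun m => by
    rw [hr, ← Real.rpow_natCast, ← Real.rpow_mul (by norm_num)]
    ring_nf
  have hterm : ∀ (m : ℕ) (y : ℝ), (m : ℝ) ≤ |y| →
      ENNReal.ofReal ((2 : ℝ) ^ (-(η * |y|))) ≤ ENNReal.ofReal (r ^ m) := by
    intro m y hy
    refine ENNReal.ofReal_le_ofReal ?_
    rw [← hpow]
    exact two_rpow_le_two_rpow (by nlinarith)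
  have hSt : ∑' m : ℕ, ENNReal.ofReal (r ^ m) ≠ ⊤ := by
    rw [← ENNReal.ofReal_tsum_of_nonneg (fun m => by positivity)
      (summable_geometric_of_lt_one hr0.le hr1)]
    exact ENNReal.ofReal_ne_top
  refine ⟨_, ENNReal.add_ne_top.2 ⟨hSt, hSt⟩, fun k => ?_⟩
  rw [tsum_eq_sum_range_add _ k]
  refine add_le_add ?_ (ENNReal.tsum_le_tsum fun m => hterm m _ ?_)
  · refine le_trans (Finset.sum_le_sum fun j hj => hterm j _ ?_)
      (ENNReal.sum_le_tsum (Finset.range k))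
    have hj' : j < k := Finset.mem_range.1 hj
    have h1 : ((k - 1 - j : ℕ) : ℝ) = (k : ℝ) - 1 - j := by
      rw [Nat.cast_sub (by omega), Nat.cast_sub (by omega)]
      simp
    rw [h1, show (k : ℝ) - 1 - j - k = -(1 + j) by ring, abs_neg, abs_of_nonneg (by positivity)]
    linarith
  · push_cast
    rw [add_sub_cancel_right]
    exact le_abs_self _

/-- The margin by which `b` stays inside `(-1/2, 1/2)`; it pays for the geometric factors in the
weights. -/
theorem exists_margin {b : ℝ} (hb : -(1 / 2 : ℝ) < b) (hb' : b < 1 / 2) :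
    ∃ η : ℝ, 0 < η ∧ 2 * η ≤ 1 - 2 * b ∧ 2 * η ≤ 1 + 2 * b := by
  refine ⟨min ((1 - 2 * b) / 2) ((1 + 2 * b) / 2), lt_min (by linarith) (by linarith), ?_, ?_⟩
  · linarith [min_le_left ((1 - 2 * b) / 2) ((1 + 2 * b) / 2)]
  · linarith [min_le_right ((1 - 2 * b) / 2) ((1 + 2 * b) / 2)]

/-- The weight of the output of the Duhamel operator on the `n`-th dyadic set: the square of the
factor `2^{n/2}` of `X^{σ,s,1/2;1}`, increased by `2^{η|n - k|}` so that the square sum over `n`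
controls the sum. -/
def outWeight (η : ℝ) (k n : ℕ) : ℝ := (2 : ℝ) ^ ((n : ℝ) + η * |(n : ℝ) - k|)

/-- The weight of the input of the Duhamel operator on the `n`-th dyadic set: the square of the
factor `2^{bn}` of `X^{σ,s,b;∞}`, decreased by `2^{-η|n - k|}` so that the supremum over `n`
controls the square sum. -/
def inWeight (b η : ℝ) (k n : ℕ) : ℝ := (2 : ℝ) ^ (2 * b * n - η * |(n : ℝ) - k|)

theorem two_rpow_le_abs {x : ℝ} {n : ℕ} (hn : 0 < n) (hx : x ∈ dyadic n) :
    (2 : ℝ) ^ ((n : ℝ) - 1) ≤ |x| := by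
  obtain ⟨m, rfl⟩ : ∃ m, n = m + 1 := ⟨n - 1, by omega⟩
  have := (mem_dyadic_succ hx).1
  push_cast
  rw [add_sub_cancel_right, Real.rpow_natCast]
  exact this

theorem outWeight_le {η : ℝ} (hη : 0 < η) (hη' : η ≤ 1 / 2) {k n : ℕ} {x : ℝ}
    (hx : x ∈ dyadic n) :
    outWeight η k n ≤ 4 * (2 : ℝ) ^ (k : ℝ) * (1 + (2 : ℝ) ^ (-(k : ℝ)) * |x|) ^ (1 + η) := by
  have hδ : (0 : ℝ) < (2 : ℝ) ^ (-(k : ℝ)) := by positivity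
  have hk : (0 : ℝ) < (2 : ℝ) ^ (k : ℝ) := by positivity
  rw [outWeight]
  rcases le_or_gt n k with hnk | hnk
  · have hnk' : (n : ℝ) ≤ k := by exact_mod_cast hnk
    have h1 : (1 : ℝ) ≤ (1 + (2 : ℝ) ^ (-(k : ℝ)) * |x|) ^ (1 + η) :=
      Real.one_le_rpow (by nlinarith [abs_nonneg x]) (by linarith)
    have h2 : (2 : ℝ) ^ ((n : ℝ) + η * |(n : ℝ) - k|) ≤ 2 ^ (k : ℝ) := by
      refine two_rpow_le_two_rpow ?_
      rw [abs_of_nonpos (by linarith)]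
      nlinarith
    nlinarith
  · have hnk' : (k : ℝ) < n := by exact_mod_cast hnk
    have h1 := two_rpow_le_abs (by omega) hx
    have h2 : (2 : ℝ) ^ ((n : ℝ) - 1 - k) ≤ 1 + (2 : ℝ) ^ (-(k : ℝ)) * |x| := by
      have h3 : (2 : ℝ) ^ ((n : ℝ) - 1 - k) = (2 : ℝ) ^ (-(k : ℝ)) * (2 : ℝ) ^ ((n : ℝ) - 1) := by
        rw [← Real.rpow_add (by norm_num)]
        ring_nf
      rw [h3]
      nlinarith
    have h3 : (2 : ℝ) ^ (((n : ℝ) - 1 - k) * (1 + η)) ≤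
        (1 + (2 : ℝ) ^ (-(k : ℝ)) * |x|) ^ (1 + η) := by
      rw [Real.rpow_mul (by norm_num)]
      exact Real.rpow_le_rpow (by positivity) h2 (by linarith)
    have h4 : (4 : ℝ) = (2 : ℝ) ^ (2 : ℝ) := by norm_num
    calc (2 : ℝ) ^ ((n : ℝ) + η * |(n : ℝ) - k|)
        ≤ (2 : ℝ) ^ (2 + (k : ℝ) + ((n : ℝ) - 1 - k) * (1 + η)) := by
          refine two_rpow_le_two_rpow ?_
          rw [abs_of_nonneg (by linarith)]
          nlinarith
      _ = 4 * (2 : ℝ) ^ (k : ℝ) * (2 : ℝ) ^ (((n : ℝ) - 1 - k) * (1 + η)) := by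
          rw [h4, ← Real.rpow_add (by norm_num), ← Real.rpow_add (by norm_num)]
      _ ≤ _ := by gcongr

theorem inWeight_pos (b η : ℝ) (k n : ℕ) : 0 < inWeight b η k n := by
  unfold inWeight
  positivity

/-- With `δ = 2^{-k}`: the bound that makes `(1 + δ|x|)⁻¹` square integrable against the inverse of
the input weight. -/
theorem inWeight_inv_mul_le {b η : ℝ} (h1 : 2 * η ≤ 1 - 2 * b) (h2 : 2 * η ≤ 1 + 2 * b) {k n : ℕ}
    {x : ℝ} (hx : x ∈ dyadic n) :
    (inWeight b η k n)⁻¹ * ((1 + (2 : ℝ) ^ (-(k : ℝ)) * |x|)⁻¹) ^ 2 * (2 * 2 ^ n) ≤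
      8 * (2 : ℝ) ^ ((k : ℝ) * (1 - 2 * b)) * (2 : ℝ) ^ (-(η * |(n : ℝ) - k|)) := by
  have hδ : (0 : ℝ) < (2 : ℝ) ^ (-(k : ℝ)) := by positivity
  have hpos : 0 ≤ (2 : ℝ) ^ (-(k : ℝ)) * |x| := by positivity
  have h3 : (2 : ℝ) ^ (max ((n : ℝ) - k) 0 - 1) ≤ 1 + (2 : ℝ) ^ (-(k : ℝ)) * |x| := by
    rcases le_or_gt n k with hnk | hnk
    · have hnk' : (n : ℝ) ≤ k := by exact_mod_cast hnk
      rw [max_eq_right (by linarith)]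
      have : (2 : ℝ) ^ ((0 : ℝ) - 1) ≤ 2 ^ (0 : ℝ) := two_rpow_le_two_rpow (by norm_num)
      rw [Real.rpow_zero] at this
      linarith
    · have hnk' : (k : ℝ) < n := by exact_mod_cast hnk
      rw [max_eq_left (by linarith)]
      have h4 := two_rpow_le_abs (by omega) hx
      have h5 : (2 : ℝ) ^ ((n : ℝ) - k - 1) = (2 : ℝ) ^ (-(k : ℝ)) * (2 : ℝ) ^ ((n : ℝ) - 1) := by
        rw [← Real.rpow_add (by norm_num)]
        ring_nf
      rw [h5]
      nlinarith
  have h4 : (1 + (2 : ℝ) ^ (-(k : ℝ)) * |x|)⁻¹ ≤ (2 : ℝ) ^ (1 - max ((n : ℝ) - k) 0) := by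
    rw [show (1 - max ((n : ℝ) - k) 0) = -(max ((n : ℝ) - k) 0 - 1) by ring,
      Real.rpow_neg (by norm_num) (max ((n : ℝ) - k) 0 - 1)]
    exact inv_anti₀ (by positivity) h3
  have h5 : (2 : ℝ) * 2 ^ n = (2 : ℝ) ^ (1 + (n : ℝ)) := by
    rw [Real.rpow_add (by norm_num), Real.rpow_one, Real.rpow_natCast]
  have h6 : (8 : ℝ) = (2 : ℝ) ^ (3 : ℝ) := by norm_num
  calc (inWeight b η k n)⁻¹ * ((1 + (2 : ℝ) ^ (-(k : ℝ)) * |x|)⁻¹) ^ 2 * (2 * 2 ^ n)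
      ≤ (inWeight b η k n)⁻¹ * ((2 : ℝ) ^ (1 - max ((n : ℝ) - k) 0)) ^ 2 * (2 * 2 ^ n) := by
        have := inWeight_pos b η k n
        gcongr
    _ = (2 : ℝ) ^ (-(2 * b * n - η * |(n : ℝ) - k|) + (1 - max ((n : ℝ) - k) 0) * 2 + (1 + n)) := by
        rw [h5, inWeight, ← Real.rpow_neg (by norm_num), ← Real.rpow_natCast,
          ← Real.rpow_mul (by norm_num), ← Real.rpow_add (by norm_num),
          ← Real.rpow_add (by norm_num)]
        push_cast
        ring_nf
    _ ≤ (2 : ℝ) ^ (3 + (k : ℝ) * (1 - 2 * b) + -(η * |(n : ℝ) - k|)) := by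
        refine two_rpow_le_two_rpow ?_
        rcases le_total (n : ℝ) k with hnk | hnk
        · rw [max_eq_right (by linarith), abs_of_nonpos (by linarith)]
          nlinarith
        · rw [max_eq_left (by linarith), abs_of_nonneg (by linarith)]
          nlinarith
    _ = _ := by
        rw [h6, ← Real.rpow_add (by norm_num), ← Real.rpow_add (by norm_num)]

/-- With `δ = 2^{-k}`: at frequencies above `δ⁻¹` the factor `(δ|x|)⁻¹`, squared, turns the majorant
of the output weight (see `outWeight_le`) into the input weight. -/
theorem high_frequency_le_inWeight {b η : ℝ} (hη : 0 < η) (hη' : η ≤ 1 / 2)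
    (h2 : 2 * η ≤ 1 + 2 * b) {k n : ℕ} {x : ℝ} (hx : x ∈ dyadic n)
    (hx1 : 1 < (2 : ℝ) ^ (-(k : ℝ)) * |x|) :
    (((2 : ℝ) ^ (-(k : ℝ)) * |x|)⁻¹) ^ 2 * (1 + (2 : ℝ) ^ (-(k : ℝ)) * |x|) ^ (1 + η) ≤
      8 * (2 : ℝ) ^ (-(2 * b * k)) * inWeight b η k n := by
  have hδ : (0 : ℝ) < (2 : ℝ) ^ (-(k : ℝ)) := by positivity
  set y : ℝ := (2 : ℝ) ^ (-(k : ℝ)) * |x| with hy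
  have hy0 : 0 < y := by linarith
  have hyle : y ≤ (2 : ℝ) ^ ((n : ℝ) - k) := by
    have h3 := abs_le_of_mem_dyadic hx
    have h4 : (2 : ℝ) ^ ((n : ℝ) - k) = (2 : ℝ) ^ (-(k : ℝ)) * (2 : ℝ) ^ n := by
      rw [← Real.rpow_natCast, ← Real.rpow_add (by norm_num)]
      ring_nf
    rw [h4, hy]
    gcongr
  have hnk : k < n := by
    by_contra hcon
    have h3 : (n : ℝ) ≤ k := by exact_mod_cast not_lt.1 hcon
    have h4 : (2 : ℝ) ^ ((n : ℝ) - k) ≤ 2 ^ (0 : ℝ) := two_rpow_le_two_rpow (by linarith)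
    rw [Real.rpow_zero] at h4
    linarith
  have hnk' : (k : ℝ) + 1 ≤ n := by exact_mod_cast hnk
  have hyge : (2 : ℝ) ^ ((n : ℝ) - k - 1) ≤ y := by
    have h4 := two_rpow_le_abs (by omega) hx
    have h5 : (2 : ℝ) ^ ((n : ℝ) - k - 1) = (2 : ℝ) ^ (-(k : ℝ)) * (2 : ℝ) ^ ((n : ℝ) - 1) := by
      rw [← Real.rpow_add (by norm_num)]
      ring_nf
    rw [h5, hy]
    gcongr
  have e1 : (1 + y) ^ (1 + η) ≤ 4 * y ^ (1 + η) := by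
    calc (1 + y) ^ (1 + η) ≤ (2 * y) ^ (1 + η) :=
          Real.rpow_le_rpow (by linarith) (by linarith) (by linarith)
      _ = (2 : ℝ) ^ (1 + η) * y ^ (1 + η) := Real.mul_rpow (by norm_num) hy0.le
      _ ≤ (2 : ℝ) ^ (2 : ℝ) * y ^ (1 + η) := by
          gcongr
          · norm_num
          · linarith
      _ = 4 * y ^ (1 + η) := by norm_num
  have e2 : (y⁻¹) ^ 2 * y ^ (1 + η) = y ^ (-(1 - η)) := by
    rw [← Real.rpow_natCast, ← Real.rpow_neg_one, ← Real.rpow_mul hy0.le, ← Real.rpow_add hy0]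
    push_cast
    ring_nf
  have e3 : y ^ (-(1 - η)) ≤ (2 : ℝ) ^ (((n : ℝ) - k - 1) * (-(1 - η))) := by
    rw [Real.rpow_mul (by norm_num)]
    exact Real.rpow_le_rpow_of_nonpos (by positivity) hyge (by linarith)
  calc (y⁻¹) ^ 2 * (1 + y) ^ (1 + η) ≤ (y⁻¹) ^ 2 * (4 * y ^ (1 + η)) := by gcongr
    _ = 4 * y ^ (-(1 - η)) := by rw [← e2]; ring
    _ ≤ 4 * (2 : ℝ) ^ (((n : ℝ) - k - 1) * (-(1 - η))) := by gcongr
    _ ≤ 4 * (2 : ℝ) ^ (1 + -(2 * b * k) + (2 * b * n - η * |(n : ℝ) - k|)) := by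
        gcongr
        · norm_num
        · rw [abs_of_nonneg (by linarith)]
          nlinarith
    _ = 8 * (2 : ℝ) ^ (-(2 * b * k)) * inWeight b η k n := by
        rw [inWeight, Real.rpow_add (by norm_num), Real.rpow_add (by norm_num), Real.rpow_one]
        ring

/-! ### A weighted estimate for the kernel of the Duhamel operator -/

theorem lintegral_comp_mul_abs_le {δ : ℝ} (hδ : 0 < δ) :
    ∫⁻ x : ℝ, ENNReal.ofReal (((1 + δ * |x|) ^ 2)⁻¹) =
      ENNReal.ofReal δ⁻¹ * ∫⁻ x : ℝ, ENNReal.ofReal (((1 + |x|) ^ 2)⁻¹) := by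
  have h1 : Measurable fun x : ℝ => ENNReal.ofReal (((1 + |x|) ^ 2)⁻¹) := by fun_prop
  have h2 := lintegral_map (μ := volume) h1 (measurable_const_mul δ)
  rw [Real.map_volume_mul_left hδ.ne', lintegral_smul_measure, smul_eq_mul,
    abs_of_pos (inv_pos.2 hδ)] at h2
  rw [h2]
  simp only [abs_mul, abs_of_pos hδ]

theorem lintegral_one_add_abs_ne_top : ∫⁻ x : ℝ, ENNReal.ofReal (((1 + |x|) ^ 2)⁻¹) ≠ ⊤ := by
  have h := finite_integral_one_add_norm (E := ℝ) (μ := volume) (r := 2) (by simp)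
  refine ne_of_lt (lt_of_le_of_lt (le_of_eq ?_) h)
  refine lintegral_congr fun x => ?_
  rw [Real.rpow_neg (by positivity), Real.norm_eq_abs]
  norm_num

/-- The part of the bound for the Duhamel kernel that is a function of `μ` times one of `ν`. -/
def prodKernel (δ μ ν : ℝ) : ℝ≥0∞ :=
  ENNReal.ofReal (δ ^ 2 * ((1 + δ * |μ|) ^ 4)⁻¹) * ENNReal.ofReal (1 + δ * |ν|)⁻¹

/-- Quadratic decay away from the diagonal, at scale `δ⁻¹`. -/
def decay (δ μ ν : ℝ) : ℝ≥0∞ := ENNReal.ofReal (((1 + δ * |μ - ν|) ^ 2)⁻¹)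

/-- The function `δ² (δ|ν|)⁻¹` cut off to frequencies `|ν| > δ⁻¹`. -/
def highCut (δ ν : ℝ) : ℝ≥0∞ := if 1 < δ * |ν| then ENNReal.ofReal (δ ^ 2 * (δ * |ν|)⁻¹) else 0

/-- The part of the bound for the Duhamel kernel that is concentrated near the diagonal. -/
def diagKernel (δ μ ν : ℝ) : ℝ≥0∞ := decay δ μ ν * (highCut δ ν * decay δ μ ν)

theorem measurable_prodKernel (δ : ℝ) : Measurable (Function.uncurry (prodKernel δ)) := by
  unfold prodKernel Function.uncurry
  fun_prop

theorem measurable_highCut (δ : ℝ) : Measurable (highCut δ) :=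
  Measurable.ite (measurableSet_lt measurable_const (by fun_prop)) (by fun_prop) measurable_const

theorem measurable_decay (δ : ℝ) : Measurable (Function.uncurry (decay δ)) := by
  unfold decay Function.uncurry
  fun_prop

theorem measurable_diagKernel (δ : ℝ) : Measurable (Function.uncurry (diagKernel δ)) :=
  (measurable_decay δ).mul
    (((measurable_highCut δ).comp (measurable_snd : Measurable (Prod.snd : ℝ × ℝ → ℝ))).mul
      (measurable_decay δ))

theorem measurable_decay_left (δ ν : ℝ) : Measurable fun μ => decay δ μ ν := by
  unfold decay
  fun_prop

theorem measurable_decay_right (δ μ : ℝ) : Measurable (decay δ μ) := by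
  unfold decay
  fun_prop

/-- The sum of the squares of the dyadic `L²` norms of `A`, with the input weights. -/
def inSum (b η : ℝ) (k : ℕ) (A : ℝ → ℝ≥0∞) : ℝ≥0∞ :=
  ∑' n, ENNReal.ofReal (inWeight b η k n) * ∫⁻ x in dyadic n, A x ^ 2

/-- The sum of the squares of the dyadic `L²` norms of `A`, with the output weights. -/
def outSum (η : ℝ) (k : ℕ) (A : ℝ → ℝ≥0∞) : ℝ≥0∞ :=
  ∑' n, ENNReal.ofReal (outWeight η k n) * ∫⁻ x in dyadic n, A x ^ 2

/-- The Cauchy–Schwarz inequality against the input weight; it bounds the integral in `ν` of the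
product part of the kernel bound. -/
theorem lintegral_low_sq_le {b η : ℝ} (hη : 0 < η) (h1 : 2 * η ≤ 1 - 2 * b)
    (h2 : 2 * η ≤ 1 + 2 * b) :
    ∃ C : ℝ≥0∞, C ≠ ⊤ ∧ ∀ (k : ℕ) (A : ℝ → ℝ≥0∞), Measurable A →
      (∫⁻ ν, ENNReal.ofReal (1 + (2 : ℝ) ^ (-(k : ℝ)) * |ν|)⁻¹ * A ν) ^ 2 ≤
        C * ENNReal.ofReal ((2 : ℝ) ^ ((k : ℝ) * (1 - 2 * b))) * inSum b η k A := by
  obtain ⟨C, hC, hsum⟩ := tsum_two_rpow_neg_abs_le hη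
  refine ⟨ENNReal.ofReal 8 * C, ENNReal.mul_ne_top ENNReal.ofReal_ne_top hC, fun k A hA => ?_⟩
  have ho : ∀ x, ∃ n, dyadicWeight (fun n => ENNReal.ofReal (inWeight b η k n)) x =
      ENNReal.ofReal (inWeight b η k n) := fun x => by
    obtain ⟨n, hn⟩ := exists_mem_dyadic x
    exact ⟨n, dyadicWeight_of_mem _ hn⟩
  have hcs := lintegral_mul_sq_le_weight volume
    (f := fun ν => ENNReal.ofReal (1 + (2 : ℝ) ^ (-(k : ℝ)) * |ν|)⁻¹) (g := A)
    (o := dyadicWeight (fun n => ENNReal.ofReal (inWeight b η k n)))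
    (by fun_prop) hA.aemeasurable (measurable_dyadicWeight _).aemeasurable
    (fun x => by
      obtain ⟨n, hn⟩ := ho x
      rw [hn]
      exact (ENNReal.ofReal_pos.2 (inWeight_pos b η k n)).ne')
    (fun x => by
      obtain ⟨n, hn⟩ := ho x
      rw [hn]
      exact ENNReal.ofReal_ne_top)
  rw [lintegral_dyadicWeight_mul _ (hA.pow_const 2)] at hcs
  refine hcs.trans (mul_le_mul_left ?_ _)
  rw [lintegral_eq_tsum_dyadic]
  have hn : ∀ n : ℕ, ∫⁻ x in dyadic n,
      (dyadicWeight (fun n => ENNReal.ofReal (inWeight b η k n)) x)⁻¹ *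
        ENNReal.ofReal (1 + (2 : ℝ) ^ (-(k : ℝ)) * |x|)⁻¹ ^ 2 ≤
      ENNReal.ofReal (8 * (2 : ℝ) ^ ((k : ℝ) * (1 - 2 * b))) *
        ENNReal.ofReal ((2 : ℝ) ^ (-(η * |(n : ℝ) - k|))) := by
    intro n
    have h0 : (0 : ℝ) < 2 * 2 ^ n := by positivity
    calc ∫⁻ x in dyadic n, (dyadicWeight (fun n => ENNReal.ofReal (inWeight b η k n)) x)⁻¹ *
          ENNReal.ofReal (1 + (2 : ℝ) ^ (-(k : ℝ)) * |x|)⁻¹ ^ 2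
        ≤ ∫⁻ x in dyadic n, ENNReal.ofReal (8 * (2 : ℝ) ^ ((k : ℝ) * (1 - 2 * b)) *
            (2 : ℝ) ^ (-(η * |(n : ℝ) - k|)) / (2 * 2 ^ n)) := by
          refine setLIntegral_mono measurable_const fun x hx => ?_
          rw [dyadicWeight_of_mem _ hx, ← ENNReal.ofReal_inv_of_pos (inWeight_pos b η k n),
            ← ENNReal.ofReal_pow (by positivity),
            ← ENNReal.ofReal_mul (inv_nonneg.2 (inWeight_pos b η k n).le)]
          refine ENNReal.ofReal_le_ofReal ?_
          rw [le_div_iff₀ h0]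
          exact inWeight_inv_mul_le h1 h2 hx
      _ ≤ ENNReal.ofReal (8 * (2 : ℝ) ^ ((k : ℝ) * (1 - 2 * b)) *
            (2 : ℝ) ^ (-(η * |(n : ℝ) - k|)) / (2 * 2 ^ n)) * ENNReal.ofReal (2 * 2 ^ n) := by
          rw [setLIntegral_const]
          gcongr
          exact volume_dyadic_le n
      _ = _ := by
          rw [← ENNReal.ofReal_mul (by positivity), div_mul_cancel₀ _ h0.ne',
            ENNReal.ofReal_mul (by positivity)]
  refine (ENNReal.tsum_le_tsum hn).trans ?_
  rw [ENNReal.tsum_mul_left, ENNReal.ofReal_mul (by norm_num), mul_assoc, mul_assoc,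
    mul_comm C]
  gcongr
  exact hsum k

theorem one_le_one_add_mul_abs {δ : ℝ} (hδ : 0 < δ) (x : ℝ) : 1 ≤ 1 + δ * |x| := by
  have : 0 ≤ δ * |x| := by positivity
  linarith

theorem outSum_prodKernel_le {b η : ℝ} (hη : 0 < η) (h1 : 2 * η ≤ 1 - 2 * b)
    (h2 : 2 * η ≤ 1 + 2 * b) :
    ∃ C : ℝ≥0∞, C ≠ ⊤ ∧ ∀ (k : ℕ) (A : ℝ → ℝ≥0∞), Measurable A →
      outSum η k (fun μ => ∫⁻ ν, prodKernel ((2 : ℝ) ^ (-(k : ℝ))) μ ν * A ν) ≤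
        C * ENNReal.ofReal ((2 : ℝ) ^ (-((k : ℝ) * (1 + 2 * b)))) * inSum b η k A := by
  obtain ⟨C, hC, hlow⟩ := lintegral_low_sq_le hη h1 h2
  set J := ∫⁻ x : ℝ, ENNReal.ofReal (((1 + |x|) ^ 2)⁻¹) with hJ
  refine ⟨ENNReal.ofReal 4 * J * C, ENNReal.mul_ne_top (ENNReal.mul_ne_top ENNReal.ofReal_ne_top
    lintegral_one_add_abs_ne_top) hC, fun k A hA => ?_⟩
  have hA1 := hlow k A hA
  set I := ∫⁻ ν, ENNReal.ofReal (1 + (2 : ℝ) ^ (-(k : ℝ)) * |ν|)⁻¹ * A ν with hI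
  obtain ⟨δ, hδe⟩ : ∃ δ : ℝ, δ = (2 : ℝ) ^ (-(k : ℝ)) := ⟨_, rfl⟩
  have hδ : 0 < δ := by rw [hδe]; positivity
  rw [← hδe] at hI ⊢
  have hin : ∀ μ, ∫⁻ ν, prodKernel δ μ ν * A ν =
      ENNReal.ofReal (δ ^ 2 * ((1 + δ * |μ|) ^ 4)⁻¹) * I := by
    intro μ
    rw [hI, ← lintegral_const_mul _ (by fun_prop)]
    simp only [prodKernel, mul_assoc]
  have hk : (0 : ℝ) < (2 : ℝ) ^ (k : ℝ) := by positivity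
  have hout : ∑' n, ENNReal.ofReal (outWeight η k n) *
      ∫⁻ μ in dyadic n, ENNReal.ofReal (δ ^ 2 * ((1 + δ * |μ|) ^ 4)⁻¹) ^ 2 ≤
      ENNReal.ofReal (4 * (2 : ℝ) ^ (k : ℝ) * δ ^ 4) * (ENNReal.ofReal δ⁻¹ * J) := by
    rw [hJ, ← lintegral_comp_mul_abs_le hδ, ← lintegral_const_mul _ (by fun_prop),
      lintegral_eq_tsum_dyadic]
    refine ENNReal.tsum_le_tsum fun n => ?_
    rw [← lintegral_const_mul _ (by fun_prop)]
    refine setLIntegral_mono (by fun_prop) fun μ hμ => ?_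
    have hy := one_le_one_add_mul_abs hδ μ
    have hw := outWeight_le hη (by linarith : η ≤ 1 / 2) (k := k) hμ
    rw [← hδe] at hw
    rw [← ENNReal.ofReal_pow (by positivity),
      ← ENNReal.ofReal_mul (by unfold outWeight; positivity),
      ← ENNReal.ofReal_mul (by positivity)]
    refine ENNReal.ofReal_le_ofReal ?_
    have hp : (1 + δ * |μ|) ^ (1 + η) ≤ (1 + δ * |μ|) ^ 2 := by
      rw [← Real.rpow_natCast]
      exact Real.rpow_le_rpow_of_exponent_le hy (by push_cast; linarith)
    have hy0 : 0 < 1 + δ * |μ| := by linarith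
    have hq : ((1 + δ * |μ|) ^ 4)⁻¹ ≤ 1 := inv_le_one_of_one_le₀ (one_le_pow₀ hy)
    calc outWeight η k n * (δ ^ 2 * ((1 + δ * |μ|) ^ 4)⁻¹) ^ 2
        ≤ (4 * (2 : ℝ) ^ (k : ℝ) * (1 + δ * |μ|) ^ 2) * (δ ^ 2 * ((1 + δ * |μ|) ^ 4)⁻¹) ^ 2 := by
          gcongr
          exact hw.trans (by gcongr)
      _ = 4 * (2 : ℝ) ^ (k : ℝ) * δ ^ 4 * (((1 + δ * |μ|) ^ 2)⁻¹ * ((1 + δ * |μ|) ^ 4)⁻¹) := by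
          field_simp
      _ ≤ 4 * (2 : ℝ) ^ (k : ℝ) * δ ^ 4 * (((1 + δ * |μ|) ^ 2)⁻¹ * 1) := by gcongr
      _ = _ := by rw [mul_one]
  have hexp : 4 * (2 : ℝ) ^ (k : ℝ) * δ ^ 4 * δ⁻¹ * (2 : ℝ) ^ ((k : ℝ) * (1 - 2 * b)) =
      4 * (2 : ℝ) ^ (-((k : ℝ) * (1 + 2 * b))) := by
    have e1 : δ ^ 4 * δ⁻¹ = (2 : ℝ) ^ (-(3 * (k : ℝ))) := by
      rw [show δ ^ 4 * δ⁻¹ = δ ^ 3 by field_simp, hδe, ← Real.rpow_natCast,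
        ← Real.rpow_mul (by norm_num)]
      push_cast
      ring_nf
    rw [mul_assoc (4 * (2 : ℝ) ^ (k : ℝ)), e1, mul_assoc, mul_assoc, ← Real.rpow_add (by norm_num),
      ← Real.rpow_add (by norm_num)]
    ring_nf
  calc outSum η k (fun μ => ∫⁻ ν, prodKernel δ μ ν * A ν)
      = (∑' n, ENNReal.ofReal (outWeight η k n) *
          ∫⁻ μ in dyadic n, ENNReal.ofReal (δ ^ 2 * ((1 + δ * |μ|) ^ 4)⁻¹) ^ 2) * I ^ 2 := by
        rw [outSum, ← ENNReal.tsum_mul_right]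
        refine tsum_congr fun n => ?_
        rw [mul_assoc, ← lintegral_mul_const _ (by fun_prop)]
        simp only [hin, mul_pow]
    _ ≤ (ENNReal.ofReal (4 * (2 : ℝ) ^ (k : ℝ) * δ ^ 4) * (ENNReal.ofReal δ⁻¹ * J)) *
          (C * ENNReal.ofReal ((2 : ℝ) ^ ((k : ℝ) * (1 - 2 * b))) * inSum b η k A) := by
        gcongr
    _ = (ENNReal.ofReal (4 * (2 : ℝ) ^ (k : ℝ) * δ ^ 4) * ENNReal.ofReal δ⁻¹ *
          ENNReal.ofReal ((2 : ℝ) ^ ((k : ℝ) * (1 - 2 * b)))) * J * C * inSum b η k A := by ring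
    _ = ENNReal.ofReal (4 * (2 : ℝ) ^ (-((k : ℝ) * (1 + 2 * b)))) * J * C * inSum b η k A := by
        rw [← ENNReal.ofReal_mul (by positivity), ← ENNReal.ofReal_mul (by positivity), hexp]
    _ = _ := by
        rw [ENNReal.ofReal_mul (by norm_num)]
        ring

theorem one_add_mul_abs_le_mul {δ : ℝ} (hδ : 0 < δ) (μ ν : ℝ) :
    1 + δ * |μ| ≤ (1 + δ * |ν|) * (1 + δ * |μ - ν|) := by
  have h1 : |μ| ≤ |ν| + |μ - ν| := by
    have := abs_add_le ν (μ - ν)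
    rwa [add_sub_cancel] at this
  have h2 : 0 ≤ δ * |ν| * (δ * |μ - ν|) := by positivity
  nlinarith

theorem decay_le_one {δ : ℝ} (hδ : 0 < δ) (μ ν : ℝ) : decay δ μ ν ≤ 1 := by
  rw [← ENNReal.ofReal_one]
  exact ENNReal.ofReal_le_ofReal
    (inv_le_one_of_one_le₀ (one_le_pow₀ (one_le_one_add_mul_abs hδ _)))

theorem lintegral_decay_right {δ : ℝ} (hδ : 0 < δ) (μ : ℝ) :
    ∫⁻ ν, decay δ μ ν = ENNReal.ofReal δ⁻¹ * ∫⁻ x : ℝ, ENNReal.ofReal (((1 + |x|) ^ 2)⁻¹) := by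
  rw [← lintegral_comp_mul_abs_le hδ]
  exact lintegral_sub_left_eq_self (fun x => ENNReal.ofReal (((1 + δ * |x|) ^ 2)⁻¹)) μ

theorem lintegral_decay_left {δ : ℝ} (hδ : 0 < δ) (ν : ℝ) :
    ∫⁻ μ, decay δ μ ν = ENNReal.ofReal δ⁻¹ * ∫⁻ x : ℝ, ENNReal.ofReal (((1 + |x|) ^ 2)⁻¹) := by
  rw [← lintegral_comp_mul_abs_le hδ]
  exact lintegral_sub_right_eq_self (fun x => ENNReal.ofReal (((1 + δ * |x|) ^ 2)⁻¹)) ν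

/-- The Cauchy–Schwarz inequality in `ν`, with half of the decay on each factor. -/
theorem lintegral_diagKernel_sq_le {δ : ℝ} (hδ : 0 < δ) {A : ℝ → ℝ≥0∞} (hA : Measurable A)
    (μ : ℝ) :
    (∫⁻ ν, diagKernel δ μ ν * A ν) ^ 2 ≤
      ENNReal.ofReal δ⁻¹ * (∫⁻ x : ℝ, ENNReal.ofReal (((1 + |x|) ^ 2)⁻¹)) *
        ∫⁻ ν, (highCut δ ν * A ν) ^ 2 * decay δ μ ν ^ 2 := by
  have h3 := lintegral_mul_sq_le volume (f := decay δ μ)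
    (g := fun ν => highCut δ ν * A ν * decay δ μ ν) (measurable_decay_right δ μ).aemeasurable
    (((measurable_highCut δ).mul hA).mul (measurable_decay_right δ μ)).aemeasurable
  have h4 : ∫⁻ ν, decay δ μ ν ^ 2 ≤
      ENNReal.ofReal δ⁻¹ * ∫⁻ x : ℝ, ENNReal.ofReal (((1 + |x|) ^ 2)⁻¹) := by
    rw [← lintegral_decay_right hδ μ]
    refine lintegral_mono fun ν => ?_
    rw [sq]
    exact mul_le_of_le_one_left' (decay_le_one hδ μ ν)
  simp only [mul_pow _ (decay δ μ _)] at h3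
  refine le_trans (le_of_eq ?_) (h3.trans (mul_le_mul_left h4 _))
  congr 1
  refine lintegral_congr fun ν => ?_
  rw [diagKernel]
  ring

/-- The majorant of the output weights given by `outWeight_le`; unlike them it is slowly varying at
scale `δ⁻¹`, so it can be moved from `μ` to `ν` at the cost of the decay off the diagonal. -/
def outMajorant (η : ℝ) (k : ℕ) (δ μ : ℝ) : ℝ≥0∞ :=
  ENNReal.ofReal (4 * (2 : ℝ) ^ (k : ℝ) * (1 + δ * |μ|) ^ (1 + η))

theorem measurable_outMajorant (η : ℝ) (k : ℕ) (δ : ℝ) : Measurable (outMajorant η k δ) := by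
  unfold outMajorant
  fun_prop

theorem lintegral_outMajorant_mul_decay_sq_le {η δ : ℝ} (hη : 0 < η) (hη' : η ≤ 1 / 2)
    (hδ : 0 < δ) (k : ℕ) (ν : ℝ) :
    ∫⁻ μ, outMajorant η k δ μ * decay δ μ ν ^ 2 ≤ outMajorant η k δ ν *
      (ENNReal.ofReal δ⁻¹ * ∫⁻ x : ℝ, ENNReal.ofReal (((1 + |x|) ^ 2)⁻¹)) := by
  rw [← lintegral_decay_left hδ ν, ← lintegral_const_mul _ (measurable_decay_left δ ν)]
  refine lintegral_mono fun μ => ?_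
  simp only [outMajorant, decay]
  have hk : (0 : ℝ) < (2 : ℝ) ^ (k : ℝ) := by positivity
  have hy := one_le_one_add_mul_abs hδ (μ - ν)
  have hz := one_le_one_add_mul_abs hδ ν
  have hx := one_le_one_add_mul_abs hδ μ
  have e1 : (1 + δ * |μ|) ^ (1 + η) ≤ (1 + δ * |ν|) ^ (1 + η) * (1 + δ * |μ - ν|) ^ 2 := by
    calc (1 + δ * |μ|) ^ (1 + η) ≤ ((1 + δ * |ν|) * (1 + δ * |μ - ν|)) ^ (1 + η) :=
          Real.rpow_le_rpow (by linarith) (one_add_mul_abs_le_mul hδ μ ν) (by linarith)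
      _ = (1 + δ * |ν|) ^ (1 + η) * (1 + δ * |μ - ν|) ^ (1 + η) :=
          Real.mul_rpow (by linarith) (by linarith)
      _ ≤ (1 + δ * |ν|) ^ (1 + η) * (1 + δ * |μ - ν|) ^ 2 := by
          gcongr
          rw [← Real.rpow_natCast]
          exact Real.rpow_le_rpow_of_exponent_le hy (by push_cast; linarith)
  rw [← ENNReal.ofReal_pow (by positivity), ← ENNReal.ofReal_mul (by positivity),
    ← ENNReal.ofReal_mul (by positivity)]
  refine ENNReal.ofReal_le_ofReal ?_
  generalize (1 + δ * |μ|) ^ (1 + η) = a at e1 ⊢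
  generalize (1 + δ * |ν|) ^ (1 + η) = c at e1 ⊢
  generalize 1 + δ * |μ - ν| = y at e1 hy ⊢
  generalize (2 : ℝ) ^ (k : ℝ) = K at hk ⊢
  have hy0 : 0 < y := by linarith
  calc 4 * K * a * ((y ^ 2)⁻¹) ^ 2 ≤ 4 * K * (c * y ^ 2) * ((y ^ 2)⁻¹) ^ 2 := by gcongr
    _ = 4 * K * c * (y ^ 2)⁻¹ := by field_simp

theorem lintegral_dyadic_highCut_le {b η : ℝ} (hη : 0 < η) (hη' : η ≤ 1 / 2)
    (h2 : 2 * η ≤ 1 + 2 * b) (k n : ℕ) {δ : ℝ} (hδe : δ = (2 : ℝ) ^ (-(k : ℝ)))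
    {A : ℝ → ℝ≥0∞} (hA : Measurable A) :
    ∫⁻ ν in dyadic n, (highCut δ ν * A ν) ^ 2 * outMajorant η k δ ν ≤
      ENNReal.ofReal (32 * (2 : ℝ) ^ (k : ℝ) * δ ^ 4 * (2 : ℝ) ^ (-(2 * b * k))) *
        (ENNReal.ofReal (inWeight b η k n) * ∫⁻ ν in dyadic n, A ν ^ 2) := by
  have hδ : 0 < δ := by rw [hδe]; positivity
  rw [← mul_assoc, ← lintegral_const_mul _ (hA.pow_const 2)]
  refine setLIntegral_mono ((hA.pow_const 2).const_mul _) fun ν hν => ?_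
  simp only [highCut, outMajorant]
  split_ifs with hcut
  · rw [mul_pow, mul_right_comm]
    refine mul_le_mul_left ?_ _
    have h0 := inWeight_pos b η k n
    rw [hδe] at hcut
    have h3 := high_frequency_le_inWeight hη hη' h2 hν hcut
    rw [← hδe] at h3
    rw [← ENNReal.ofReal_pow (by positivity), ← ENNReal.ofReal_mul (by positivity),
      ← ENNReal.ofReal_mul (by positivity)]
    refine ENNReal.ofReal_le_ofReal ?_
    calc (δ ^ 2 * (δ * |ν|)⁻¹) ^ 2 * (4 * (2 : ℝ) ^ (k : ℝ) * (1 + δ * |ν|) ^ (1 + η))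
        = 4 * (2 : ℝ) ^ (k : ℝ) * δ ^ 4 *
          (((δ * |ν|)⁻¹) ^ 2 * (1 + δ * |ν|) ^ (1 + η)) := by ring
      _ ≤ 4 * (2 : ℝ) ^ (k : ℝ) * δ ^ 4 *
          (8 * (2 : ℝ) ^ (-(2 * b * k)) * inWeight b η k n) := by gcongr
      _ = _ := by ring
  · simp

theorem outSum_diagKernel_le_lintegral {η δ : ℝ} (hη : 0 < η) (hη' : η ≤ 1 / 2) (k : ℕ)
    (hδe : δ = (2 : ℝ) ^ (-(k : ℝ))) {A : ℝ → ℝ≥0∞} (hA : Measurable A) :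
    outSum η k (fun μ => ∫⁻ ν, diagKernel δ μ ν * A ν) ≤
      ENNReal.ofReal δ⁻¹ * (∫⁻ x : ℝ, ENNReal.ofReal (((1 + |x|) ^ 2)⁻¹)) *
        ∫⁻ ν, (highCut δ ν * A ν) ^ 2 * ∫⁻ μ, outMajorant η k δ μ * decay δ μ ν ^ 2 := by
  have hδ : 0 < δ := by rw [hδe]; positivity
  have hWm := measurable_outMajorant η k δ
  have hPm := measurable_decay δ
  have hQAm : Measurable fun ν => (highCut δ ν * A ν) ^ 2 :=
    ((measurable_highCut δ).mul hA).pow_const 2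
  have hint : Measurable fun μ => ∫⁻ ν, (highCut δ ν * A ν) ^ 2 * decay δ μ ν ^ 2 := by
    refine Measurable.lintegral_prod_right' (f := fun p : ℝ × ℝ =>
      (highCut δ p.2 * A p.2) ^ 2 * decay δ p.1 p.2 ^ 2) ?_
    exact (hQAm.comp measurable_snd).mul (hPm.pow_const 2)
  have hprod : Measurable fun p : ℝ × ℝ =>
      (highCut δ p.2 * A p.2) ^ 2 * (outMajorant η k δ p.1 * decay δ p.1 p.2 ^ 2) :=
    (hQAm.comp measurable_snd).mul ((hWm.comp measurable_fst).mul (hPm.pow_const 2))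
  generalize hJ : (∫⁻ x : ℝ, ENNReal.ofReal (((1 + |x|) ^ 2)⁻¹)) = J
  calc outSum η k (fun μ => ∫⁻ ν, diagKernel δ μ ν * A ν)
      ≤ ∑' n, ∫⁻ μ in dyadic n, outMajorant η k δ μ * (ENNReal.ofReal δ⁻¹ * J *
          ∫⁻ ν, (highCut δ ν * A ν) ^ 2 * decay δ μ ν ^ 2) := by
        refine ENNReal.tsum_le_tsum fun n => ?_
        refine (lintegral_const_mul_le _ _).trans ?_
        refine setLIntegral_mono (hWm.mul (hint.const_mul _)) fun μ hμ => ?_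
        rw [← hJ]
        refine mul_le_mul' ?_ (lintegral_diagKernel_sq_le hδ hA μ)
        refine ENNReal.ofReal_le_ofReal ?_
        rw [hδe]
        exact outWeight_le hη hη' hμ
    _ = ENNReal.ofReal δ⁻¹ * J * ∫⁻ μ, ∫⁻ ν,
          (highCut δ ν * A ν) ^ 2 * (outMajorant η k δ μ * decay δ μ ν ^ 2) := by
        rw [← lintegral_eq_tsum_dyadic, ← lintegral_const_mul _ hprod.lintegral_prod_right']
        refine lintegral_congr fun μ => ?_
        rw [mul_left_comm, ← lintegral_const_mul
          (f := fun ν => (highCut δ ν * A ν) ^ 2 * decay δ μ ν ^ 2) _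
          (hQAm.mul ((measurable_decay_right δ μ).pow_const 2))]
        congr 1
        refine lintegral_congr fun ν => ?_
        exact mul_left_comm _ _ _
    _ = _ := by
        rw [lintegral_lintegral_swap hprod.aemeasurable]
        congr 1
        refine lintegral_congr fun ν => ?_
        exact lintegral_const_mul _ (hWm.mul ((measurable_decay_left δ ν).pow_const 2))

theorem outSum_diagKernel_le {b η : ℝ} (hη : 0 < η) (h1 : 2 * η ≤ 1 - 2 * b)
    (h2 : 2 * η ≤ 1 + 2 * b) :
    ∃ C : ℝ≥0∞, C ≠ ⊤ ∧ ∀ (k : ℕ) (A : ℝ → ℝ≥0∞), Measurable A →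
      outSum η k (fun μ => ∫⁻ ν, diagKernel ((2 : ℝ) ^ (-(k : ℝ))) μ ν * A ν) ≤
        C * ENNReal.ofReal ((2 : ℝ) ^ (-((k : ℝ) * (1 + 2 * b)))) * inSum b η k A := by
  have hη' : η ≤ 1 / 2 := by linarith
  refine ⟨ENNReal.ofReal 32 * (∫⁻ x : ℝ, ENNReal.ofReal (((1 + |x|) ^ 2)⁻¹)) *
    (∫⁻ x : ℝ, ENNReal.ofReal (((1 + |x|) ^ 2)⁻¹)),
    ENNReal.mul_ne_top (ENNReal.mul_ne_top ENNReal.ofReal_ne_top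
    lintegral_one_add_abs_ne_top) lintegral_one_add_abs_ne_top, fun k A hA => ?_⟩
  obtain ⟨δ, hδe⟩ : ∃ δ : ℝ, δ = (2 : ℝ) ^ (-(k : ℝ)) := ⟨_, rfl⟩
  have hδ : 0 < δ := by rw [hδe]; positivity
  rw [← hδe]
  have hmain := outSum_diagKernel_le_lintegral hη hη' k hδe hA
  have hWP := lintegral_outMajorant_mul_decay_sq_le hη hη' hδ k
  generalize (∫⁻ x : ℝ, ENNReal.ofReal (((1 + |x|) ^ 2)⁻¹)) = J at hmain hWP ⊢
  have hexp : δ⁻¹ * δ⁻¹ * (32 * (2 : ℝ) ^ (k : ℝ) * δ ^ 4 * (2 : ℝ) ^ (-(2 * b * k))) =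
      32 * (2 : ℝ) ^ (-((k : ℝ) * (1 + 2 * b))) := by
    have e1 : δ ^ 2 = (2 : ℝ) ^ (-(2 * (k : ℝ))) := by
      rw [hδe, ← Real.rpow_natCast, ← Real.rpow_mul (by norm_num)]
      push_cast
      ring_nf
    calc δ⁻¹ * δ⁻¹ * (32 * (2 : ℝ) ^ (k : ℝ) * δ ^ 4 * (2 : ℝ) ^ (-(2 * b * k)))
        = (δ⁻¹ * δ) ^ 2 * (32 * ((2 : ℝ) ^ (k : ℝ) * δ ^ 2 * (2 : ℝ) ^ (-(2 * b * k)))) := by ring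
      _ = _ := by
        rw [inv_mul_cancel₀ hδ.ne', one_pow, one_mul, e1, ← Real.rpow_add (by norm_num),
          ← Real.rpow_add (by norm_num)]
        ring_nf
  have hQAm : Measurable fun ν => (highCut δ ν * A ν) ^ 2 :=
    ((measurable_highCut δ).mul hA).pow_const 2
  calc outSum η k (fun μ => ∫⁻ ν, diagKernel δ μ ν * A ν)
      ≤ ENNReal.ofReal δ⁻¹ * J *
          ∫⁻ ν, (highCut δ ν * A ν) ^ 2 * (outMajorant η k δ ν * (ENNReal.ofReal δ⁻¹ * J)) := by
        refine hmain.trans ?_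
        gcongr with ν
        exact hWP ν
    _ = ENNReal.ofReal δ⁻¹ * J *
          ((∑' n, ∫⁻ ν in dyadic n, (highCut δ ν * A ν) ^ 2 * outMajorant η k δ ν) *
          (ENNReal.ofReal δ⁻¹ * J)) := by
        rw [← lintegral_eq_tsum_dyadic,
          ← lintegral_mul_const (f := fun ν => (highCut δ ν * A ν) ^ 2 * outMajorant η k δ ν) _
            (hQAm.mul (measurable_outMajorant η k δ))]
        simp only [mul_assoc]
    _ ≤ ENNReal.ofReal δ⁻¹ * J * ((∑' n,
          ENNReal.ofReal (32 * (2 : ℝ) ^ (k : ℝ) * δ ^ 4 * (2 : ℝ) ^ (-(2 * b * k))) *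
            (ENNReal.ofReal (inWeight b η k n) * ∫⁻ ν in dyadic n, A ν ^ 2)) *
          (ENNReal.ofReal δ⁻¹ * J)) := by
        gcongr with n
        exact lintegral_dyadic_highCut_le hη hη' h2 k n hδe hA
    _ = (ENNReal.ofReal δ⁻¹ * ENNReal.ofReal δ⁻¹ *
          ENNReal.ofReal (32 * (2 : ℝ) ^ (k : ℝ) * δ ^ 4 * (2 : ℝ) ^ (-(2 * b * k)))) * J * J *
          inSum b η k A := by
        rw [ENNReal.tsum_mul_left, inSum]
        ring
    _ = _ := by
        rw [← ENNReal.ofReal_mul (by positivity), ← ENNReal.ofReal_mul (by positivity), hexp,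
          ENNReal.ofReal_mul (by norm_num)]
        ring

/-- The Duhamel operator gains `δ^{1/2 + b}`, in a weighted `L²` form, where `δ = 2^{-k}`. -/
theorem outSum_kernel_le {b η : ℝ} (hη : 0 < η) (h1 : 2 * η ≤ 1 - 2 * b)
    (h2 : 2 * η ≤ 1 + 2 * b) :
    ∃ C : ℝ≥0∞, C ≠ ⊤ ∧ ∀ (k : ℕ) (A : ℝ → ℝ≥0∞), Measurable A →
      outSum η k (fun μ => ∫⁻ ν, (prodKernel ((2 : ℝ) ^ (-(k : ℝ))) μ ν +
        diagKernel ((2 : ℝ) ^ (-(k : ℝ))) μ ν) * A ν) ≤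
        C * ENNReal.ofReal ((2 : ℝ) ^ (-((k : ℝ) * (1 + 2 * b)))) * inSum b η k A := by
  obtain ⟨C₁, hC₁, hp⟩ := outSum_prodKernel_le hη h1 h2
  obtain ⟨C₂, hC₂, hd⟩ := outSum_diagKernel_le hη h1 h2
  refine ⟨2 * (C₁ + C₂), ENNReal.mul_ne_top (by norm_num) (ENNReal.add_ne_top.2 ⟨hC₁, hC₂⟩),
    fun k A hA => ?_⟩
  set δ : ℝ := (2 : ℝ) ^ (-(k : ℝ)) with hδ
  have hm1 : Measurable fun p : ℝ × ℝ => prodKernel δ p.1 p.2 * A p.2 :=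
    (measurable_prodKernel δ).mul (hA.comp measurable_snd)
  have hm2 : Measurable fun p : ℝ × ℝ => diagKernel δ p.1 p.2 * A p.2 :=
    (measurable_diagKernel δ).mul (hA.comp measurable_snd)
  have hI1 : Measurable fun μ => (∫⁻ ν, prodKernel δ μ ν * A ν) ^ 2 :=
    hm1.lintegral_prod_right'.pow_const 2
  have hI2 : Measurable fun μ => (∫⁻ ν, diagKernel δ μ ν * A ν) ^ 2 :=
    hm2.lintegral_prod_right'.pow_const 2
  calc outSum η k (fun μ => ∫⁻ ν, (prodKernel δ μ ν + diagKernel δ μ ν) * A ν)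
      ≤ ∑' n, (2 * (ENNReal.ofReal (outWeight η k n) *
            ∫⁻ μ in dyadic n, (∫⁻ ν, prodKernel δ μ ν * A ν) ^ 2) +
          2 * (ENNReal.ofReal (outWeight η k n) *
            ∫⁻ μ in dyadic n, (∫⁻ ν, diagKernel δ μ ν * A ν) ^ 2)) := by
        refine ENNReal.tsum_le_tsum fun n => ?_
        have h3 : ∫⁻ μ in dyadic n, (∫⁻ ν, (prodKernel δ μ ν + diagKernel δ μ ν) * A ν) ^ 2 ≤
            2 * ((∫⁻ μ in dyadic n, (∫⁻ ν, prodKernel δ μ ν * A ν) ^ 2) +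
              ∫⁻ μ in dyadic n, (∫⁻ ν, diagKernel δ μ ν * A ν) ^ 2) := by
          rw [← lintegral_add_left hI1, ← lintegral_const_mul
            (f := fun μ => (∫⁻ ν, prodKernel δ μ ν * A ν) ^ 2 +
              (∫⁻ ν, diagKernel δ μ ν * A ν) ^ 2) 2 (hI1.add hI2)]
          refine lintegral_mono fun μ => ?_
          simp only [add_mul]
          have hm3 : Measurable fun ν => prodKernel δ μ ν * A ν := by
            unfold prodKernel
            fun_prop
          rw [lintegral_add_left hm3]
          exact add_sq_le_two_mul _ _
        refine (mul_le_mul_right h3 _).trans (le_of_eq ?_)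
        ring
    _ = 2 * (outSum η k (fun μ => ∫⁻ ν, prodKernel δ μ ν * A ν) +
          outSum η k (fun μ => ∫⁻ ν, diagKernel δ μ ν * A ν)) := by
        rw [ENNReal.tsum_add, ENNReal.tsum_mul_left, ENNReal.tsum_mul_left, mul_add]
        rfl
    _ ≤ 2 * (C₁ * ENNReal.ofReal ((2 : ℝ) ^ (-((k : ℝ) * (1 + 2 * b)))) * inSum b η k A +
          C₂ * ENNReal.ofReal ((2 : ℝ) ^ (-((k : ℝ) * (1 + 2 * b)))) * inSum b η k A) := by
        gcongr
        · exact hp k A hA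
        · exact hd k A hA
    _ = _ := by ring

/-! ### The time cutoff on the Fourier side -/

/-- A Schwartz function on the line whose inverse Fourier transform is a smooth cutoff, equal to `1`
on `[-1, 1]` (see `integral_exp_mul_kappa`). -/
def kappa : 𝓢(ℝ, ℂ) :=
  (((2 * Real.pi)⁻¹ : ℝ) : ℂ) •
    schwartzHat ℝ (testFunction (cutoff ℝ) contDiff_cutoff hasCompactSupport_cutoff)

theorem integral_exp_mul_kappa {t : ℝ} (ht : |t| ≤ 1) :
    ∫ x, Complex.exp (Complex.I * (t * x : ℝ)) * kappa x = 1 := by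
  have h1 := schwartzHatInv_apply (schwartzHat ℝ
    (testFunction (cutoff ℝ) contDiff_cutoff hasCompactSupport_cutoff)) t
  rw [schwartzHatInv_schwartzHat, testFunction_apply,
    cutoff_eq_one (by rwa [Real.norm_eq_abs]), Module.finrank_self, pow_one] at h1
  have h2 : ∀ x : ℝ, Complex.exp (Complex.I * (t * x : ℝ)) * kappa x = ((2 * Real.pi : ℝ) : ℂ)⁻¹ *
      (Complex.exp (Complex.I * (inner ℝ x t : ℝ)) * schwartzHat ℝ
        (testFunction (cutoff ℝ) contDiff_cutoff hasCompactSupport_cutoff) x) := by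
    intro x
    have : kappa x = (((2 * Real.pi)⁻¹ : ℝ) : ℂ) * schwartzHat ℝ
        (testFunction (cutoff ℝ) contDiff_cutoff hasCompactSupport_cutoff) x := rfl
    rw [this]
    simp only [Real.inner_apply]
    push_cast
    rw [mul_comm (x : ℂ)]
    ring
  simp only [h2]
  rw [integral_const_mul]
  push_cast at h1 ⊢
  exact h1.symm

theorem norm_exp_I_mul (x : ℝ) : ‖Complex.exp (Complex.I * (x : ℝ))‖ = 1 := by
  rw [mul_comm]
  exact Complex.norm_exp_ofReal_mul_I x

theorem integrable_exp_mul {f : ℝ → ℂ} (hf : Integrable f) (t : ℝ) :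
    Integrable fun x => Complex.exp (Complex.I * (t * x : ℝ)) * f x := by
  refine hf.bdd_mul (c := 1) (by fun_prop) (Eventually.of_forall fun x => ?_)
  rw [norm_exp_I_mul]

theorem integrable_id_mul_schwartz (f : 𝓢(ℝ, ℂ)) : Integrable fun x : ℝ => (x : ℂ) * f x := by
  have h := f.integrable_pow_mul volume 1
  refine h.mono' (by fun_prop) (Eventually.of_forall fun x => ?_)
  rw [norm_mul, Complex.norm_real, pow_one]

theorem hasDerivAt_integral_exp_mul {f : ℝ → ℂ} (hf : Integrable f)
    (hf' : Integrable fun x : ℝ => (x : ℂ) * f x) (t : ℝ) :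
    HasDerivAt (fun t : ℝ => ∫ x : ℝ, Complex.exp (Complex.I * (t * x : ℝ)) * f x)
      (∫ x : ℝ, Complex.exp (Complex.I * (t * x : ℝ)) * (Complex.I * (x * f x))) t := by
  refine (hasDerivAt_integral_of_dominated_loc_of_deriv_le (s := Set.univ)
    (F' := fun (t : ℝ) (x : ℝ) =>
      Complex.exp (Complex.I * (t * x : ℝ)) * (Complex.I * (x * f x)))
    (bound := fun x : ℝ => ‖(x : ℂ) * f x‖) univ_mem
    (Eventually.of_forall fun s => (integrable_exp_mul hf s).aestronglyMeasurable)
    (integrable_exp_mul hf t) (integrable_exp_mul (hf'.const_mul Complex.I) t).aestronglyMeasurable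
    (Eventually.of_forall fun x s _ => ?_) hf'.norm (Eventually.of_forall fun x s _ => ?_)).2
  · rw [norm_mul, norm_exp_I_mul, norm_mul, Complex.norm_I, one_mul, one_mul]
  · have h1 : HasDerivAt (fun s : ℝ => Complex.I * ((s * x : ℝ) : ℂ)) (Complex.I * x) s := by
      have h2 : HasDerivAt (fun s : ℝ => s * x) x s := by
        simpa using (hasDerivAt_id s).mul_const x
      exact h2.ofReal_comp.const_mul Complex.I
    have h3 := h1.cexp.mul_const (f x)
    rw [mul_assoc, mul_assoc] at h3
    exact h3

/-- The free evolution `κ` solves the homogeneous equation on `(-1, 1)`, where its inverse transform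
is constant. -/
theorem integral_exp_mul_id_mul_kappa {t : ℝ} (ht : |t| < 1) :
    ∫ x : ℝ, Complex.exp (Complex.I * (t * x : ℝ)) * (x * kappa x) = 0 := by
  have h1 := hasDerivAt_integral_exp_mul kappa.integrable (integrable_id_mul_schwartz kappa) t
  -- the derivative of the function that is constant by `integral_exp_mul_kappa`
  have h2 : (fun t : ℝ => ∫ x, Complex.exp (Complex.I * (t * x : ℝ)) * kappa x) =ᶠ[𝓝 t]
      fun _ => 1 := by
    filter_upwards [(isOpen_lt continuous_abs continuous_const).mem_nhds ht] with s hs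
    exact integral_exp_mul_kappa (le_of_lt hs)
  have h3 := h1.unique ((hasDerivAt_const t (1 : ℂ)).congr_of_eventuallyEq h2)
  have h4 : ∀ x : ℝ, Complex.exp (Complex.I * (t * x : ℝ)) * (Complex.I * (x * kappa x)) =
      Complex.I * (Complex.exp (Complex.I * (t * x : ℝ)) * (x * kappa x)) := fun x => by ring
  simp only [h4] at h3
  rw [integral_const_mul] at h3
  exact (mul_eq_zero.1 h3).resolve_left Complex.I_ne_zero

theorem exists_norm_le_schwartz (f : 𝓢(ℝ, ℂ)) :
    ∃ C : ℝ, 0 ≤ C ∧ ∀ x : ℝ, ‖f x‖ ≤ C * ((1 + |x|) ^ 4)⁻¹ := by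
  refine ⟨2 ^ 4 * (Finset.Iic (4, 0)).sup (fun m : ℕ × ℕ => SchwartzMap.seminorm ℝ m.1 m.2) f,
    by positivity, fun x => ?_⟩
  have h := SchwartzMap.one_add_le_sup_seminorm_apply (𝕜 := ℝ) (m := (4, 0)) (k := 4) (n := 0)
    le_rfl le_rfl f x
  rw [norm_iteratedFDeriv_zero, Real.norm_eq_abs] at h
  rw [← div_eq_mul_inv, le_div_iff₀ (by positivity), mul_comm]
  exact h

theorem exists_norm_sub_le_schwartz (f : 𝓢(ℝ, ℂ)) :
    ∃ C : ℝ, 0 ≤ C ∧ ∀ x y : ℝ, |y| ≤ 1 → ‖f (x - y) - f x‖ ≤ C * |y| * ((1 + |x|) ^ 4)⁻¹ := by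
  obtain ⟨C, hC, hb⟩ := exists_norm_le_schwartz (SchwartzMap.derivCLM ℂ ℂ f)
  refine ⟨16 * C, by positivity, fun x y hy => ?_⟩
  have h1 : ∀ z ∈ Metric.closedBall x 1, ‖deriv f z‖ ≤ 16 * C * ((1 + |x|) ^ 4)⁻¹ := by
    intro z hz
    have h2 := hb z
    rw [SchwartzMap.derivCLM_apply] at h2
    refine h2.trans ?_
    have h3 : |x| ≤ |z| + 1 := by
      have h4 : |z - x| ≤ 1 := by simpa [Real.dist_eq] using hz
      have h5 := abs_sub_abs_le_abs_sub x z
      rw [abs_sub_comm] at h5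
      linarith
    have h4 : (1 + |x|) ^ 4 ≤ 16 * (1 + |z|) ^ 4 := by
      calc (1 + |x|) ^ 4 ≤ (2 * (1 + |z|)) ^ 4 := by
            gcongr
            linarith [abs_nonneg z]
        _ = _ := by ring
    rw [mul_comm 16 C, mul_assoc]
    gcongr
    rw [← div_eq_mul_inv, le_div_iff₀ (by positivity), inv_mul_le_iff₀ (by positivity),
      mul_comm]
    exact h4
  have h2 := (convex_closedBall x 1).norm_image_sub_le_of_norm_deriv_le
    (fun z _ => f.differentiable.differentiableAt) h1 (x := x) (y := x - y)
    (Metric.mem_closedBall_self zero_le_one) (by simpa [Real.dist_eq] using hy)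
  rw [sub_sub_cancel_left, norm_neg, Real.norm_eq_abs] at h2
  linarith

/-! ### The kernel of the Duhamel operator -/

/-- The kernel of the Duhamel operator `g ↦ i ∫₀ᵗ g`, cut off to times of size `δ`, on the Fourier
side: for `|t| ≤ δ` the integral of `e^{itμ} K(μ, ν)` in `μ` is
`(e^{itν} - 1)/ν = i ∫₀ᵗ e^{irν} dr`. The value at `ν = 0` is the junk value `0`, which does no harm
since `{0}` is a null set. -/
def duhamelKernel (δ μ ν : ℝ) : ℂ := δ * (kappa (δ * (μ - ν)) - kappa (δ * μ)) / ν

theorem measurable_duhamelKernel (δ : ℝ) : Measurable (Function.uncurry (duhamelKernel δ)) := by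
  unfold duhamelKernel Function.uncurry
  have h1 : Measurable fun p : ℝ × ℝ => kappa (δ * (p.1 - p.2)) :=
    kappa.continuous.measurable.comp (by fun_prop)
  have h2 : Measurable fun p : ℝ × ℝ => kappa (δ * p.1) :=
    kappa.continuous.measurable.comp (by fun_prop)
  fun_prop

/-- At frequencies `|ν| ≤ δ⁻¹` the mean value theorem for `κ` compensates the division by `ν`. -/
theorem norm_duhamelKernel_le_of_low {C δ μ ν : ℝ} (hδ : 0 < δ) (hν : δ * |ν| ≤ 1)
    (hb : ∀ x y : ℝ, |y| ≤ 1 → ‖kappa (x - y) - kappa x‖ ≤ C * |y| * ((1 + |x|) ^ 4)⁻¹)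
    (hC : 0 ≤ C) :
    ‖duhamelKernel δ μ ν‖ ≤ 2 * C * (δ ^ 2 * ((1 + δ * |μ|) ^ 4)⁻¹) * (1 + δ * |ν|)⁻¹ := by
  have h1 := hb (δ * μ) (δ * ν) (by rwa [abs_mul, abs_of_pos hδ])
  rw [abs_mul, abs_mul, abs_of_pos hδ, ← mul_sub] at h1
  have h3 : (1 : ℝ) ≤ 2 * (1 + δ * |ν|)⁻¹ := by
    rw [← div_eq_mul_inv, le_div_iff₀ (by positivity)]
    linarith
  rw [duhamelKernel, norm_div, norm_mul, Complex.norm_real, Complex.norm_real,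
    Real.norm_of_nonneg hδ.le, Real.norm_eq_abs]
  rcases eq_or_ne ν 0 with rfl | hν0
  · rw [abs_zero, div_zero]
    positivity
  have h2 : 0 < |ν| := abs_pos.2 hν0
  rw [div_le_iff₀ h2]
  calc δ * ‖kappa (δ * (μ - ν)) - kappa (δ * μ)‖
      ≤ δ * (C * (δ * |ν|) * ((1 + δ * |μ|) ^ 4)⁻¹) := by gcongr
    _ = C * (δ ^ 2 * ((1 + δ * |μ|) ^ 4)⁻¹) * |ν| * 1 := by ring
    _ ≤ C * (δ ^ 2 * ((1 + δ * |μ|) ^ 4)⁻¹) * |ν| * (2 * (1 + δ * |ν|)⁻¹) := by gcongr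
    _ = _ := by ring

/-- At frequencies `|ν| > δ⁻¹` the two terms of the kernel are bounded separately. -/
theorem norm_duhamelKernel_le_of_high {C δ μ ν : ℝ} (hδ : 0 < δ) (hν : 1 < δ * |ν|)
    (hb : ∀ x : ℝ, ‖kappa x‖ ≤ C * ((1 + |x|) ^ 4)⁻¹) (hC : 0 ≤ C) :
    ‖duhamelKernel δ μ ν‖ ≤ 2 * C * (δ ^ 2 * ((1 + δ * |μ|) ^ 4)⁻¹) * (1 + δ * |ν|)⁻¹ +
      2 * C * (δ ^ 2 * (δ * |ν|)⁻¹) * (((1 + δ * |μ - ν|) ^ 4)⁻¹) := by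
  have h1 := hb (δ * (μ - ν))
  have h2 := hb (δ * μ)
  rw [abs_mul, abs_of_pos hδ] at h1 h2
  have h0 : 0 < δ * |ν| := by linarith
  have h3 : (δ * |ν|)⁻¹ ≤ 2 * (1 + δ * |ν|)⁻¹ := by
    rw [← div_eq_mul_inv, le_div_iff₀ (by positivity), inv_mul_le_iff₀ h0]
    linarith
  rw [duhamelKernel, norm_div, norm_mul, Complex.norm_real, Complex.norm_real,
    Real.norm_of_nonneg hδ.le, Real.norm_eq_abs]
  calc δ * ‖kappa (δ * (μ - ν)) - kappa (δ * μ)‖ / |ν|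
      ≤ δ * (C * ((1 + δ * |μ - ν|) ^ 4)⁻¹ + C * ((1 + δ * |μ|) ^ 4)⁻¹) / |ν| := by
        gcongr
        exact (norm_sub_le _ _).trans (add_le_add h1 h2)
    _ = C * (δ ^ 2 * ((1 + δ * |μ|) ^ 4)⁻¹) * (δ * |ν|)⁻¹ +
        C * (δ ^ 2 * (δ * |ν|)⁻¹) * (((1 + δ * |μ - ν|) ^ 4)⁻¹) := by
        field_simp
        ring
    _ ≤ C * (δ ^ 2 * ((1 + δ * |μ|) ^ 4)⁻¹) * (2 * (1 + δ * |ν|)⁻¹) +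
        2 * C * (δ ^ 2 * (δ * |ν|)⁻¹) * (((1 + δ * |μ - ν|) ^ 4)⁻¹) := by
        gcongr
        linarith
    _ = _ := by ring

theorem exists_enorm_duhamelKernel_le :
    ∃ C : ℝ≥0∞, C ≠ ⊤ ∧ ∀ δ μ ν : ℝ, 0 < δ →
      ‖duhamelKernel δ μ ν‖ₑ ≤ C * (prodKernel δ μ ν + diagKernel δ μ ν) := by
  obtain ⟨C₁, hC₁, h1⟩ := exists_norm_le_schwartz kappa
  obtain ⟨C₂, hC₂, h2⟩ := exists_norm_sub_le_schwartz kappa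
  refine ⟨ENNReal.ofReal (2 * C₁ + 2 * C₂), ENNReal.ofReal_ne_top, fun δ μ ν hδ => ?_⟩
  have hp : ∀ {C : ℝ}, 0 ≤ C → ENNReal.ofReal
      (2 * C * (δ ^ 2 * ((1 + δ * |μ|) ^ 4)⁻¹) * (1 + δ * |ν|)⁻¹) =
      ENNReal.ofReal (2 * C) * prodKernel δ μ ν := by
    intro C hC
    rw [prodKernel, mul_assoc, ENNReal.ofReal_mul (p := 2 * C) (by positivity),
      ENNReal.ofReal_mul (p := δ ^ 2 * ((1 + δ * |μ|) ^ 4)⁻¹) (by positivity)]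
  rw [← ofReal_norm]
  rcases le_or_gt (δ * |ν|) 1 with hν | hν
  · refine (ENNReal.ofReal_le_ofReal (norm_duhamelKernel_le_of_low hδ hν h2 hC₂)).trans ?_
    rw [hp hC₂]
    gcongr
    · linarith
    · exact le_self_add
  · refine (ENNReal.ofReal_le_ofReal (norm_duhamelKernel_le_of_high hδ hν h1 hC₁)).trans ?_
    have hd : ENNReal.ofReal (2 * C₁ * (δ ^ 2 * (δ * |ν|)⁻¹) * (((1 + δ * |μ - ν|) ^ 4)⁻¹)) =
        ENNReal.ofReal (2 * C₁) * diagKernel δ μ ν := by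
      rw [diagKernel, highCut, if_pos hν, decay, ← ENNReal.ofReal_mul (by positivity),
        ← ENNReal.ofReal_mul (by positivity), ← ENNReal.ofReal_mul (by positivity)]
      congr 1
      generalize 1 + δ * |μ - ν| = y
      rw [show y ^ 4 = y ^ 2 * y ^ 2 by ring, mul_inv (y ^ 2)]
      generalize (y ^ 2)⁻¹ = z
      ring
    rw [ENNReal.ofReal_add (by positivity) (by positivity), hp hC₁, hd, ← mul_add]
    gcongr
    linarith

/-- For fixed `ν` the majorant of the Duhamel kernel is at most an integrable function of `μ` times
`(1 + δ|ν|)⁻¹`. -/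
theorem prodKernel_add_diagKernel_le {δ : ℝ} (hδ : 0 < δ) (μ ν : ℝ) :
    prodKernel δ μ ν + diagKernel δ μ ν ≤ ENNReal.ofReal (2 * δ ^ 2) *
      (ENNReal.ofReal (((1 + δ * |μ|) ^ 2)⁻¹) + decay δ μ ν) * ENNReal.ofReal (1 + δ * |ν|)⁻¹ := by
  have hμ := one_le_one_add_mul_abs hδ μ
  have h1 : prodKernel δ μ ν ≤ ENNReal.ofReal (2 * δ ^ 2) * ENNReal.ofReal (((1 + δ * |μ|) ^ 2)⁻¹) *
      ENNReal.ofReal (1 + δ * |ν|)⁻¹ := by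
    rw [prodKernel, ← ENNReal.ofReal_mul (p := 2 * δ ^ 2) (by positivity)]
    refine mul_le_mul_left (ENNReal.ofReal_le_ofReal ?_) _
    have h2 : ((1 + δ * |μ|) ^ 4)⁻¹ ≤ ((1 + δ * |μ|) ^ 2)⁻¹ :=
      inv_anti₀ (by positivity) (pow_le_pow_right₀ hμ (by norm_num))
    have h3 : (0 : ℝ) ≤ ((1 + δ * |μ|) ^ 2)⁻¹ := by positivity
    have h4 : (0 : ℝ) < δ ^ 2 := by positivity
    nlinarith
  have h2 : highCut δ ν ≤ ENNReal.ofReal (2 * δ ^ 2) * ENNReal.ofReal (1 + δ * |ν|)⁻¹ := by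
    rw [highCut]
    split_ifs with hν
    · rw [← ENNReal.ofReal_mul (by positivity)]
      refine ENNReal.ofReal_le_ofReal ?_
      have h0 : 0 < δ * |ν| := by linarith
      have h3 : (δ * |ν|)⁻¹ ≤ 2 * (1 + δ * |ν|)⁻¹ := by
        rw [← div_eq_mul_inv, le_div_iff₀ (by positivity), inv_mul_le_iff₀ h0]
        linarith
      calc δ ^ 2 * (δ * |ν|)⁻¹ ≤ δ ^ 2 * (2 * (1 + δ * |ν|)⁻¹) := by gcongr
        _ = _ := by ring
    · exact zero_le
  have h3 : diagKernel δ μ ν ≤ ENNReal.ofReal (2 * δ ^ 2) * decay δ μ ν *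
      ENNReal.ofReal (1 + δ * |ν|)⁻¹ := by
    calc diagKernel δ μ ν ≤ decay δ μ ν *
          (ENNReal.ofReal (2 * δ ^ 2) * ENNReal.ofReal (1 + δ * |ν|)⁻¹ * 1) := by
          rw [diagKernel]
          gcongr
          exact decay_le_one hδ μ ν
      _ = _ := by ring
  calc prodKernel δ μ ν + diagKernel δ μ ν ≤ _ := add_le_add h1 h3
    _ = _ := by ring

/-- For `|t| ≤ δ` the time cutoff is invisible, and `δ κ(δ(· - ν))` acts as a point mass at `ν`. -/
theorem integral_scaled_kappa {δ t ν : ℝ} (hδ : 0 < δ) (ht : |t| ≤ δ) :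
    ∫ μ : ℝ, Complex.exp (Complex.I * (t * μ : ℝ)) * (δ * kappa (δ * (μ - ν))) =
      Complex.exp (Complex.I * (t * ν : ℝ)) := by
  have h1 : ∀ μ : ℝ, Complex.exp (Complex.I * (t * μ : ℝ)) * (δ * kappa (δ * (μ - ν))) =
      (fun x : ℝ => δ * Complex.exp (Complex.I * (t * ν : ℝ)) *
        (Complex.exp (Complex.I * (t / δ * x : ℝ)) * kappa x)) (δ * (μ - ν)) := by
    intro μ
    have : t / δ * (δ * (μ - ν)) = t * μ - t * ν := by field_simp
    simp only [this]
    push_cast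
    rw [mul_sub Complex.I, Complex.exp_sub]
    field_simp [Complex.exp_ne_zero]
  simp only [h1]
  rw [integral_sub_right_eq_self (fun μ : ℝ => δ * Complex.exp (Complex.I * (t * ν : ℝ)) *
        (Complex.exp (Complex.I * (t / δ * (δ * μ) : ℝ)) * kappa (δ * μ))) ν,
    Measure.integral_comp_mul_left (fun x : ℝ => δ * Complex.exp (Complex.I * (t * ν : ℝ)) *
        (Complex.exp (Complex.I * (t / δ * x : ℝ)) * kappa x)) δ, integral_const_mul,
    integral_exp_mul_kappa (by rw [abs_div, abs_of_pos hδ]; exact div_le_one_of_le₀ ht hδ.le),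
    abs_of_pos (inv_pos.2 hδ), Complex.real_smul, mul_one, ← mul_assoc]
  push_cast
  rw [inv_mul_cancel₀ (by exact_mod_cast hδ.ne'), one_mul]

theorem integrable_scaled_kappa {δ : ℝ} (hδ : 0 < δ) (ν : ℝ) :
    Integrable fun μ : ℝ => (δ : ℂ) * kappa (δ * (μ - ν)) :=
  ((kappa.integrable.comp_mul_left' hδ.ne').comp_sub_right ν).const_mul _

theorem integrable_id_mul_scaled_kappa {δ : ℝ} (hδ : 0 < δ) (ν : ℝ) :
    Integrable fun μ : ℝ => (μ : ℂ) * (δ * kappa (δ * (μ - ν))) := by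
  have h1 := ((integrable_id_mul_schwartz kappa).comp_mul_left' hδ.ne').comp_sub_right ν
  have h2 := (integrable_scaled_kappa hδ ν).const_mul (ν : ℂ)
  refine (h1.add h2).congr (Eventually.of_forall fun μ => ?_)
  simp only [Pi.add_apply]
  push_cast
  ring

theorem integral_id_mul_scaled_kappa {δ t ν : ℝ} (hδ : 0 < δ) (ht : |t| < δ) :
    ∫ μ : ℝ, Complex.exp (Complex.I * (t * μ : ℝ)) * (μ * (δ * kappa (δ * (μ - ν)))) =
      ν * Complex.exp (Complex.I * (t * ν : ℝ)) := by
  -- the derivative in `t` of `integral_scaled_kappa`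
  have h1 := hasDerivAt_integral_exp_mul (integrable_scaled_kappa hδ ν)
    (integrable_id_mul_scaled_kappa hδ ν) t
  have h2 : (fun t : ℝ => ∫ μ : ℝ, Complex.exp (Complex.I * (t * μ : ℝ)) *
      (δ * kappa (δ * (μ - ν)))) =ᶠ[𝓝 t] fun t => Complex.exp (Complex.I * (t * ν : ℝ)) := by
    filter_upwards [(isOpen_lt continuous_abs continuous_const).mem_nhds ht] with s hs
    exact integral_scaled_kappa hδ (le_of_lt hs)
  have h3 : HasDerivAt (fun t : ℝ => Complex.exp (Complex.I * (t * ν : ℝ)))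
      (Complex.exp (Complex.I * (t * ν : ℝ)) * (Complex.I * ν)) t := by
    have h4 : HasDerivAt (fun s : ℝ => s * ν) ν t := by
      simpa using (hasDerivAt_id t).mul_const ν
    exact (h4.ofReal_comp.const_mul Complex.I).cexp
  have h4 := h1.unique (h3.congr_of_eventuallyEq h2)
  have h5 : ∀ μ : ℝ, Complex.exp (Complex.I * (t * μ : ℝ)) *
      (Complex.I * (μ * (δ * kappa (δ * (μ - ν))))) = Complex.I *
      (Complex.exp (Complex.I * (t * μ : ℝ)) * (μ * (δ * kappa (δ * (μ - ν))))) := fun μ => by ring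
  simp only [h5] at h4
  rw [integral_const_mul] at h4
  refine mul_left_cancel₀ Complex.I_ne_zero (h4.trans ?_)
  ring

theorem duhamelKernel_eq (δ μ ν : ℝ) : duhamelKernel δ μ ν =
    (ν : ℂ)⁻¹ * (δ * kappa (δ * (μ - ν)) - δ * kappa (δ * (μ - 0))) := by
  rw [duhamelKernel, sub_zero]
  ring

theorem integral_duhamelKernel {δ : ℝ} (hδ : 0 < δ) (ν : ℝ) :
    ∫ μ, duhamelKernel δ μ ν = 0 := by
  simp only [duhamelKernel_eq]
  rw [integral_const_mul, integral_sub (integrable_scaled_kappa hδ ν)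
    (integrable_scaled_kappa hδ 0)]
  have h := fun ν => integral_scaled_kappa (t := 0) (ν := ν) hδ (by simpa using hδ.le)
  simp only [zero_mul, Complex.ofReal_zero, mul_zero, Complex.exp_zero, one_mul] at h
  rw [h, h, sub_self, mul_zero]

theorem integrable_id_mul_duhamelKernel {δ : ℝ} (hδ : 0 < δ) (ν : ℝ) :
    Integrable fun μ : ℝ => (μ : ℂ) * duhamelKernel δ μ ν := by
  refine (((integrable_id_mul_scaled_kappa hδ ν).sub
    (integrable_id_mul_scaled_kappa hδ 0)).const_mul (ν : ℂ)⁻¹).congr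
    (Eventually.of_forall fun μ => ?_)
  simp only [duhamelKernel_eq, Pi.sub_apply]
  ring

/-- On `(-δ, δ)` the inverse Fourier transform of `μ ↦ μ K(μ, ν)` is `e^{itν}`: the Duhamel operator
is a right inverse of `-i ∂_t` there. -/
theorem integral_id_mul_duhamelKernel {δ t ν : ℝ} (hδ : 0 < δ) (ht : |t| < δ) (hν : ν ≠ 0) :
    ∫ μ : ℝ, Complex.exp (Complex.I * (t * μ : ℝ)) * (μ * duhamelKernel δ μ ν) =
      Complex.exp (Complex.I * (t * ν : ℝ)) := by
  have h1 : ∀ μ : ℝ, Complex.exp (Complex.I * (t * μ : ℝ)) * (μ * duhamelKernel δ μ ν) =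
      (ν : ℂ)⁻¹ * (Complex.exp (Complex.I * (t * μ : ℝ)) * (μ * (δ * kappa (δ * (μ - ν)))) -
        Complex.exp (Complex.I * (t * μ : ℝ)) * (μ * (δ * kappa (δ * (μ - 0))))) := fun μ => by
    rw [duhamelKernel_eq]
    ring
  simp only [h1]
  rw [integral_const_mul, integral_sub
    (integrable_exp_mul (integrable_id_mul_scaled_kappa hδ ν) t)
    (integrable_exp_mul (integrable_id_mul_scaled_kappa hδ 0) t),
    integral_id_mul_scaled_kappa hδ ht, integral_id_mul_scaled_kappa hδ ht]
  push_cast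
  rw [zero_mul, sub_zero, inv_mul_cancel_left₀ (by exact_mod_cast hν)]

/-! ### The Duhamel operator at a fixed frequency -/

theorem integral_mul_integral_exp {f q : ℝ → ℂ} (hf : Integrable f) (hq : Integrable q) :
    ∫ x : ℝ, f x * ∫ t : ℝ, Complex.exp (Complex.I * (t * x : ℝ)) * q t =
      ∫ t : ℝ, q t * ∫ x : ℝ, Complex.exp (Complex.I * (t * x : ℝ)) * f x := by
  have hi : Integrable (fun p : ℝ × ℝ => Complex.exp (Complex.I * (p.2 * p.1 : ℝ)) *
      (f p.1 * q p.2)) (volume.prod volume) := by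
    refine (hf.mul_prod hq).bdd_mul (c := 1) (by fun_prop) (Eventually.of_forall fun p => ?_)
    rw [norm_exp_I_mul]
  calc ∫ x : ℝ, f x * ∫ t : ℝ, Complex.exp (Complex.I * (t * x : ℝ)) * q t
      = ∫ x : ℝ, ∫ t : ℝ, Complex.exp (Complex.I * (t * x : ℝ)) * (f x * q t) := by
        refine integral_congr_ae (Eventually.of_forall fun x => ?_)
        simp only
        rw [← integral_const_mul]
        refine integral_congr_ae (Eventually.of_forall fun t => ?_)
        simp only
        ring
    _ = ∫ t : ℝ, ∫ x : ℝ, Complex.exp (Complex.I * (t * x : ℝ)) * (f x * q t) :=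
        integral_integral_swap hi
    _ = _ := by
        refine integral_congr_ae (Eventually.of_forall fun t => ?_)
        simp only
        rw [← integral_const_mul]
        refine integral_congr_ae (Eventually.of_forall fun x => ?_)
        simp only
        ring

theorem exists_lintegral_enorm_duhamelKernel_le {δ : ℝ} (hδ : 0 < δ) :
    ∃ C : ℝ≥0∞, C ≠ ⊤ ∧ ∀ ν, ∫⁻ μ, ‖duhamelKernel δ μ ν‖ₑ ≤ C * ENNReal.ofReal (1 + δ * |ν|)⁻¹ := by
  obtain ⟨C, hC, hK⟩ := exists_enorm_duhamelKernel_le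
  set J := ENNReal.ofReal δ⁻¹ * ∫⁻ x : ℝ, ENNReal.ofReal (((1 + |x|) ^ 2)⁻¹) with hJ
  have hJt : J ≠ ⊤ := ENNReal.mul_ne_top ENNReal.ofReal_ne_top lintegral_one_add_abs_ne_top
  refine ⟨C * (ENNReal.ofReal (2 * δ ^ 2) * (J + J)), by finiteness, fun ν => ?_⟩
  have hm : Measurable fun μ => ENNReal.ofReal (((1 + δ * |μ|) ^ 2)⁻¹) := by fun_prop
  have hm' : Measurable fun μ => ENNReal.ofReal (((1 + δ * |μ|) ^ 2)⁻¹) + decay δ μ ν :=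
    hm.add (measurable_decay_left δ ν)
  calc ∫⁻ μ, ‖duhamelKernel δ μ ν‖ₑ
      ≤ ∫⁻ μ, C * (ENNReal.ofReal (2 * δ ^ 2) * (ENNReal.ofReal (((1 + δ * |μ|) ^ 2)⁻¹) +
          decay δ μ ν) * ENNReal.ofReal (1 + δ * |ν|)⁻¹) :=
        lintegral_mono fun μ => (hK δ μ ν hδ).trans (by
          gcongr
          exact prodKernel_add_diagKernel_le hδ μ ν)
    _ = C * (ENNReal.ofReal (2 * δ ^ 2) * (J + J)) * ENNReal.ofReal (1 + δ * |ν|)⁻¹ := by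
        rw [lintegral_const_mul' _ _ hC, lintegral_mul_const' _ _ ENNReal.ofReal_ne_top,
          lintegral_const_mul' _ _ ENNReal.ofReal_ne_top, lintegral_add_left hm,
          lintegral_decay_left hδ, lintegral_comp_mul_abs_le hδ, mul_assoc, ← hJ]
        ring

/-- The condition on `G` under which the Duhamel operator is given by an absolutely convergent
double integral, by the bound of `exists_lintegral_enorm_duhamelKernel_le`. -/
def DuhamelIntegrable (δ : ℝ) (G : ℝ → ℂ) : Prop :=
  Measurable G ∧ ∫⁻ ν, ENNReal.ofReal (1 + δ * |ν|)⁻¹ * ‖G ν‖ₑ ≠ ⊤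

theorem DuhamelIntegrable.integrable {δ : ℝ} (hδ : 0 < δ) {G : ℝ → ℂ}
    (hG : DuhamelIntegrable δ G) :
    Integrable (fun p : ℝ × ℝ => duhamelKernel δ p.1 p.2 * G p.2) (volume.prod volume) := by
  have hm : Measurable fun p : ℝ × ℝ => duhamelKernel δ p.1 p.2 * G p.2 :=
    (measurable_duhamelKernel δ).mul (hG.1.comp measurable_snd)
  obtain ⟨C, hC, hK⟩ := exists_lintegral_enorm_duhamelKernel_le hδ
  refine ⟨hm.aestronglyMeasurable, ?_⟩
  rw [hasFiniteIntegral_iff_enorm, lintegral_prod_symm _ hm.enorm.aemeasurable]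
  calc ∫⁻ ν, ∫⁻ μ, ‖duhamelKernel δ μ ν * G ν‖ₑ
      ≤ ∫⁻ ν, C * (ENNReal.ofReal (1 + δ * |ν|)⁻¹ * ‖G ν‖ₑ) := by
        refine lintegral_mono fun ν => ?_
        simp only [enorm_mul]
        rw [lintegral_mul_const' _ _ enorm_ne_top, ← mul_assoc]
        gcongr
        exact hK ν
    _ = C * ∫⁻ ν, ENNReal.ofReal (1 + δ * |ν|)⁻¹ * ‖G ν‖ₑ := lintegral_const_mul' _ _ hC
    _ < ⊤ := ENNReal.mul_lt_top hC.lt_top hG.2.lt_top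

/-- The Duhamel operator at a fixed frequency, on the Fourier side. -/
def duhamel (δ : ℝ) (G : ℝ → ℂ) (μ : ℝ) : ℂ := ∫ ν, duhamelKernel δ μ ν * G ν

theorem DuhamelIntegrable.integrable_duhamel {δ : ℝ} (hδ : 0 < δ) {G : ℝ → ℂ}
    (hG : DuhamelIntegrable δ G) : Integrable (duhamel δ G) :=
  (hG.integrable hδ).integral_prod_left

theorem DuhamelIntegrable.integral_duhamel {δ : ℝ} (hδ : 0 < δ) {G : ℝ → ℂ}
    (hG : DuhamelIntegrable δ G) : ∫ μ, duhamel δ G μ = 0 := by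
  unfold duhamel
  rw [integral_integral_swap (f := fun μ ν => duhamelKernel δ μ ν * G ν) (hG.integrable hδ)]
  simp only [integral_mul_const, integral_duhamelKernel hδ, zero_mul, integral_zero]

/-- The Duhamel operator inverts multiplication by `μ`, when tested against inverse Fourier
transforms of functions supported in `(-δ, δ)`. -/
theorem DuhamelIntegrable.integral_id_mul_duhamel {δ : ℝ} (hδ : 0 < δ) {G : ℝ → ℂ}
    (hG : DuhamelIntegrable δ G) {q P : ℝ → ℂ} (hq : Integrable q) (hq0 : ∀ t, δ ≤ |t| → q t = 0)
    (hP : ∀ x : ℝ, P x = ∫ t : ℝ, Complex.exp (Complex.I * (t * x : ℝ)) * q t)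
    (hPm : Measurable P) {B : ℝ} (hB : ∀ x : ℝ, |x| * ‖P x‖ ≤ B) :
    ∫ μ : ℝ, μ * duhamel δ G μ * P μ = ∫ ν, G ν * P ν := by
  have hi : Integrable (fun p : ℝ × ℝ => (p.1 * P p.1) * (duhamelKernel δ p.1 p.2 * G p.2))
      (volume.prod volume) := by
    refine (hG.integrable hδ).bdd_mul (c := B) ?_ (Eventually.of_forall fun p => ?_)
    · exact Measurable.aestronglyMeasurable (by fun_prop)
    · rw [norm_mul, Complex.norm_real, Real.norm_eq_abs]
      exact hB _
  have h1 : ∀ ν : ℝ, ν ≠ 0 → ∫ μ : ℝ, μ * P μ * (duhamelKernel δ μ ν * G ν) = G ν * P ν := by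
    intro ν hν
    calc ∫ μ : ℝ, μ * P μ * (duhamelKernel δ μ ν * G ν)
        = G ν * ∫ μ : ℝ, (μ * duhamelKernel δ μ ν) *
            ∫ t : ℝ, Complex.exp (Complex.I * (t * μ : ℝ)) * q t := by
          rw [← integral_const_mul]
          refine integral_congr_ae (Eventually.of_forall fun μ => ?_)
          simp only
          rw [hP]
          ring
      _ = G ν * P ν := by
          rw [integral_mul_integral_exp (integrable_id_mul_duhamelKernel hδ ν) hq, hP]
          congr 1
          refine integral_congr_ae (Eventually.of_forall fun t => ?_)
          simp only
          rcases lt_or_ge |t| δ with ht | ht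
          · rw [integral_id_mul_duhamelKernel hδ ht hν, mul_comm]
          · rw [hq0 t ht, zero_mul, mul_zero]
  calc ∫ μ : ℝ, μ * duhamel δ G μ * P μ
      = ∫ μ : ℝ, ∫ ν : ℝ, μ * P μ * (duhamelKernel δ μ ν * G ν) := by
        refine integral_congr_ae (Eventually.of_forall fun μ => ?_)
        simp only
        rw [integral_const_mul, duhamel]
        ring
    _ = ∫ ν : ℝ, ∫ μ : ℝ, μ * P μ * (duhamelKernel δ μ ν * G ν) := integral_integral_swap hi
    _ = _ := by
        refine integral_congr_ae ?_
        -- at `ν = 0` the kernel has its junk value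
        filter_upwards [compl_mem_ae_iff.2 (measure_singleton (0 : ℝ))] with ν hν
        exact h1 ν hν

theorem integral_id_mul_kappa_mul {δ : ℝ} (hδ : δ ≤ 1) {q P : ℝ → ℂ} (hq : Integrable q)
    (hq0 : ∀ t, δ ≤ |t| → q t = 0)
    (hP : ∀ x : ℝ, P x = ∫ t : ℝ, Complex.exp (Complex.I * (t * x : ℝ)) * q t) :
    ∫ μ : ℝ, μ * kappa μ * P μ = 0 := by
  simp only [hP]
  rw [integral_mul_integral_exp (integrable_id_mul_schwartz kappa) hq]
  refine integral_eq_zero_of_ae (Eventually.of_forall fun t => ?_)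
  simp only [Pi.zero_apply]
  rcases lt_or_ge |t| δ with ht | ht
  · rw [integral_exp_mul_id_mul_kappa (ht.trans_le hδ), mul_zero]
  · rw [hq0 t ht, zero_mul]

/-- The Fourier transform in time of the solution at a fixed frequency, for the initial value `a`
and the right-hand side `G`; here `μ = τ + h(ξ)`. -/
def solution (δ : ℝ) (a : ℂ) (G : ℝ → ℂ) (μ : ℝ) : ℂ :=
  2 * Real.pi * a * kappa μ + duhamel δ G μ

theorem integral_solution {δ : ℝ} (hδ : 0 < δ) (a : ℂ) {G : ℝ → ℂ}
    (hG : DuhamelIntegrable δ G) : ∫ μ, solution δ a G μ = 2 * Real.pi * a := by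
  unfold solution
  have h1 := integral_exp_mul_kappa (t := 0) (by simp)
  simp only [zero_mul, Complex.ofReal_zero, mul_zero, Complex.exp_zero, one_mul] at h1
  rw [integral_add (kappa.integrable.const_mul _) (hG.integrable_duhamel hδ), integral_const_mul,
    hG.integral_duhamel hδ, h1, mul_one, add_zero]

/-- The equation `-i W' = g` on `(-δ, δ)`, in its weak form on the Fourier side: `μ` times the
transform of the solution agrees with the right-hand side when tested against `P = q̌`, for `q`
supported in `[-δ, δ]`. -/
theorem integral_id_mul_solution {δ : ℝ} (hδ : 0 < δ) (hδ' : δ ≤ 1) (a : ℂ) {G : ℝ → ℂ}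
    (hG : DuhamelIntegrable δ G) {q P : ℝ → ℂ} (hq : Integrable q) (hq0 : ∀ t, δ ≤ |t| → q t = 0)
    (hP : ∀ x : ℝ, P x = ∫ t : ℝ, Complex.exp (Complex.I * (t * x : ℝ)) * q t)
    (hPm : Measurable P) {B : ℝ} (hB : ∀ x : ℝ, |x| * ‖P x‖ ≤ B) :
    ∫ μ : ℝ, μ * solution δ a G μ * P μ = ∫ ν, G ν * P ν := by
  have hb : ∀ x : ℝ, ‖(x : ℂ) * P x‖ ≤ B := fun x => by
    rw [norm_mul, Complex.norm_real, Real.norm_eq_abs]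
    exact hB x
  have hm : AEStronglyMeasurable fun x : ℝ => (x : ℂ) * P x :=
    Measurable.aestronglyMeasurable (by fun_prop)
  have h1 : Integrable fun μ : ℝ => 2 * Real.pi * a * (μ * kappa μ * P μ) := by
    refine (((kappa.integrable.bdd_mul hm (Eventually.of_forall hb)).const_mul
      (2 * Real.pi * a)).congr (Eventually.of_forall fun μ => ?_))
    simp only
    ring
  have h2 : Integrable fun μ : ℝ => μ * duhamel δ G μ * P μ := by
    refine ((hG.integrable_duhamel hδ).bdd_mul hm (Eventually.of_forall hb)).congr
      (Eventually.of_forall fun μ => ?_)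
    simp only
    ring
  calc ∫ μ : ℝ, μ * solution δ a G μ * P μ
      = ∫ μ : ℝ, (2 * Real.pi * a * (μ * kappa μ * P μ) + μ * duhamel δ G μ * P μ) := by
        refine integral_congr_ae (Eventually.of_forall fun μ => ?_)
        simp only [solution]
        ring
    _ = _ := by
        rw [integral_add h1 h2, integral_const_mul, integral_id_mul_kappa_mul hδ' hq hq0 hP,
          hG.integral_id_mul_duhamel hδ hq hq0 hP hPm hB, mul_zero, zero_add]

/-! ### The partial Fourier transform in the space variable -/

theorem integral_spaceTime {F : Type*} [NormedAddCommGroup F] [NormedSpace ℝ F]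
    (f : SpaceTime → F) : ∫ z, f z = ∫ p : ℝ × Space, f (WithLp.toLp 2 p) :=
  ((WithLp.volume_preserving_toLp ℝ Space).integral_comp
    (MeasurableEquiv.toLp 2 (ℝ × Space)).measurableEmbedding f).symm

theorem lintegral_spaceTime (f : SpaceTime → ℝ≥0∞) :
    ∫⁻ z, f z = ∫⁻ p : ℝ × Space, f (WithLp.toLp 2 p) :=
  ((WithLp.volume_preserving_toLp ℝ Space).lintegral_comp_emb
    (MeasurableEquiv.toLp 2 (ℝ × Space)).measurableEmbedding f).symm

theorem integrable_spaceTime {F : Type*} [NormedAddCommGroup F] {f : SpaceTime → F} :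
    Integrable f ↔ Integrable fun p : ℝ × Space => f (WithLp.toLp 2 p) :=
  ((WithLp.volume_preserving_toLp ℝ Space).integrable_comp_emb
    (MeasurableEquiv.toLp 2 (ℝ × Space)).measurableEmbedding).symm

theorem continuous_toLp_prod : Continuous fun p : ℝ × Space => (WithLp.toLp 2 p : SpaceTime) :=
  WithLp.prod_continuous_toLp 2 ℝ Space

theorem norm_snd_le (t : ℝ) (x : Space) : ‖x‖ ≤ ‖(WithLp.toLp 2 (t, x) : SpaceTime)‖ := by
  rw [WithLp.prod_norm_eq_of_L2]
  exact Real.le_sqrt_of_sq_le (by simp; positivity)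

theorem abs_fst_le (t : ℝ) (x : Space) : |t| ≤ ‖(WithLp.toLp 2 (t, x) : SpaceTime)‖ := by
  rw [WithLp.prod_norm_eq_of_L2]
  exact Real.le_sqrt_of_sq_le (by simp)

theorem exists_norm_apply_le (φ : 𝓢(SpaceTime, ℂ)) : ∃ C : ℝ, 0 ≤ C ∧ ∀ (t : ℝ) (x : Space),
    ‖φ (WithLp.toLp 2 (t, x))‖ ≤ C * (1 + t ^ 2)⁻¹ * ((1 + ‖x‖) ^ 3)⁻¹ := by
  refine ⟨2 ^ 5 * (Finset.Iic (5, 0)).sup (fun m : ℕ × ℕ => SchwartzMap.seminorm ℝ m.1 m.2) φ,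
    by positivity, fun t x => ?_⟩
  have h := SchwartzMap.one_add_le_sup_seminorm_apply (𝕜 := ℝ) (m := (5, 0)) (k := 5) (n := 0)
    le_rfl le_rfl φ (WithLp.toLp 2 (t, x))
  rw [norm_iteratedFDeriv_zero] at h
  have h1 := norm_snd_le t x
  have h2 : 1 + t ^ 2 ≤ (1 + ‖(WithLp.toLp 2 (t, x) : SpaceTime)‖) ^ 2 := by
    have := abs_fst_le t x
    rw [← sq_abs]
    nlinarith [abs_nonneg t]
  rw [mul_assoc, ← mul_inv, ← div_eq_mul_inv, le_div_iff₀ (by positivity), mul_comm]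
  refine le_trans ?_ h
  gcongr
  calc (1 + t ^ 2) * (1 + ‖x‖) ^ 3 ≤ (1 + ‖(WithLp.toLp 2 (t, x) : SpaceTime)‖) ^ 2 *
        (1 + ‖(WithLp.toLp 2 (t, x) : SpaceTime)‖) ^ 3 := by gcongr
    _ = _ := by ring

/-- The inverse Fourier transform of `φ` in the space variable, normalised so that its
one-dimensional Fourier integral in time is the full inverse Fourier transform. -/
def partialHatInv (φ : 𝓢(SpaceTime, ℂ)) (t : ℝ) (ξ : Space) : ℂ :=
  (2 * Real.pi : ℝ)⁻¹ * schwartzHatInv Space (slice t φ) ξ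

theorem partialHatInv_eq_integral (φ : 𝓢(SpaceTime, ℂ)) (t : ℝ) (ξ : Space) :
    partialHatInv φ t ξ = ((2 * Real.pi) ^ 3 : ℝ)⁻¹ *
      ∫ x : Space, Complex.exp (Complex.I * (inner ℝ x ξ : ℝ)) * φ (WithLp.toLp 2 (t, x)) := by
  rw [partialHatInv, schwartzHatInv_apply, finrank_euclideanSpace_fin, ← mul_assoc]
  congr 1
  push_cast
  ring

theorem integrable_one_add_norm_inv : Integrable fun x : Space => ((1 + ‖x‖) ^ 3)⁻¹ := by
  have h := integrable_one_add_norm (E := Space) (μ := volume) (r := 3) (by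
    rw [finrank_euclideanSpace_fin]
    norm_num)
  refine h.congr (Eventually.of_forall fun x => ?_)
  simp only
  rw [Real.rpow_neg (by positivity)]
  norm_cast

theorem measurable_partialHatInv (φ : 𝓢(SpaceTime, ℂ)) :
    Measurable (Function.uncurry (partialHatInv φ)) := by
  have h1 : StronglyMeasurable fun p : (ℝ × Space) × Space =>
      Complex.exp (Complex.I * (inner ℝ p.2 p.1.2 : ℝ)) * φ (WithLp.toLp 2 (p.1.1, p.2)) := by
    refine Continuous.stronglyMeasurable (Continuous.mul (by fun_prop) ?_)
    exact φ.continuous.comp (continuous_toLp_prod.comp (by fun_prop))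
  have h2 := h1.integral_prod_right' (ν := volume)
  unfold Function.uncurry
  simp only [partialHatInv_eq_integral]
  exact (h2.measurable).const_mul _

theorem partialHatInv_eq_zero {φ : 𝓢(SpaceTime, ℂ)} {δ t : ℝ} (hφ : tsupport φ ⊆ slab δ)
    (ht : δ ≤ |t|) (ξ : Space) : partialHatInv φ t ξ = 0 := by
  have h1 : ∀ x : Space, φ (WithLp.toLp 2 (t, x)) = 0 := fun x => by
    by_contra h
    have h2 : t ∈ Set.Ioo (-δ) δ := hφ (subset_tsupport _ h)
    exact absurd (abs_lt.2 h2) (not_lt.2 ht)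
  rw [partialHatInv_eq_integral]
  simp [h1]

theorem exists_norm_partialHatInv_le_zero (φ : 𝓢(SpaceTime, ℂ)) : ∃ C : ℝ, 0 ≤ C ∧
    ∀ (t : ℝ) (ξ : Space), ‖partialHatInv φ t ξ‖ ≤ C * (1 + t ^ 2)⁻¹ := by
  obtain ⟨C, hC, hb⟩ := exists_norm_apply_le φ
  refine ⟨((2 * Real.pi) ^ 3)⁻¹ * (C * ∫ x : Space, ((1 + ‖x‖) ^ 3)⁻¹),
    mul_nonneg (by positivity) (mul_nonneg hC (integral_nonneg fun x => by positivity)),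
    fun t ξ => ?_⟩
  have h1 : ‖∫ x : Space, Complex.exp (Complex.I * (inner ℝ x ξ : ℝ)) *
      φ (WithLp.toLp 2 (t, x))‖ ≤ ∫ x : Space, C * (1 + t ^ 2)⁻¹ * ((1 + ‖x‖) ^ 3)⁻¹ := by
    refine norm_integral_le_of_norm_le (integrable_one_add_norm_inv.const_mul _)
      (Eventually.of_forall fun x => ?_)
    rw [norm_mul, norm_exp_I_mul, one_mul]
    exact hb t x
  rw [integral_const_mul] at h1
  rw [partialHatInv_eq_integral, norm_mul, Complex.norm_real, Real.norm_of_nonneg (by positivity),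
    mul_assoc]
  refine mul_le_mul_of_nonneg_left (h1.trans (le_of_eq ?_)) (by positivity)
  ring

theorem slice_lineDeriv (φ : 𝓢(SpaceTime, ℂ)) (t : ℝ) (m : Space) :
    slice t (∂_{(WithLp.toLp 2 ((0 : ℝ), m) : SpaceTime)} φ) = ∂_{m} (slice t φ) := by
  refine SchwartzMap.ext fun x => ?_
  rw [slice_apply, SchwartzMap.lineDerivOp_apply, SchwartzMap.lineDerivOp_apply]
  unfold lineDeriv
  congr 1
  funext r
  rw [slice_apply, ← WithLp.toLp_smul, ← WithLp.toLp_add]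
  simp

theorem partialHatInv_lineDeriv (φ : 𝓢(SpaceTime, ℂ)) (t : ℝ) (m ξ : Space) :
    partialHatInv (∂_{(WithLp.toLp 2 ((0 : ℝ), m) : SpaceTime)} φ) t ξ =
      -(Complex.I * (inner ℝ ξ m : ℝ)) * partialHatInv φ t ξ := by
  rw [partialHatInv, slice_lineDeriv, schwartzHatInv_lineDeriv, partialHatInv]
  ring

theorem partialHatInv_sub (φ ψ : 𝓢(SpaceTime, ℂ)) (t : ℝ) (ξ : Space) :
    partialHatInv (φ - ψ) t ξ = partialHatInv φ t ξ - partialHatInv ψ t ξ := by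
  simp only [partialHatInv, map_sub, sub_apply]
  ring

theorem exists_partialHatInv_eq_one_add_norm_sq_mul (φ : 𝓢(SpaceTime, ℂ)) :
    ∃ ψ : 𝓢(SpaceTime, ℂ), ∀ t ξ,
      partialHatInv ψ t ξ = ((1 + ‖ξ‖ ^ 2 : ℝ) : ℂ) * partialHatInv φ t ξ := by
  have hI := Complex.I_sq
  let e : Fin 2 → SpaceTime := fun i => WithLp.toLp 2 ((0 : ℝ), EuclideanSpace.single i (1 : ℝ))
  refine ⟨φ - ∂_{e 0} (∂_{e 0} φ) - ∂_{e 1} (∂_{e 1} φ), fun t ξ => ?_⟩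
  simp only [e, partialHatInv_sub, partialHatInv_lineDeriv, EuclideanSpace.inner_single_right]
  rw [EuclideanSpace.norm_sq_eq, Fin.sum_univ_two]
  simp only [Real.norm_eq_abs, sq_abs, conj_trivial, one_mul]
  push_cast
  linear_combination (-((ξ 0 : ℂ) ^ 2 + (ξ 1 : ℂ) ^ 2) * partialHatInv φ t ξ) * hI

/-- Decay in both variables; each factor `1 + |ξ|²` costs two derivatives of `φ` in the space
variable. -/
theorem exists_norm_partialHatInv_le (φ : 𝓢(SpaceTime, ℂ)) (M : ℕ) : ∃ C : ℝ, 0 ≤ C ∧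
    ∀ (t : ℝ) (ξ : Space),
      ‖partialHatInv φ t ξ‖ ≤ C * (1 + t ^ 2)⁻¹ * ((1 + ‖ξ‖ ^ 2) ^ M)⁻¹ := by
  induction M generalizing φ with
  | zero => simpa using exists_norm_partialHatInv_le_zero φ
  | succ M ih =>
    obtain ⟨ψ, hψ⟩ := exists_partialHatInv_eq_one_add_norm_sq_mul φ
    obtain ⟨C, hC, hb⟩ := ih ψ
    refine ⟨C, hC, fun t ξ => ?_⟩
    have h1 := hb t ξ
    have h2 : (0 : ℝ) < 1 + ‖ξ‖ ^ 2 := by positivity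
    rw [hψ, norm_mul, Complex.norm_real, Real.norm_of_nonneg h2.le] at h1
    rw [pow_succ _ M, mul_inv, ← mul_assoc, ← div_eq_mul_inv _ (1 + ‖ξ‖ ^ 2), le_div_iff₀ h2,
      mul_comm]
    exact h1

theorem integrable_partialHatInv (φ : 𝓢(SpaceTime, ℂ)) (ξ : Space) :
    Integrable fun t => partialHatInv φ t ξ := by
  obtain ⟨C, hC, hb⟩ := exists_norm_partialHatInv_le_zero φ
  refine (integrable_inv_one_add_sq.const_mul C).mono' ?_ (Eventually.of_forall fun t => hb t ξ)
  exact ((measurable_partialHatInv φ).of_uncurry_right).aestronglyMeasurable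

theorem schwartzHatInv_eq_integral_partialHatInv (φ : 𝓢(SpaceTime, ℂ)) (τ : ℝ) (ξ : Space) :
    schwartzHatInv SpaceTime φ (WithLp.toLp 2 (τ, ξ)) =
      ∫ t : ℝ, Complex.exp (Complex.I * (t * τ : ℝ)) * partialHatInv φ t ξ := by
  have hdim : Module.finrank ℝ SpaceTime = 3 := by
    rw [(WithLp.linearEquiv 2 ℝ (ℝ × Space)).finrank_eq, Module.finrank_prod,
      finrank_euclideanSpace_fin, Module.finrank_self]
  have hi : Integrable (fun p : ℝ × Space => Complex.exp (Complex.I *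
      (inner ℝ (WithLp.toLp 2 p : SpaceTime) (WithLp.toLp 2 (τ, ξ)) : ℝ)) *
        φ (WithLp.toLp 2 p)) (volume.prod volume) := by
    refine (integrable_spaceTime.1 φ.integrable).bdd_mul (c := 1) ?_
      (Eventually.of_forall fun p => ?_)
    · refine Continuous.aestronglyMeasurable ?_
      have := continuous_toLp_prod
      fun_prop
    · rw [norm_exp_I_mul]
  rw [schwartzHatInv_apply, hdim, integral_spaceTime]
  have h1 := integral_prod _ hi
  rw [← Measure.volume_eq_prod] at h1
  rw [h1, ← integral_const_mul]
  refine integral_congr_ae (Eventually.of_forall fun t => ?_)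
  simp only
  rw [partialHatInv_eq_integral, mul_left_comm]
  congr 1
  rw [← integral_const_mul]
  refine integral_congr_ae (Eventually.of_forall fun x => ?_)
  simp only
  rw [WithLp.prod_inner_apply]
  have h2 : (inner ℝ t τ : ℝ) = t * τ := by simp [mul_comm]
  change Complex.exp (Complex.I * ((inner ℝ t τ + inner ℝ x ξ : ℝ) : ℂ)) * _ = _
  rw [h2]
  push_cast
  rw [mul_add, Complex.exp_add]
  ring

/-! ### The dyadic norms along the fibres `ξ = const` -/

theorem eLpNorm_two_sq {α F : Type*} [MeasurableSpace α] [NormedAddCommGroup F] (f : α → F)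
    (μ : Measure α) : eLpNorm f 2 μ ^ 2 = ∫⁻ a, ‖f a‖ₑ ^ 2 ∂μ := by
  have h := eLpNorm_nnreal_pow_eq_lintegral (f := f) (μ := μ) (p := 2) two_ne_zero
  have h2 : ((2 : NNReal) : ℝ) = ((2 : ℕ) : ℝ) := by norm_num
  simp only [h2, ENNReal.rpow_natCast] at h
  exact_mod_cast h

/-- Integration in the coordinates `(ξ, l)` with `l = τ + h(ξ)`. -/
theorem lintegral_shear (h : Space → ℝ) {f : SpaceTime → ℝ≥0∞}
    (hf : Measurable f) :
    ∫⁻ z, f z = ∫⁻ ξ, ∫⁻ l : ℝ, f (WithLp.toLp 2 (l - h ξ, ξ)) := by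
  have hm : Measurable fun p : ℝ × Space => f (WithLp.toLp 2 p) :=
    hf.comp continuous_toLp_prod.measurable
  rw [lintegral_spaceTime, Measure.volume_eq_prod, lintegral_prod_symm _ hm.aemeasurable]
  refine lintegral_congr fun ξ => ?_
  exact (lintegral_sub_right_eq_self (fun τ => f (WithLp.toLp 2 (τ, ξ))) (h ξ)).symm

theorem measurable_shear {h : Space → ℝ} (hh : Continuous h) :
    Measurable fun p : Space × ℝ => (WithLp.toLp 2 (p.2 - h p.1, p.1) : SpaceTime) :=
  continuous_toLp_prod.measurable.comp (by fun_prop)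

theorem continuous_weight (σ s : ℝ) : Continuous (weight σ s) := by
  unfold weight
  refine Continuous.mul (by fun_prop) (Continuous.rpow_const (by fun_prop) fun ξ => Or.inl ?_)
  positivity

theorem weight_pos (σ s : ℝ) (ξ : Space) : 0 < weight σ s ξ := by
  unfold weight
  positivity

theorem enorm_weight (σ s : ℝ) (ξ : Space) :
    ‖(weight σ s ξ : ℂ)‖ₑ = ENNReal.ofReal (weight σ s ξ) := by
  rw [← ofReal_norm, Complex.norm_real, Real.norm_of_nonneg (weight_pos σ s ξ).le]

/-- Since `σ ≥ 0`, the weight is bounded below by a negative power of `1 + |ξ|²`, so that the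
weighted spaces consist of tempered distributions. -/
theorem one_le_weight_mul {σ : ℝ} (hσ : 0 ≤ σ) (s : ℝ) :
    ∃ N : ℕ, ∀ ξ : Space, 1 ≤ weight σ s ξ * (1 + ‖ξ‖ ^ 2) ^ N := by
  obtain ⟨N, hN⟩ := exists_nat_ge |s|
  refine ⟨N, fun ξ => ?_⟩
  have h1 : 1 ≤ Real.sqrt (1 + ‖ξ‖ ^ 2) := by
    rw [Real.one_le_sqrt]
    nlinarith [norm_nonneg ξ]
  have h2 : 1 ≤ Real.exp (σ * (|ξ 0| + |ξ 1|)) := Real.one_le_exp (by positivity)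
  have h3 : (1 + ‖ξ‖ ^ 2) ^ N = Real.sqrt (1 + ‖ξ‖ ^ 2) ^ (2 * N : ℝ) := by
    rw [Real.rpow_mul (by positivity), Real.rpow_two, Real.sq_sqrt (by positivity),
      Real.rpow_natCast]
  rw [weight, h3, mul_assoc, ← Real.rpow_add (by linarith)]
  refine one_le_mul_of_one_le_of_one_le h2 (Real.one_le_rpow h1 ?_)
  have := neg_abs_le s
  have := abs_nonneg s
  linarith

/-- The weighted size of `g` in the coordinates `(ξ, l)` with `l = τ + h(ξ)`. -/
def fiberSize (h : Space → ℝ) (σ s : ℝ) (g : SpaceTime → ℂ) (ξ : Space) (l : ℝ) : ℝ≥0∞ :=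
  ENNReal.ofReal (weight σ s ξ) * ‖g (WithLp.toLp 2 (l - h ξ, ξ))‖ₑ

theorem measurable_fiberSize {h : Space → ℝ} (hh : Continuous h) (σ s : ℝ) {g : SpaceTime → ℂ}
    (hg : Measurable g) : Measurable (Function.uncurry (fiberSize h σ s g)) := by
  have h1 := (continuous_weight σ s).measurable
  have h2 : Measurable fun p : Space × ℝ => g (WithLp.toLp 2 (p.2 - h p.1, p.1)) :=
    hg.comp (measurable_shear hh)
  unfold fiberSize Function.uncurry
  fun_prop

/-- The square of the `L²` norm over the `n`-th dyadic block. -/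
def blockSq (B : Space → ℝ → ℝ≥0∞) (n : ℕ) : ℝ≥0∞ := ∫⁻ ξ, ∫⁻ l in dyadic n, B ξ l ^ 2

theorem measurable_block {B : Space → ℝ → ℝ≥0∞} (hB : Measurable (Function.uncurry B)) (n : ℕ) :
    Measurable fun ξ => ∫⁻ l in dyadic n, B ξ l ^ 2 :=
  Measurable.lintegral_prod_right' (f := fun p : Space × ℝ => B p.1 p.2 ^ 2) (hB.pow_const 2)

theorem two_pow_rpow_sq (b : ℝ) (n : ℕ) :
    ENNReal.ofReal (((2 : ℝ) ^ n) ^ b) ^ 2 = ENNReal.ofReal ((2 : ℝ) ^ (2 * b * n)) := by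
  rw [← ENNReal.ofReal_pow (by positivity), ← Real.rpow_natCast 2 n, ← Real.rpow_mul (by norm_num),
    ← Real.rpow_natCast _ 2, ← Real.rpow_mul (by norm_num)]
  congr 2
  push_cast
  ring

theorem xPiece_sq {h : Space → ℝ} (hh : Continuous h) (σ s b : ℝ) {u : 𝓢'(SpaceTime, ℂ)}
    {g : SpaceTime → ℂ} (hg : Measurable g) (hu : hatFun u =ᵐ[volume] g) (n : ℕ) :
    xPiece h σ s b u n ^ 2 =
      ENNReal.ofReal ((2 : ℝ) ^ (2 * b * n)) * blockSq (fiberSize h σ s g) n := by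
  have h1 : MeasurableSet {z : SpaceTime | z.fst + h z.snd ∈ dyadic n} := by
    have : Measurable fun z : SpaceTime => z.fst + h z.snd := by fun_prop
    exact this (measurableSet_dyadic n)
  have h2 := (continuous_weight σ s).measurable
  have h3 : Measurable fun z : SpaceTime =>
      ‖(Set.indicator {z : SpaceTime | z.fst + h z.snd ∈ dyadic n}
      fun z => (weight σ s z.snd : ℂ) * g z) z‖ₑ ^ 2 := by
    refine Measurable.pow_const (Measurable.enorm (Measurable.indicator ?_ h1)) 2
    fun_prop
  rw [xPiece, mul_pow, two_pow_rpow_sq]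
  congr 1
  have h4 : Set.indicator {z : SpaceTime | z.fst + h z.snd ∈ dyadic n}
      (fun z => (weight σ s z.snd : ℂ) * hatFun u z) =ᵐ[volume]
      Set.indicator {z : SpaceTime | z.fst + h z.snd ∈ dyadic n}
      (fun z => (weight σ s z.snd : ℂ) * g z) := by
    filter_upwards [hu] with z hz
    simp only [Set.indicator, hz]
  rw [eLpNorm_congr_ae h4, eLpNorm_two_sq, lintegral_shear h h3, blockSq]
  refine lintegral_congr fun ξ => ?_
  rw [← lintegral_indicator (measurableSet_dyadic n)]
  refine lintegral_congr fun l => ?_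
  have hmem : (WithLp.toLp 2 (l - h ξ, ξ) : SpaceTime) ∈
      {z : SpaceTime | z.fst + h z.snd ∈ dyadic n} ↔ l ∈ dyadic n := by
    change l - h ξ + h ξ ∈ dyadic n ↔ _
    rw [sub_add_cancel]
  by_cases hl : l ∈ dyadic n
  · rw [Set.indicator_of_mem (hmem.2 hl), Set.indicator_of_mem hl, enorm_mul, enorm_weight]
    rfl
  · rw [Set.indicator_of_notMem (fun h => hl (hmem.1 h)), Set.indicator_of_notMem hl]
    simp

theorem xPiece_le_xNorm_top (h : Space → ℝ) (σ s b : ℝ) (u : 𝓢'(SpaceTime, ℂ)) (n : ℕ) :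
    xPiece h σ s b u n ≤ xNorm h σ s b ⊤ u := by
  rw [xNorm, if_pos rfl]
  exact le_iSup (xPiece h σ s b u) n

theorem xNorm_one (h : Space → ℝ) (σ s b : ℝ) (u : 𝓢'(SpaceTime, ℂ)) :
    xNorm h σ s b 1 u = ∑' n, xPiece h σ s b u n := by
  simp [xNorm]

theorem xPiece_le_xNorm_one (h : Space → ℝ) (σ s b : ℝ) (u : 𝓢'(SpaceTime, ℂ)) (n : ℕ) :
    xPiece h σ s b u n ≤ xNorm h σ s b 1 u := by
  rw [xNorm_one]
  exact ENNReal.le_tsum n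

/-- The weights of `inSum` are smaller than `2^{2bn}` by a summable factor, so the supremum over
dyadic blocks controls the sum. -/
theorem lintegral_inSum_le (b : ℝ) {η : ℝ} (hη : 0 < η) :
    ∃ C : ℝ≥0∞, C ≠ ⊤ ∧ ∀ (k : ℕ) (B : Space → ℝ → ℝ≥0∞) (N : ℝ≥0∞),
      Measurable (Function.uncurry B) →
      (∀ n : ℕ, ENNReal.ofReal ((2 : ℝ) ^ (2 * b * n)) * blockSq B n ≤ N ^ 2) →
      ∫⁻ ξ, inSum b η k (B ξ) ≤ C * N ^ 2 := by
  obtain ⟨C, hC, hsum⟩ := tsum_two_rpow_neg_abs_le hη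
  refine ⟨C, hC, fun k B N hB hN => ?_⟩
  calc ∫⁻ ξ, inSum b η k (B ξ)
      = ∑' n, ENNReal.ofReal (inWeight b η k n) * blockSq B n := by
        unfold inSum
        rw [lintegral_tsum fun n => ((measurable_block hB n).const_mul _).aemeasurable]
        refine tsum_congr fun n => ?_
        rw [lintegral_const_mul _ (measurable_block hB n), blockSq]
    _ ≤ ∑' n : ℕ, ENNReal.ofReal ((2 : ℝ) ^ (-(η * |(n : ℝ) - k|))) * N ^ 2 := by
        refine ENNReal.tsum_le_tsum fun n => ?_
        rw [inWeight, sub_eq_neg_add, Real.rpow_add (by norm_num),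
          ENNReal.ofReal_mul (by positivity), mul_assoc]
        gcongr
        exact hN n
    _ ≤ C * N ^ 2 := by
        rw [ENNReal.tsum_mul_right]
        gcongr
        exact hsum k

/-- The weights of `outSum` are larger than `2^n` by a factor with summable inverse, so by the
Cauchy–Schwarz inequality the square sum controls the `ℓ¹` sum over dyadic blocks. -/
theorem tsum_sq_le_lintegral_outSum {η : ℝ} (hη : 0 < η) :
    ∃ C : ℝ≥0∞, C ≠ ⊤ ∧ ∀ (k : ℕ) (B : Space → ℝ → ℝ≥0∞) (X : ℕ → ℝ≥0∞),
      Measurable (Function.uncurry B) →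
      (∀ n : ℕ, X n ^ 2 ≤ ENNReal.ofReal ((2 : ℝ) ^ (n : ℝ)) * blockSq B n) →
      (∑' n, X n) ^ 2 ≤ C * ∫⁻ ξ, outSum η k (B ξ) := by
  obtain ⟨C, hC, hsum⟩ := tsum_two_rpow_neg_abs_le hη
  refine ⟨C, hC, fun k B X hB hX => ?_⟩
  have hsq : ∀ x : ℝ, ENNReal.ofReal ((2 : ℝ) ^ (x / 2)) ^ 2 = ENNReal.ofReal ((2 : ℝ) ^ x) := by
    intro x
    rw [← ENNReal.ofReal_pow (by positivity), ← Real.rpow_natCast, ← Real.rpow_mul (by norm_num)]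
    congr 2
    push_cast
    ring
  have h1 : ∀ n : ℕ, X n = ENNReal.ofReal ((2 : ℝ) ^ (-(η * |(n : ℝ) - k|) / 2)) *
      (ENNReal.ofReal ((2 : ℝ) ^ (η * |(n : ℝ) - k| / 2)) * X n) := by
    intro n
    rw [← mul_assoc, ← ENNReal.ofReal_mul (by positivity), ← Real.rpow_add (by norm_num),
      neg_div, neg_add_cancel, Real.rpow_zero, ENNReal.ofReal_one, one_mul]
  calc (∑' n, X n) ^ 2 = (∑' n : ℕ, ENNReal.ofReal ((2 : ℝ) ^ (-(η * |(n : ℝ) - k|) / 2)) *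
        (ENNReal.ofReal ((2 : ℝ) ^ (η * |(n : ℝ) - k| / 2)) * X n)) ^ 2 := by
        congr 1
        exact tsum_congr h1
    _ ≤ (∑' n : ℕ, ENNReal.ofReal ((2 : ℝ) ^ (-(η * |(n : ℝ) - k|) / 2)) ^ 2) *
        ∑' n : ℕ, (ENNReal.ofReal ((2 : ℝ) ^ (η * |(n : ℝ) - k| / 2)) * X n) ^ 2 :=
        tsum_mul_sq_le _ _
    _ ≤ C * ∑' n, ENNReal.ofReal (outWeight η k n) * blockSq B n := by
        refine mul_le_mul' ?_ (ENNReal.tsum_le_tsum fun n => ?_)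
        · simp only [hsq]
          exact hsum k
        · rw [mul_pow, hsq, outWeight, add_comm, Real.rpow_add (by norm_num),
            ENNReal.ofReal_mul (by positivity), mul_assoc]
          gcongr
          exact hX n
    _ = C * ∫⁻ ξ, outSum η k (B ξ) := by
        unfold outSum
        rw [lintegral_tsum fun n => ((measurable_block hB n).const_mul _).aemeasurable]
        congr 1
        refine tsum_congr fun n => ?_
        rw [lintegral_const_mul _ (measurable_block hB n), blockSq]

/-- The `ℓ¹` norm over dyadic blocks with weight `2^{n/2}` controls the `L²` norm in `ξ` of the `L¹`
norm in the modulation variable. -/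
theorem lintegral_lintegral_sq_le {B : Space → ℝ → ℝ≥0∞} {X : ℕ → ℝ≥0∞}
    (hB : Measurable (Function.uncurry B))
    (hX : ∀ n : ℕ, ENNReal.ofReal ((2 : ℝ) ^ (n : ℝ)) * blockSq B n ≤ X n ^ 2) :
    ∫⁻ ξ, (∫⁻ l, B ξ l) ^ 2 ≤ (2 * ∑' n, X n) ^ 2 := by
  have hBξ : ∀ ξ, Measurable (B ξ) := fun ξ => hB.of_uncurry_left
  have h1 : ∀ n ξ, (∫⁻ l in dyadic n, B ξ l) ^ 2 ≤
      ENNReal.ofReal (2 * 2 ^ n) * ∫⁻ l in dyadic n, B ξ l ^ 2 := by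
    intro n ξ
    have h2 := lintegral_mul_sq_le (volume.restrict (dyadic n)) (f := fun _ => 1) (g := B ξ)
      aemeasurable_const (hBξ ξ).aemeasurable
    simp only [one_mul, one_pow, lintegral_const, Measure.restrict_apply_univ] at h2
    refine h2.trans ?_
    gcongr
    exact volume_dyadic_le n
  rw [← ENNReal.tsum_mul_left]
  calc ∫⁻ ξ, (∫⁻ l, B ξ l) ^ 2 = ∫⁻ ξ, (∑' n, ∫⁻ l in dyadic n, B ξ l) ^ 2 := by
        refine lintegral_congr fun ξ => ?_
        rw [lintegral_eq_tsum_dyadic]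
    _ ≤ _ := by
        refine lintegral_tsum_sq_le volume (fun n => ?_) fun n => ?_
        · exact (Measurable.lintegral_prod_right' (f := fun p : Space × ℝ => B p.1 p.2)
            hB).aemeasurable
        · calc ∫⁻ ξ, (∫⁻ l in dyadic n, B ξ l) ^ 2
              ≤ ∫⁻ ξ, ENNReal.ofReal (2 * 2 ^ n) * ∫⁻ l in dyadic n, B ξ l ^ 2 :=
                lintegral_mono fun ξ => h1 n ξ
            _ = 2 * (ENNReal.ofReal ((2 : ℝ) ^ (n : ℝ)) * blockSq B n) := by
                rw [lintegral_const_mul _ (measurable_block hB n), blockSq,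
                  ENNReal.ofReal_mul (by norm_num), Real.rpow_natCast, mul_assoc]
                norm_num
            _ ≤ 4 * X n ^ 2 := by
                gcongr
                · norm_num
                · exact hX n
            _ = (2 * X n) ^ 2 := by
                rw [mul_pow]
                norm_num

/-- For `b ≥ -1/2` even the weakest norm, `p = ∞`, makes `(1 + |l|)⁻¹ B` square integrable. -/
theorem lintegral_inv_mul_sq_lt_top {b : ℝ} (hb : -(1 / 2) ≤ b) {B : Space → ℝ → ℝ≥0∞}
    {N : ℝ≥0∞} (hN : N ≠ ⊤) (hB : Measurable (Function.uncurry B))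
    (hBN : ∀ n : ℕ, ENNReal.ofReal ((2 : ℝ) ^ (2 * b * n)) * blockSq B n ≤ N ^ 2) :
    ∫⁻ ξ, ∫⁻ l, (ENNReal.ofReal (1 + |l|)⁻¹ * B ξ l) ^ 2 < ⊤ := by
  have hBξ : ∀ ξ, Measurable (B ξ) := fun ξ => hB.of_uncurry_left
  have h1 : ∀ n : ℕ, ∀ l ∈ dyadic n,
      ENNReal.ofReal (1 + |l|)⁻¹ ^ 2 ≤ 4 * ENNReal.ofReal ((1 / 2) ^ n) *
        ENNReal.ofReal ((2 : ℝ) ^ (2 * b * n)) := by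
    intro n l hl
    have h2 : (2 : ℝ) ^ n / 2 ≤ 1 + |l| := by
      cases n with
      | zero => norm_num; linarith [abs_nonneg l]
      | succ n =>
        have := (mem_dyadic_succ hl).1
        rw [pow_succ]
        linarith
    have h3 : (1 + |l|)⁻¹ ≤ 2 * (1 / 2) ^ n := by
      rw [inv_le_comm₀ (by positivity) (by positivity), mul_inv, one_div, inv_pow, inv_inv]
      linarith
    -- one of the two factors `2^{-n}` is spent on `2^{2bn}`, the other one makes the sum converge
    have h4 : ((1 : ℝ) / 2) ^ n ≤ (2 : ℝ) ^ (2 * b * n) := by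
      rw [one_div, inv_pow, ← Real.rpow_natCast, ← Real.rpow_neg (by norm_num)]
      refine two_rpow_le_two_rpow ?_
      nlinarith [(Nat.cast_nonneg n : (0 : ℝ) ≤ n)]
    have h40 : (4 : ℝ≥0∞) = ENNReal.ofReal 4 := by norm_num
    rw [h40, ← ENNReal.ofReal_pow (by positivity), ← ENNReal.ofReal_mul (by norm_num),
      ← ENNReal.ofReal_mul (by positivity)]
    refine ENNReal.ofReal_le_ofReal ?_
    calc (1 + |l|)⁻¹ ^ 2 ≤ (2 * (1 / 2) ^ n) ^ 2 := by gcongr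
      _ = 4 * (1 / 2) ^ n * (1 / 2) ^ n := by ring
      _ ≤ _ := by gcongr
  calc ∫⁻ ξ, ∫⁻ l, (ENNReal.ofReal (1 + |l|)⁻¹ * B ξ l) ^ 2
      ≤ ∫⁻ ξ, ∑' n : ℕ, 4 * ENNReal.ofReal ((1 / 2) ^ n) * ENNReal.ofReal ((2 : ℝ) ^ (2 * b * n)) *
          ∫⁻ l in dyadic n, B ξ l ^ 2 := by
        refine lintegral_mono fun ξ => ?_
        rw [lintegral_eq_tsum_dyadic]
        refine ENNReal.tsum_le_tsum fun n => ?_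
        rw [← lintegral_const_mul _ ((hBξ ξ).pow_const 2)]
        refine setLIntegral_mono' (measurableSet_dyadic n) fun l hl => ?_
        rw [mul_pow]
        gcongr
        exact h1 n l hl
    _ = ∑' n : ℕ, 4 * ENNReal.ofReal ((1 / 2) ^ n) * (ENNReal.ofReal ((2 : ℝ) ^ (2 * b * n)) *
          blockSq B n) := by
        rw [lintegral_tsum fun n => ((measurable_block hB n).const_mul _).aemeasurable]
        refine tsum_congr fun n => ?_
        rw [lintegral_const_mul _ (measurable_block hB n), blockSq]
        ring
    _ ≤ ∑' n : ℕ, 4 * ENNReal.ofReal ((1 / 2) ^ n) * N ^ 2 := by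
        refine ENNReal.tsum_le_tsum fun n => ?_
        gcongr
        exact hBN n
    _ < ⊤ := by
        rw [ENNReal.tsum_mul_right, ENNReal.tsum_mul_left]
        have h5 : ∑' n : ℕ, ENNReal.ofReal ((1 / 2) ^ n) ≠ ⊤ := by
          rw [← ENNReal.ofReal_tsum_of_nonneg (fun n => by positivity) summable_geometric_two]
          exact ENNReal.ofReal_ne_top
        finiteness

/-! ### Representatives of the Fourier transforms -/

theorem IsFunction.congr {E : Type*} [NormedAddCommGroup E] [InnerProductSpace ℝ E]
    [FiniteDimensional ℝ E] [MeasurableSpace E] [BorelSpace E] {T : 𝓢'(E, ℂ)} {g g' : E → ℂ}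
    (hg : IsFunction T g) (h : g =ᵐ[volume] g') : IsFunction T g' := by
  refine ⟨hg.1.congr h, fun φ hφ => (hg.2 φ hφ).trans (integral_congr_ae ?_)⟩
  filter_upwards [h] with y hy
  rw [hy]

theorem HatLocInt.exists_measurable {E : Type*} [NormedAddCommGroup E] [InnerProductSpace ℝ E]
    [FiniteDimensional ℝ E] [MeasurableSpace E] [BorelSpace E] {u : 𝓢'(E, ℂ)} (hu : HatLocInt u) :
    ∃ g, Measurable g ∧ IsFunction (hat u) g := by
  have h1 := isFunction_hatFun hu
  have h2 := h1.1.aestronglyMeasurable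
  exact ⟨h2.mk, h2.stronglyMeasurable_mk.measurable, h1.congr h2.ae_eq_mk⟩

theorem gNorm_sq (σ s : ℝ) {f : 𝓢'(Space, ℂ)} {a : Space → ℂ} (ha : IsFunction (hat f) a) :
    gNorm σ s f ^ 2 = ∫⁻ ξ, (ENNReal.ofReal (weight σ s ξ) * ‖a ξ‖ₑ) ^ 2 := by
  rw [gNorm, eLpNorm_two_sq]
  refine lintegral_congr_ae ?_
  filter_upwards [hatFun_ae_eq ha] with ξ hξ
  rw [hξ, enorm_mul, enorm_weight]

theorem memG_of_lintegral {σ s : ℝ} {f : 𝓢'(Space, ℂ)} {a : Space → ℂ} (ha : IsFunction (hat f) a)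
    (h : ∫⁻ ξ, (ENNReal.ofReal (weight σ s ξ) * ‖a ξ‖ₑ) ^ 2 < ⊤) : MemG σ s f := by
  refine ⟨⟨a, ha⟩, ?_⟩
  rw [← gNorm_sq σ s ha] at h
  exact lt_top_iff_ne_top.2 fun ht => by simp [ht] at h

theorem polyL2_of_lintegral {σ : ℝ} (hσ : 0 ≤ σ) (s : ℝ) {a : Space → ℂ}
    (ha : AEStronglyMeasurable a)
    (h : ∫⁻ ξ, (ENNReal.ofReal (weight σ s ξ) * ‖a ξ‖ₑ) ^ 2 < ⊤) : PolyL2 a := by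
  obtain ⟨N, hN⟩ := one_le_weight_mul hσ s
  have hw : AEStronglyMeasurable fun ξ => (weight σ s ξ : ℂ) :=
    (Complex.continuous_ofReal.comp (continuous_weight σ s)).aestronglyMeasurable
  have h1 : PolyL2 fun ξ => (weight σ s ξ : ℂ) * a ξ := by
    refine PolyL2.of_memLp ⟨hw.mul ha, lt_top_iff_ne_top.2 fun ht => ?_⟩
    have h2 := eLpNorm_two_sq (fun ξ => (weight σ s ξ : ℂ) * a ξ) volume
    simp only [enorm_mul, enorm_weight] at h2
    rw [ht] at h2
    rw [← h2] at h
    simp at h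
  refine h1.of_norm_le ha (C := 1) (N := N) (Eventually.of_forall fun ξ => ?_)
  rw [norm_mul, Complex.norm_real, Real.norm_of_nonneg (weight_pos σ s ξ).le, one_mul, ← mul_assoc,
    mul_comm _ (weight σ s ξ)]
  exact le_mul_of_one_le_left (norm_nonneg _) (hN ξ)

theorem MemG.exists_measurable {σ s : ℝ} (hσ : 0 ≤ σ) {f : 𝓢'(Space, ℂ)} (hf : MemG σ s f) :
    ∃ a, Measurable a ∧ IsFunction (hat f) a ∧ PolyL2 a := by
  obtain ⟨a, ham, ha⟩ := hf.1.exists_measurable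
  refine ⟨a, ham, ha, polyL2_of_lintegral hσ s ham.aestronglyMeasurable ?_⟩
  rw [← gNorm_sq σ s ha]
  exact ENNReal.pow_lt_top hf.2

theorem exists_one_add_abs_add_le {h : Space → ℝ} (hg : PolynomialGrowth h) :
    ∃ (C : ℝ) (N : ℕ), 0 ≤ C ∧ ∀ z : SpaceTime,
      1 + |z.fst| + |h z.snd| ≤ C * (1 + ‖z‖ ^ 2) ^ N := by
  obtain ⟨C, m, hC⟩ := hg
  refine ⟨(1 + |C|) * 2 ^ (m + 1), m + 1, by positivity, fun z => ?_⟩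
  have h1 : |z.fst| ≤ ‖z‖ := abs_fst_le z.fst z.snd
  have h2 : ‖z.snd‖ ≤ ‖z‖ := norm_snd_le z.fst z.snd
  have h3 : 1 + ‖z‖ ≤ 2 * (1 + ‖z‖ ^ 2) := by nlinarith [sq_nonneg (‖z‖ - 1)]
  have h4 : (1 : ℝ) ≤ 1 + ‖z‖ := by linarith [norm_nonneg z]
  have h5 : |h z.snd| ≤ |C| * (1 + ‖z‖) ^ (m + 1) :=
    calc |h z.snd| ≤ C * (1 + ‖z.snd‖) ^ m := hC _
      _ ≤ |C| * (1 + ‖z‖) ^ m := by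
        gcongr
        exact le_abs_self C
      _ ≤ |C| * (1 + ‖z‖) ^ (m + 1) := by
        gcongr
        omega
  have h6 : 1 + ‖z‖ ≤ (1 + ‖z‖) ^ (m + 1) := le_self_pow₀ h4 (by omega)
  calc 1 + |z.fst| + |h z.snd| ≤ (1 + |C|) * (1 + ‖z‖) ^ (m + 1) := by linarith
    _ ≤ (1 + |C|) * (2 * (1 + ‖z‖ ^ 2)) ^ (m + 1) := by gcongr
    _ = _ := by rw [mul_pow, mul_assoc]

/-- A function with weighted fibrewise `L²` bounds is in `PolyL2`, because `h` has polynomial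
growth. -/
theorem polyL2_of_fiberSize {h : Space → ℝ} (hh : Continuous h) (hgr : PolynomialGrowth h)
    {σ : ℝ} (hσ : 0 ≤ σ) (s : ℝ) {g : SpaceTime → ℂ} (hg : Measurable g)
    (hfin : ∫⁻ ξ, ∫⁻ l, (ENNReal.ofReal (1 + |l|)⁻¹ * fiberSize h σ s g ξ l) ^ 2 < ⊤) :
    PolyL2 g := by
  obtain ⟨N, hN⟩ := one_le_weight_mul hσ s
  obtain ⟨C, m, hC, hb⟩ := exists_one_add_abs_add_le hgr
  have hw := (continuous_weight σ s).measurable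
  let r : SpaceTime → ℝ := fun z => (1 + |z.fst + h z.snd|)⁻¹ * weight σ s z.snd
  have hr0 : ∀ z, 0 < r z := fun z => mul_pos (by positivity) (weight_pos _ _ _)
  have hrm : Measurable r := by fun_prop
  have hm : Measurable fun z => (r z : ℂ) * g z := by fun_prop
  have h1 : PolyL2 fun z => (r z : ℂ) * g z := by
    refine PolyL2.of_memLp ⟨hm.aestronglyMeasurable, lt_top_iff_ne_top.2 fun ht => ?_⟩
    have h2 := eLpNorm_two_sq (fun z => (r z : ℂ) * g z) volume
    rw [ht, lintegral_shear h (hm.enorm.pow_const 2)] at h2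
    have h3 : ∀ ξ l, ‖(r (WithLp.toLp 2 (l - h ξ, ξ)) : ℂ) * g (WithLp.toLp 2 (l - h ξ, ξ))‖ₑ =
        ENNReal.ofReal (1 + |l|)⁻¹ * fiberSize h σ s g ξ l := by
      intro ξ l
      rw [enorm_mul, ← ofReal_norm, Complex.norm_real, Real.norm_of_nonneg (hr0 _).le, fiberSize,
        ← mul_assoc, ← ENNReal.ofReal_mul (by positivity)]
      change ENNReal.ofReal ((1 + |l - h ξ + h ξ|)⁻¹ * weight σ s ξ) * _ = _
      rw [sub_add_cancel]
    simp only [h3] at h2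
    rw [← h2] at hfin
    simp at hfin
  refine h1.of_norm_le hg.aestronglyMeasurable (C := C) (N := m + N)
    (Eventually.of_forall fun z => ?_)
  rw [norm_mul, Complex.norm_real, Real.norm_of_nonneg (hr0 _).le, ← mul_assoc]
  refine le_mul_of_one_le_left (norm_nonneg _) ?_
  have h2 : ‖z.snd‖ ≤ ‖z‖ := norm_snd_le z.fst z.snd
  have h3 : 1 + |z.fst + h z.snd| ≤ C * (1 + ‖z‖ ^ 2) ^ m :=
    le_trans (by linarith [abs_add_le z.fst (h z.snd)]) (hb z)
  have h4 : 1 ≤ C * (1 + ‖z‖ ^ 2) ^ m * (1 + |z.fst + h z.snd|)⁻¹ := by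
    rw [← div_eq_mul_inv, le_div_iff₀ (by positivity), one_mul]
    exact h3
  have h5 : 1 ≤ weight σ s z.snd * (1 + ‖z‖ ^ 2) ^ N := by
    refine (hN z.snd).trans ?_
    have := (weight_pos σ s z.snd).le
    gcongr
  calc (1 : ℝ) ≤ (C * (1 + ‖z‖ ^ 2) ^ m * (1 + |z.fst + h z.snd|)⁻¹) *
        (weight σ s z.snd * (1 + ‖z‖ ^ 2) ^ N) := one_le_mul_of_one_le_of_one_le h4 h5
    _ = _ := by
      simp only [r]
      rw [pow_add]
      ring

/-- The condition `‖e^{σ‖ξ‖} ⟨ξ⟩^s g‖_{L²_ξ L¹_τ} < ∞`, under which the inverse Fourier transform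
of `g` is a continuous curve in `G^{σ,s}`. -/
def TimeL1 (σ s : ℝ) (g : SpaceTime → ℂ) : Prop :=
  ∫⁻ ξ, (ENNReal.ofReal (weight σ s ξ) * ∫⁻ τ : ℝ, ‖g (WithLp.toLp 2 (τ, ξ))‖ₑ) ^ 2 < ⊤

theorem measurable_fiber {g : SpaceTime → ℂ} (hg : Measurable g) (ξ : Space) :
    Measurable fun τ : ℝ => g (WithLp.toLp 2 (τ, ξ)) :=
  hg.comp (continuous_toLp_prod.measurable.comp (by fun_prop))

theorem lintegral_fiberSize (h : Space → ℝ) (σ s : ℝ) (g : SpaceTime → ℂ)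
    (ξ : Space) : ∫⁻ l, fiberSize h σ s g ξ l =
      ENNReal.ofReal (weight σ s ξ) * ∫⁻ τ : ℝ, ‖g (WithLp.toLp 2 (τ, ξ))‖ₑ := by
  unfold fiberSize
  rw [lintegral_const_mul' _ _ ENNReal.ofReal_ne_top]
  congr 1
  exact lintegral_sub_right_eq_self (fun τ : ℝ => ‖g (WithLp.toLp 2 (τ, ξ))‖ₑ) (h ξ)

/-- A measurable representative of `û`, with the dyadic bounds in the coordinates `(ξ, τ + h(ξ))`.
-/
theorem MemX.exists_measurable_top {h : Space → ℝ} (hh : Continuous h) (hgr : PolynomialGrowth h)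
    {σ s b : ℝ} (hσ : 0 ≤ σ) (hb : -(1 / 2) ≤ b) {u : 𝓢'(SpaceTime, ℂ)}
    (hu : MemX h σ s b ⊤ u) :
    ∃ g, Measurable g ∧ IsFunction (hat u) g ∧ PolyL2 g ∧
      ∀ n : ℕ, ENNReal.ofReal ((2 : ℝ) ^ (2 * b * n)) * blockSq (fiberSize h σ s g) n ≤
        xNorm h σ s b ⊤ u ^ 2 := by
  obtain ⟨g, hgm, hg⟩ := hu.1.exists_measurable
  have hN : ∀ n : ℕ, ENNReal.ofReal ((2 : ℝ) ^ (2 * b * n)) * blockSq (fiberSize h σ s g) n ≤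
      xNorm h σ s b ⊤ u ^ 2 := fun n => by
    rw [← xPiece_sq hh σ s b hgm (hatFun_ae_eq hg)]
    gcongr
    exact xPiece_le_xNorm_top _ _ _ _ _ _
  exact ⟨g, hgm, hg, polyL2_of_fiberSize hh hgr hσ s hgm
    (lintegral_inv_mul_sq_lt_top hb hu.2.ne (measurable_fiberSize hh σ s hgm) hN), hN⟩

/-- A measurable representative of `û`; the norm of `X^{σ,s,1/2;1}` is strong enough for `TimeL1`.
-/
theorem MemX.exists_measurable_one {h : Space → ℝ} (hh : Continuous h) (hgr : PolynomialGrowth h)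
    {σ s : ℝ} (hσ : 0 ≤ σ) {u : 𝓢'(SpaceTime, ℂ)} (hu : MemX h σ s (1 / 2) 1 u) :
    ∃ g, Measurable g ∧ IsFunction (hat u) g ∧ PolyL2 g ∧ TimeL1 σ s g := by
  obtain ⟨g, hgm, hg⟩ := hu.1.exists_measurable
  have hX := xPiece_sq hh σ s (1 / 2) hgm (hatFun_ae_eq hg)
  have hN : ∀ n : ℕ, ENNReal.ofReal ((2 : ℝ) ^ (2 * (1 / 2 : ℝ) * n)) *
      blockSq (fiberSize h σ s g) n ≤ xNorm h σ s (1 / 2) 1 u ^ 2 := fun n => by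
    rw [← hX]
    gcongr
    exact xPiece_le_xNorm_one _ _ _ _ _ _
  refine ⟨g, hgm, hg, polyL2_of_fiberSize hh hgr hσ s hgm
    (lintegral_inv_mul_sq_lt_top (by norm_num) hu.2.ne (measurable_fiberSize hh σ s hgm) hN), ?_⟩
  have h1 := lintegral_lintegral_sq_le (X := xPiece h σ s (1 / 2) u)
    (measurable_fiberSize hh σ s hgm) fun n => by
      rw [hX, mul_one_div_cancel two_ne_zero, one_mul]
  simp only [lintegral_fiberSize h σ s g] at h1
  refine h1.trans_lt (ENNReal.pow_lt_top (ENNReal.mul_lt_top (by norm_num) ?_))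
  rw [← xNorm_one]
  exact hu.2

/-! ### Distributions that are continuous curves in `G^{σ,s}` -/

/-- The inverse Fourier transform in time of the function `g` of `(τ, ξ)`, up to the factor `2π`. -/
def timeTransform (g : SpaceTime → ℂ) (t : ℝ) (ξ : Space) : ℂ :=
  ∫ τ : ℝ, Complex.exp (Complex.I * (t * τ : ℝ)) * g (WithLp.toLp 2 (τ, ξ))

theorem measurable_timeTransform {g : SpaceTime → ℂ} (hg : Measurable g) :
    Measurable (Function.uncurry (timeTransform g)) := by
  have h1 : Measurable fun p : (ℝ × Space) × ℝ =>
      Complex.exp (Complex.I * (p.1.1 * p.2 : ℝ)) * g (WithLp.toLp 2 (p.2, p.1.2)) := by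
    have h2 : Measurable fun p : (ℝ × Space) × ℝ => g (WithLp.toLp 2 (p.2, p.1.2)) :=
      hg.comp (continuous_toLp_prod.measurable.comp (by fun_prop))
    fun_prop
  exact (h1.stronglyMeasurable.integral_prod_right' (ν := volume)).measurable

theorem enorm_timeTransform_le (g : SpaceTime → ℂ) (t : ℝ) (ξ : Space) :
    ‖timeTransform g t ξ‖ₑ ≤ ∫⁻ τ : ℝ, ‖g (WithLp.toLp 2 (τ, ξ))‖ₑ := by
  refine (enorm_integral_le_lintegral_enorm _).trans (le_of_eq (lintegral_congr fun τ => ?_))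
  rw [enorm_mul, ← ofReal_norm, norm_exp_I_mul, ENNReal.ofReal_one, one_mul]

theorem measurable_lintegral_fiber {g : SpaceTime → ℂ} (hg : Measurable g) :
    Measurable fun ξ => ∫⁻ τ : ℝ, ‖g (WithLp.toLp 2 (τ, ξ))‖ₑ := by
  have h2 : Measurable fun p : Space × ℝ => g (WithLp.toLp 2 (p.2, p.1)) :=
    hg.comp (continuous_toLp_prod.measurable.comp (by fun_prop))
  exact h2.enorm.lintegral_prod_right'

theorem TimeL1.ae_lt_top {σ s : ℝ} {g : SpaceTime → ℂ} (hg : Measurable g) (h : TimeL1 σ s g) :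
    ∀ᵐ ξ, ∫⁻ τ : ℝ, ‖g (WithLp.toLp 2 (τ, ξ))‖ₑ < ⊤ := by
  have hm : Measurable fun ξ =>
      (ENNReal.ofReal (weight σ s ξ) * ∫⁻ τ : ℝ, ‖g (WithLp.toLp 2 (τ, ξ))‖ₑ) ^ 2 := by
    have h1 := (continuous_weight σ s).measurable
    have h2 := measurable_lintegral_fiber hg
    fun_prop
  filter_upwards [MeasureTheory.ae_lt_top hm (ne_of_lt h)] with ξ hξ
  by_contra hc
  rw [not_lt, top_le_iff] at hc
  rw [hc, ENNReal.mul_top (by simpa using weight_pos σ s ξ)] at hξ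
  simp at hξ

theorem TimeL1.ae_integrable {σ s : ℝ} {g : SpaceTime → ℂ} (hg : Measurable g) (h : TimeL1 σ s g) :
    ∀ᵐ ξ, Integrable fun τ : ℝ => g (WithLp.toLp 2 (τ, ξ)) := by
  filter_upwards [h.ae_lt_top hg] with ξ hξ
  exact ⟨(measurable_fiber hg ξ).aestronglyMeasurable, hξ⟩

theorem TimeL1.sub {σ s : ℝ} {g g' : SpaceTime → ℂ} (hgm : Measurable g)
    (hg : TimeL1 σ s g) (hg' : TimeL1 σ s g') : TimeL1 σ s fun z => g z - g' z := by
  have hm : ∀ {g : SpaceTime → ℂ}, Measurable g → Measurable fun ξ =>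
      (ENNReal.ofReal (weight σ s ξ) * ∫⁻ τ : ℝ, ‖g (WithLp.toLp 2 (τ, ξ))‖ₑ) ^ 2 := by
    intro g hg
    have h1 := (continuous_weight σ s).measurable
    have h2 := measurable_lintegral_fiber hg
    fun_prop
  unfold TimeL1
  calc ∫⁻ ξ, (ENNReal.ofReal (weight σ s ξ) *
        ∫⁻ τ : ℝ, ‖g (WithLp.toLp 2 (τ, ξ)) - g' (WithLp.toLp 2 (τ, ξ))‖ₑ) ^ 2
      ≤ ∫⁻ ξ, 2 * ((ENNReal.ofReal (weight σ s ξ) * ∫⁻ τ : ℝ, ‖g (WithLp.toLp 2 (τ, ξ))‖ₑ) ^ 2 +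
          (ENNReal.ofReal (weight σ s ξ) * ∫⁻ τ : ℝ, ‖g' (WithLp.toLp 2 (τ, ξ))‖ₑ) ^ 2) := by
        refine lintegral_mono fun ξ => le_trans ?_ (add_sq_le_two_mul _ _)
        rw [← mul_add, ← lintegral_add_left (measurable_fiber hgm ξ).enorm]
        gcongr with τ
        exact enorm_sub_le
    _ < ⊤ := by
        rw [lintegral_const_mul' _ _ (by norm_num), lintegral_add_left (hm hgm)]
        exact ENNReal.mul_lt_top (by norm_num) (ENNReal.add_lt_top.2 ⟨hg, hg'⟩)

/-- The dual bound: the pairing of a negative power of `1 + |ξ|²` with a function in the weighted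
`L²` space is finite. -/
theorem exists_lintegral_pow_mul_lt_top {σ : ℝ} (hσ : 0 ≤ σ) (s : ℝ) :
    ∃ M : ℕ, ∃ C : ℝ≥0∞, C ≠ ⊤ ∧ ∀ A : Space → ℝ≥0∞, Measurable A →
      (∫⁻ ξ : Space, ENNReal.ofReal ((1 + ‖ξ‖ ^ 2) ^ M)⁻¹ * A ξ) ^ 2 ≤
        C * ∫⁻ ξ, (ENNReal.ofReal (weight σ s ξ) * A ξ) ^ 2 := by
  obtain ⟨N, hN⟩ := one_le_weight_mul hσ s
  have hw := (continuous_weight σ s).measurable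
  refine ⟨N + 2, ∫⁻ ξ : Space, ENNReal.ofReal ((1 + ‖ξ‖ ^ 2) ^ 2)⁻¹ ^ 2, ?_, fun A hA => ?_⟩
  · have h1 : ∀ ξ : Space, ENNReal.ofReal ((1 + ‖ξ‖ ^ 2) ^ 2)⁻¹ ^ 2 ≤
        ENNReal.ofReal 16 * ‖((1 + ‖ξ‖) ^ 3)⁻¹‖ₑ := by
      intro ξ
      have h0 := norm_nonneg ξ
      have h2 : 1 + ‖ξ‖ ≤ 2 * (1 + ‖ξ‖ ^ 2) := by nlinarith [sq_nonneg (‖ξ‖ - 1)]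
      rw [← ENNReal.ofReal_pow (by positivity), ← ofReal_norm,
        Real.norm_of_nonneg (by positivity), ← ENNReal.ofReal_mul (by norm_num)]
      refine ENNReal.ofReal_le_ofReal ?_
      rw [inv_pow, ← pow_mul, ← div_eq_mul_inv, le_div_iff₀ (by positivity),
        inv_mul_le_iff₀ (by positivity)]
      calc (1 + ‖ξ‖) ^ 3 ≤ (2 * (1 + ‖ξ‖ ^ 2)) ^ 3 := by gcongr
        _ = 8 * (1 + ‖ξ‖ ^ 2) ^ 3 := by ring
        _ ≤ 16 * (1 + ‖ξ‖ ^ 2) ^ 4 := by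
          gcongr
          · norm_num
          · nlinarith
          · norm_num
        _ = _ := by ring
    refine ne_top_of_le_ne_top ?_ (lintegral_mono h1)
    rw [lintegral_const_mul' _ _ ENNReal.ofReal_ne_top]
    exact ENNReal.mul_ne_top ENNReal.ofReal_ne_top integrable_one_add_norm_inv.2.ne
  · have h1 : ∀ ξ : Space, ENNReal.ofReal ((1 + ‖ξ‖ ^ 2) ^ (N + 2))⁻¹ ≤
        ENNReal.ofReal ((1 + ‖ξ‖ ^ 2) ^ 2)⁻¹ * ENNReal.ofReal (weight σ s ξ) := by
      intro ξ
      rw [← ENNReal.ofReal_mul (by positivity)]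
      refine ENNReal.ofReal_le_ofReal ?_
      rw [pow_add, mul_inv, mul_comm]
      gcongr
      rw [inv_le_iff_one_le_mul₀ (by positivity)]
      exact hN ξ
    calc (∫⁻ ξ : Space, ENNReal.ofReal ((1 + ‖ξ‖ ^ 2) ^ (N + 2))⁻¹ * A ξ) ^ 2
        ≤ (∫⁻ ξ : Space, ENNReal.ofReal ((1 + ‖ξ‖ ^ 2) ^ 2)⁻¹ *
            (ENNReal.ofReal (weight σ s ξ) * A ξ)) ^ 2 := by
          refine pow_le_pow_left' (lintegral_mono fun ξ => ?_) 2
          rw [← mul_assoc]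
          exact mul_le_mul_left (h1 ξ) _
      _ ≤ _ := lintegral_mul_sq_le volume (by fun_prop) (by fun_prop)

theorem integrable_partialHatInv_mul {σ s : ℝ} (hσ : 0 ≤ σ) {g : SpaceTime → ℂ}
    (hg : Measurable g) (h : TimeL1 σ s g) (φ : 𝓢(SpaceTime, ℂ)) :
    Integrable (fun p : Space × ℝ => partialHatInv φ p.2 p.1 * timeTransform g p.2 p.1)
      (volume.prod volume) := by
  obtain ⟨M, C, hC, hM⟩ := exists_lintegral_pow_mul_lt_top hσ s
  obtain ⟨D, hD, hb⟩ := exists_norm_partialHatInv_le φ M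
  have hm : Measurable fun p : Space × ℝ => partialHatInv φ p.2 p.1 * timeTransform g p.2 p.1 :=
    ((measurable_partialHatInv φ).comp measurable_swap).mul
      ((measurable_timeTransform hg).comp measurable_swap)
  have hA := measurable_lintegral_fiber hg
  have h1 := (hM _ hA).trans_lt (ENNReal.mul_lt_top hC.lt_top h)
  have h2 : ∫⁻ ξ : Space, ENNReal.ofReal ((1 + ‖ξ‖ ^ 2) ^ M)⁻¹ *
      ∫⁻ τ : ℝ, ‖g (WithLp.toLp 2 (τ, ξ))‖ₑ ≠ ⊤ := fun ht => by simp [ht] at h1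
  refine ⟨hm.aestronglyMeasurable, ?_⟩
  rw [hasFiniteIntegral_iff_enorm, lintegral_prod _ hm.enorm.aemeasurable]
  calc ∫⁻ ξ, ∫⁻ t, ‖partialHatInv φ t ξ * timeTransform g t ξ‖ₑ
      ≤ ∫⁻ ξ : Space, ∫⁻ t : ℝ, (ENNReal.ofReal (D * (1 + t ^ 2)⁻¹)) *
          (ENNReal.ofReal ((1 + ‖ξ‖ ^ 2) ^ M)⁻¹ * ∫⁻ τ : ℝ, ‖g (WithLp.toLp 2 (τ, ξ))‖ₑ) := by
        refine lintegral_mono fun ξ => lintegral_mono fun t => ?_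
        rw [enorm_mul, ← mul_assoc, ← ENNReal.ofReal_mul (by positivity)]
        gcongr
        · rw [← ofReal_norm]
          exact ENNReal.ofReal_le_ofReal (hb t ξ)
        · exact enorm_timeTransform_le g t ξ
    _ = (∫⁻ t : ℝ, ENNReal.ofReal (D * (1 + t ^ 2)⁻¹)) *
          ∫⁻ ξ : Space, ENNReal.ofReal ((1 + ‖ξ‖ ^ 2) ^ M)⁻¹ *
            ∫⁻ τ : ℝ, ‖g (WithLp.toLp 2 (τ, ξ))‖ₑ := by
        rw [← lintegral_const_mul _ (by fun_prop)]
        refine lintegral_congr fun ξ => ?_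
        rw [lintegral_mul_const _ (by fun_prop)]
    _ < ⊤ := by
        refine ENNReal.mul_lt_top ?_ h2.lt_top
        exact (integrable_inv_one_add_sq.const_mul D).lintegral_lt_top

theorem integral_schwartzHatInv_mul {g : SpaceTime → ℂ} (hp : PolyL2 g) (φ : 𝓢(SpaceTime, ℂ)) :
    ∫ z, schwartzHatInv SpaceTime φ z * g z = ∫ ξ, ∫ τ : ℝ,
      schwartzHatInv SpaceTime φ (WithLp.toLp 2 (τ, ξ)) * g (WithLp.toLp 2 (τ, ξ)) := by
  rw [integral_spaceTime, Measure.volume_eq_prod]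
  have h1 := integrable_spaceTime.1 (hp.integrable_mul (schwartzHatInv SpaceTime φ))
  rw [Measure.volume_eq_prod] at h1
  exact integral_prod_symm _ h1

/-- The Plancherel formula in time alone. -/
theorem apply_eq_integral_timeTransform {σ s : ℝ} {u : 𝓢'(SpaceTime, ℂ)} {g : SpaceTime → ℂ}
    (hg : Measurable g) (hu : IsFunction (hat u) g) (hp : PolyL2 g) (h : TimeL1 σ s g)
    (φ : 𝓢(SpaceTime, ℂ)) :
    u φ = ∫ ξ, ∫ t, partialHatInv φ t ξ * timeTransform g t ξ := by
  rw [apply_eq_integral hu hp, integral_schwartzHatInv_mul hp]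
  refine integral_congr_ae ?_
  filter_upwards [h.ae_integrable hg] with ξ hξ
  simp only [schwartzHatInv_eq_integral_partialHatInv, timeTransform]
  rw [← integral_mul_integral_exp hξ (integrable_partialHatInv φ ξ)]
  refine integral_congr_ae (Eventually.of_forall fun τ => ?_)
  simp only
  rw [mul_comm]

theorem le_rpow_mul_of_sq_le {x y C : ℝ≥0∞} (h : x ^ 2 ≤ C * y ^ 2) : x ≤ C ^ (1 / 2 : ℝ) * y := by
  rw [← rpow_half_sq C, ← mul_pow] at h
  exact (ENNReal.pow_le_pow_left_iff two_ne_zero).1 h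

/-- The pairing with a Schwartz function is continuous on `G^{σ,s}`. -/
theorem exists_enorm_apply_le {σ : ℝ} (hσ : 0 ≤ σ) (s : ℝ) (g : 𝓢(Space, ℂ)) :
    ∃ C : ℝ≥0∞, C ≠ ⊤ ∧ ∀ (f : 𝓢'(Space, ℂ)) (a : Space → ℂ), Measurable a →
      IsFunction (hat f) a → PolyL2 a → ‖f g‖ₑ ≤ C * gNorm σ s f := by
  obtain ⟨M, C, hC, hM⟩ := exists_lintegral_pow_mul_lt_top hσ s
  obtain ⟨D, hD, hb⟩ : ∃ D : ℝ, 0 ≤ D ∧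
      ∀ ξ : Space, ‖schwartzHatInv Space g ξ‖ ≤ D * ((1 + ‖ξ‖ ^ 2) ^ M)⁻¹ := by
    refine ⟨2 ^ (2 * M) * (Finset.Iic (2 * M, 0)).sup
      (fun m : ℕ × ℕ => SchwartzMap.seminorm ℝ m.1 m.2) (schwartzHatInv Space g), by positivity,
      fun ξ => ?_⟩
    have h := SchwartzMap.one_add_le_sup_seminorm_apply (𝕜 := ℝ) (m := (2 * M, 0)) (k := 2 * M)
      (n := 0) le_rfl le_rfl (schwartzHatInv Space g) ξ
    rw [norm_iteratedFDeriv_zero] at h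
    rw [← div_eq_mul_inv, le_div_iff₀ (by positivity), mul_comm]
    refine le_trans ?_ h
    rw [pow_mul]
    gcongr
    nlinarith [norm_nonneg ξ]
  refine ⟨ENNReal.ofReal D * C ^ (1 / 2 : ℝ), ENNReal.mul_ne_top ENNReal.ofReal_ne_top
    (ENNReal.rpow_ne_top_of_nonneg (by norm_num) hC), fun f a ham ha hp => ?_⟩
  rw [apply_eq_integral ha hp, mul_assoc]
  calc ‖∫ ξ, schwartzHatInv Space g ξ * a ξ‖ₑ
      ≤ ∫⁻ ξ, ‖schwartzHatInv Space g ξ * a ξ‖ₑ := enorm_integral_le_lintegral_enorm _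
    _ ≤ ∫⁻ ξ : Space, ENNReal.ofReal D * (ENNReal.ofReal ((1 + ‖ξ‖ ^ 2) ^ M)⁻¹ * ‖a ξ‖ₑ) := by
        refine lintegral_mono fun ξ => ?_
        rw [enorm_mul, ← mul_assoc, ← ENNReal.ofReal_mul hD]
        gcongr
        rw [← ofReal_norm]
        exact ENNReal.ofReal_le_ofReal (hb ξ)
    _ ≤ ENNReal.ofReal D * (C ^ (1 / 2 : ℝ) * gNorm σ s f) := by
        rw [lintegral_const_mul' _ _ ENNReal.ofReal_ne_top]
        gcongr
        refine le_rpow_mul_of_sq_le ?_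
        rw [gNorm_sq σ s ha]
        exact hM _ ham.enorm

theorem continuous_apply_of_tendsto_gNorm {σ s : ℝ} (hσ : 0 ≤ σ) {U : ℝ → 𝓢'(Space, ℂ)}
    (hU : ∀ t, MemG σ s (U t)) (hc : ∀ t₀, Tendsto (fun t => gNorm σ s (U t - U t₀)) (𝓝 t₀) (𝓝 0))
    (g : 𝓢(Space, ℂ)) : Continuous fun t => U t g := by
  obtain ⟨C, hC, hb⟩ := exists_enorm_apply_le hσ s g
  rw [continuous_iff_continuousAt]
  intro t₀
  rw [ContinuousAt, tendsto_iff_edist_tendsto_0]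
  have h1 : Tendsto (fun t => C * gNorm σ s (U t - U t₀)) (𝓝 t₀) (𝓝 0) := by
    simpa using ENNReal.Tendsto.const_mul (hc t₀) (Or.inr hC)
  refine tendsto_of_tendsto_of_tendsto_of_le_of_le tendsto_const_nhds h1 (fun _ => zero_le)
    fun t => ?_
  obtain ⟨a, ham, ha, hap⟩ := (hU t).exists_measurable hσ
  obtain ⟨a', ham', ha', hap'⟩ := (hU t₀).exists_measurable hσ
  have h2 := hb (U t - U t₀) (fun ξ => a ξ - a' ξ) (ham.sub ham')
    (by rw [hat_sub]; exact ha.sub ha') (hap.sub hap')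
  rw [edist_eq_enorm_sub]
  exact h2

/-- The product `θ(t) g(x)`. -/
def tensor (θ : ℝ → ℝ) (hθ : ContDiff ℝ ∞ θ) (hc : HasCompactSupport θ) (g : 𝓢(Space, ℂ))
    (hg : HasCompactSupport g) : 𝓢(SpaceTime, ℂ) :=
  HasCompactSupport.toSchwartzMap (f := fun z : SpaceTime => (θ z.fst : ℂ) * g z.snd)
    (by
      refine HasCompactSupport.intro ((hc.isCompact.prod hg.isCompact).image continuous_toLp_prod)
        fun z hz => ?_
      by_contra h
      refine hz ⟨(z.fst, z.snd),
        ⟨subset_tsupport _ fun h0 => h ?_, subset_tsupport _ fun h0 => h ?_⟩, rfl⟩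
      · rw [h0, Complex.ofReal_zero, zero_mul]
      · rw [h0, mul_zero])
    (by
      have h1 : ContDiff ℝ ∞ fun z : SpaceTime => z.fst :=
        ((ContinuousLinearMap.fst ℝ ℝ Space).comp
          (WithLp.prodContinuousLinearEquiv 2 ℝ ℝ Space).toContinuousLinearMap).contDiff
      have h2 : ContDiff ℝ ∞ fun z : SpaceTime => z.snd :=
        ((ContinuousLinearMap.snd ℝ ℝ Space).comp
          (WithLp.prodContinuousLinearEquiv 2 ℝ ℝ Space).toContinuousLinearMap).contDiff
      exact (Complex.ofRealCLM.contDiff.comp (hθ.comp h1)).mul ((g.smooth ⊤).comp h2))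

section Tensor

variable {θ : ℝ → ℝ} (hθ : ContDiff ℝ ∞ θ) (hc : HasCompactSupport θ) (g : 𝓢(Space, ℂ))
  (hg : HasCompactSupport g)

theorem tensor_apply (t : ℝ) (x : Space) :
    tensor θ hθ hc g hg (WithLp.toLp 2 (t, x)) = θ t * g x := rfl

theorem slice_tensor (t : ℝ) : slice t (tensor θ hθ hc g hg) = (θ t : ℂ) • g := by
  refine SchwartzMap.ext fun x => ?_
  rw [slice_apply, tensor_apply]
  rfl

theorem tsupport_tensor_subset {δ : ℝ} (hδ : tsupport θ ⊆ Set.Ioo (-δ) δ) :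
    tsupport (tensor θ hθ hc g hg) ⊆ slab δ := by
  have hcont : Continuous fun z : SpaceTime => z.fst := by fun_prop
  refine (closure_minimal (t := {z : SpaceTime | z.fst ∈ tsupport θ}) (fun z hz => ?_)
    ((isClosed_tsupport θ).preimage hcont)).trans fun z hz => hδ hz
  refine subset_tsupport _ fun h0 => hz ?_
  change (θ z.fst : ℂ) * g z.snd = 0
  rw [h0, Complex.ofReal_zero, zero_mul]

theorem hasCompactSupport_tensor : HasCompactSupport (tensor θ hθ hc g hg) := by
  refine HasCompactSupport.intro ((hc.isCompact.prod hg.isCompact).image continuous_toLp_prod)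
    fun z hz => ?_
  by_contra h
  have h1 : (θ z.fst : ℂ) * g z.snd ≠ 0 := h
  refine hz ⟨(z.fst, z.snd), ⟨subset_tsupport _ fun h0 => h1 ?_, subset_tsupport _ fun h0 => h1 ?_⟩,
    rfl⟩
  · rw [h0, Complex.ofReal_zero, zero_mul]
  · rw [h0, mul_zero]

end Tensor

/-- A distribution is a continuous curve in at most one way, so that its value at a time is well
defined: two such curves agree after integration against all `θ(t) g(x)`. -/
theorem IsCurve.eq {σ s : ℝ} (hσ : 0 ≤ σ) {u : 𝓢'(SpaceTime, ℂ)} {U V : ℝ → 𝓢'(Space, ℂ)}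
    (hU : IsCurve σ s u U) (hV : IsCurve σ s u V) (t : ℝ) : U t = V t := by
  refine tempered_ext_of_hasCompactSupport fun g hg => ?_
  have h1 := continuous_apply_of_tendsto_gNorm hσ hU.1 hU.2.1 g
  have h2 := continuous_apply_of_tendsto_gNorm hσ hV.1 hV.2.1 g
  have h3 : (fun t => U t g) =ᵐ[volume] fun t => V t g := by
    refine ae_eq_of_integral_contDiff_smul_eq h1.locallyIntegrable h2.locallyIntegrable
      fun θ hθ hc => ?_
    have h4 := hU.2.2 (tensor θ hθ hc g hg) (hasCompactSupport_tensor hθ hc g hg)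
    rw [hV.2.2 (tensor θ hθ hc g hg) (hasCompactSupport_tensor hθ hc g hg)] at h4
    simpa only [slice_tensor, map_smul, smul_eq_mul, Complex.real_smul] using h4.symm
  exact congrFun ((h1.ae_eq_iff_eq volume h2).1 h3) t

theorem enorm_inv_two_pi_le_one : ‖(2 * Real.pi : ℂ)⁻¹‖ₑ ≤ 1 := by
  rw [← ofReal_norm, ← ENNReal.ofReal_one]
  refine ENNReal.ofReal_le_ofReal ?_
  rw [norm_inv, norm_mul, Complex.norm_real, Real.norm_of_nonneg Real.pi_pos.le]
  refine inv_le_one_of_one_le₀ ?_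
  norm_num
  linarith [Real.pi_gt_three]

theorem TimeL1.lintegral_timeTransform_le {σ s : ℝ} {g : SpaceTime → ℂ} (h : TimeL1 σ s g)
    (t : ℝ) : ∫⁻ ξ, (ENNReal.ofReal (weight σ s ξ) *
      ‖(2 * Real.pi : ℂ)⁻¹ * timeTransform g t ξ‖ₑ) ^ 2 < ⊤ := by
  refine lt_of_le_of_lt (lintegral_mono fun ξ => ?_) h
  gcongr
  calc ‖(2 * Real.pi : ℂ)⁻¹ * timeTransform g t ξ‖ₑ
      ≤ 1 * ‖timeTransform g t ξ‖ₑ := by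
        rw [enorm_mul]
        gcongr
        exact enorm_inv_two_pi_le_one
    _ ≤ _ := by
        rw [one_mul]
        exact enorm_timeTransform_le g t ξ

theorem continuous_timeTransform {g : SpaceTime → ℂ} {ξ : Space}
    (hξ : Integrable fun τ : ℝ => g (WithLp.toLp 2 (τ, ξ))) :
    Continuous fun t => timeTransform g t ξ := by
  refine continuous_of_dominated (bound := fun τ => ‖g (WithLp.toLp 2 (τ, ξ))‖)
    (fun t => (integrable_exp_mul hξ t).aestronglyMeasurable)
    (fun t => Eventually.of_forall fun τ => ?_) hξ.norm (Eventually.of_forall fun τ => ?_)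
  · rw [norm_mul, norm_exp_I_mul, one_mul]
  · fun_prop

/-- If `û ∈ L²_ξ L¹_τ` with weight `e^{σ‖ξ‖} ⟨ξ⟩^s`, then `u` is a continuous curve in `G^{σ,s}`. -/
theorem exists_isCurve {σ s : ℝ} (hσ : 0 ≤ σ) {u : 𝓢'(SpaceTime, ℂ)} {g : SpaceTime → ℂ}
    (hg : Measurable g) (hu : IsFunction (hat u) g) (hp : PolyL2 g) (h : TimeL1 σ s g) :
    ∃ U, IsCurve σ s u U ∧
      ∀ t, IsFunction (hat (U t)) fun ξ => (2 * Real.pi : ℂ)⁻¹ * timeTransform g t ξ := by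
  have hw := (continuous_weight σ s).measurable
  have hm : ∀ t, Measurable fun ξ => (2 * Real.pi : ℂ)⁻¹ * timeTransform g t ξ := fun t =>
    ((measurable_timeTransform hg).of_uncurry_left).const_mul _
  have hpt : ∀ t, PolyL2 fun ξ => (2 * Real.pi : ℂ)⁻¹ * timeTransform g t ξ := fun t =>
    polyL2_of_lintegral hσ s (hm t).aestronglyMeasurable (h.lintegral_timeTransform_le t)
  choose U hU using fun t => (hpt t).exists_isFunction_hat
  refine ⟨U, ⟨fun t => memG_of_lintegral (hU t) (h.lintegral_timeTransform_le t), fun t₀ => ?_,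
    fun φ _ => ?_⟩, hU⟩
  -- continuity in time, by dominated convergence at each frequency
  · have hsq : ∀ t, gNorm σ s (U t - U t₀) = (∫⁻ ξ, (ENNReal.ofReal (weight σ s ξ) *
        ‖(2 * Real.pi : ℂ)⁻¹ * timeTransform g t ξ -
          (2 * Real.pi : ℂ)⁻¹ * timeTransform g t₀ ξ‖ₑ) ^ 2) ^ (1 / 2 : ℝ) := by
      intro t
      have h1 : IsFunction (hat (U t - U t₀)) fun ξ => (2 * Real.pi : ℂ)⁻¹ * timeTransform g t ξ -
          (2 * Real.pi : ℂ)⁻¹ * timeTransform g t₀ ξ := by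
        rw [hat_sub]
        exact (hU t).sub (hU t₀)
      rw [← gNorm_sq σ s h1, ← ENNReal.rpow_natCast, ← ENNReal.rpow_mul]
      norm_num
    simp only [hsq]
    have h0 : (0 : ℝ≥0∞) = 0 ^ (1 / 2 : ℝ) := by norm_num
    rw [h0]
    refine (ENNReal.continuous_rpow_const.tendsto 0).comp ?_
    have hA := measurable_lintegral_fiber hg
    have hlim := tendsto_lintegral_filter_of_dominated_convergence (μ := volume) (l := 𝓝 t₀)
      (F := fun t ξ => (ENNReal.ofReal (weight σ s ξ) *
        ‖(2 * Real.pi : ℂ)⁻¹ * timeTransform g t ξ -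
          (2 * Real.pi : ℂ)⁻¹ * timeTransform g t₀ ξ‖ₑ) ^ 2) (f := fun _ => 0)
      (fun ξ => 4 * (ENNReal.ofReal (weight σ s ξ) * ∫⁻ τ : ℝ, ‖g (WithLp.toLp 2 (τ, ξ))‖ₑ) ^ 2)
      (Eventually.of_forall fun t => by
        have h1 := hm t
        have h2 := hm t₀
        fun_prop) (Eventually.of_forall fun t => ae_of_all _ fun ξ => ?_) ?_ ?_
    · simpa only [lintegral_zero] using hlim
    · have h1 : ∀ t, ‖(2 * Real.pi : ℂ)⁻¹ * timeTransform g t ξ‖ₑ ≤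
          ∫⁻ τ : ℝ, ‖g (WithLp.toLp 2 (τ, ξ))‖ₑ := by
        intro t
        refine le_trans ?_ (enorm_timeTransform_le g t ξ)
        rw [enorm_mul]
        exact mul_le_of_le_one_left zero_le enorm_inv_two_pi_le_one
      calc (ENNReal.ofReal (weight σ s ξ) * ‖(2 * Real.pi : ℂ)⁻¹ * timeTransform g t ξ -
            (2 * Real.pi : ℂ)⁻¹ * timeTransform g t₀ ξ‖ₑ) ^ 2
          ≤ (ENNReal.ofReal (weight σ s ξ) * (2 * ∫⁻ τ : ℝ, ‖g (WithLp.toLp 2 (τ, ξ))‖ₑ)) ^ 2 := by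
            gcongr
            exact enorm_sub_le.trans ((add_le_add (h1 t) (h1 t₀)).trans_eq (two_mul _).symm)
        _ = _ := by ring
    · rw [lintegral_const_mul' _ _ (by norm_num)]
      exact ENNReal.mul_ne_top (by norm_num) (ne_of_lt h)
    · filter_upwards [h.ae_integrable hg] with ξ hξ
      have h1 : Continuous fun t => (ENNReal.ofReal (weight σ s ξ) *
          ‖(2 * Real.pi : ℂ)⁻¹ * timeTransform g t ξ -
            (2 * Real.pi : ℂ)⁻¹ * timeTransform g t₀ ξ‖ₑ) ^ 2 := by
        have h2 := continuous_timeTransform hξ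
        refine (ENNReal.continuous_pow 2).comp
          ((ENNReal.continuous_const_mul ENNReal.ofReal_ne_top).comp ?_)
        fun_prop
      simpa using h1.tendsto t₀
  -- the curve represents `u`, by Fubini's theorem
  · rw [apply_eq_integral_timeTransform hg hu hp h,
      integral_integral_swap (f := fun ξ t => partialHatInv φ t ξ * timeTransform g t ξ)
        (integrable_partialHatInv_mul hσ hg h φ)]
    refine integral_congr_ae (Eventually.of_forall fun t => ?_)
    simp only
    rw [apply_eq_integral (hU t) (hpt t)]
    refine integral_congr_ae (Eventually.of_forall fun ξ => ?_)
    simp only [partialHatInv]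
    push_cast
    ring

/-! ### The solution on the Fourier side -/

/-- The function `g` along the fibre over `ξ`, in the variable `l = τ + h(ξ)`. -/
def fiber (h : Space → ℝ) (g : SpaceTime → ℂ) (ξ : Space) (l : ℝ) : ℂ :=
  g (WithLp.toLp 2 (l - h ξ, ξ))

theorem measurable_fiber_uncurry {h : Space → ℝ} (hh : Continuous h) {g : SpaceTime → ℂ}
    (hg : Measurable g) : Measurable (Function.uncurry (fiber h g)) :=
  hg.comp (measurable_shear hh)

/-- The Fourier transform of the solution with initial value `a` and right-hand side `G`, both given
on the Fourier side, cut off in time at scale `δ`. -/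
def solutionHat (h : Space → ℝ) (δ : ℝ) (a : Space → ℂ) (G : SpaceTime → ℂ) (z : SpaceTime) : ℂ :=
  solution δ (a z.snd) (fiber h G z.snd) (z.fst + h z.snd)

theorem fiber_solutionHat (h : Space → ℝ) (δ : ℝ) (a : Space → ℂ) (G : SpaceTime → ℂ) (ξ : Space)
    (l : ℝ) : fiber h (solutionHat h δ a G) ξ l = solution δ (a ξ) (fiber h G ξ) l := by
  change solution δ (a ξ) (fiber h G ξ) (l - h ξ + h ξ) = _
  rw [sub_add_cancel]

theorem measurable_solutionHat {h : Space → ℝ} (hh : Continuous h) (δ : ℝ) {a : Space → ℂ}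
    (ha : Measurable a) {G : SpaceTime → ℂ} (hG : Measurable G) :
    Measurable (solutionHat h δ a G) := by
  have h1 : Measurable fun p : SpaceTime × ℝ => duhamelKernel δ (p.1.fst + h p.1.snd) p.2 :=
    (measurable_duhamelKernel δ).comp
      (f := fun p : SpaceTime × ℝ => (p.1.fst + h p.1.snd, p.2)) (by fun_prop)
  have h2 : Measurable fun p : SpaceTime × ℝ => fiber h G p.1.snd p.2 :=
    (measurable_fiber_uncurry hh hG).comp (f := fun p : SpaceTime × ℝ => (p.1.snd, p.2))
      (by fun_prop)
  have h3 := ((h1.mul h2).stronglyMeasurable.integral_prod_right' (ν := volume)).measurable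
  have h4 : Measurable fun z : SpaceTime => 2 * Real.pi * a z.snd * kappa (z.fst + h z.snd) := by
    have : Measurable fun z : SpaceTime => kappa (z.fst + h z.snd) :=
      kappa.continuous.measurable.comp (by fun_prop)
    fun_prop
  exact h4.add h3

/-- The estimate for the free evolution of the initial value, by the rapid decay of `κ`. -/
theorem exists_tsum_kappa_le : ∃ C : ℝ≥0∞, C ≠ ⊤ ∧ ∀ (a : Space → ℝ≥0∞) (A : ℝ≥0∞)
    (X : ℕ → ℝ≥0∞), Measurable a → ∫⁻ ξ, a ξ ^ 2 ≤ A ^ 2 →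
      (∀ n : ℕ, X n ^ 2 ≤ ENNReal.ofReal ((2 : ℝ) ^ (n : ℝ)) *
        blockSq (fun ξ l => a ξ * ‖kappa l‖ₑ) n) → ∑' n, X n ≤ C * A := by
  obtain ⟨C, hC, hb⟩ := exists_norm_le_schwartz kappa
  refine ⟨∑' n : ℕ, ENNReal.ofReal (32 * C * (1 / 2) ^ n), ?_, fun a A X ha hA hX => ?_⟩
  · rw [← ENNReal.ofReal_tsum_of_nonneg (fun n => by positivity)
      (summable_geometric_two.mul_left _)]
    exact ENNReal.ofReal_ne_top
  rw [← ENNReal.tsum_mul_right]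
  refine ENNReal.tsum_le_tsum fun n => (ENNReal.pow_le_pow_left_iff two_ne_zero).1 ?_
  have h1 : ∀ l ∈ dyadic n, ‖kappa l‖ₑ ^ 2 ≤ ENNReal.ofReal ((16 * C * ((2 ^ n) ^ 4)⁻¹) ^ 2) := by
    intro l hl
    have h2 : (2 : ℝ) ^ n / 2 ≤ 1 + |l| := by
      cases n with
      | zero => norm_num; linarith [abs_nonneg l]
      | succ n =>
        have := (mem_dyadic_succ hl).1
        rw [pow_succ]
        linarith
    rw [← ofReal_norm, ← ENNReal.ofReal_pow (norm_nonneg _)]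
    refine ENNReal.ofReal_le_ofReal (pow_le_pow_left₀ (norm_nonneg _) ((hb l).trans ?_) 2)
    have h3 : ((1 + |l|) ^ 4)⁻¹ ≤ (((2 : ℝ) ^ n / 2) ^ 4)⁻¹ := by gcongr
    calc C * ((1 + |l|) ^ 4)⁻¹ ≤ C * (((2 : ℝ) ^ n / 2) ^ 4)⁻¹ := by gcongr
      _ = _ := by
        rw [div_pow, inv_div]
        ring
  have h2 : ∫⁻ l in dyadic n, ‖kappa l‖ₑ ^ 2 ≤
      ENNReal.ofReal ((16 * C * ((2 ^ n) ^ 4)⁻¹) ^ 2 * (2 * 2 ^ n)) :=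
    calc ∫⁻ l in dyadic n, ‖kappa l‖ₑ ^ 2
        ≤ ∫⁻ _ in dyadic n, ENNReal.ofReal ((16 * C * ((2 ^ n) ^ 4)⁻¹) ^ 2) :=
          setLIntegral_mono' (measurableSet_dyadic n) h1
      _ = ENNReal.ofReal ((16 * C * ((2 ^ n) ^ 4)⁻¹) ^ 2) * volume (dyadic n) := by
          rw [setLIntegral_const]
      _ ≤ _ := by
          rw [ENNReal.ofReal_mul (by positivity)]
          gcongr
          exact volume_dyadic_le n
  have hk : Measurable fun l => ‖kappa l‖ₑ := kappa.continuous.measurable.enorm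
  calc X n ^ 2 ≤ ENNReal.ofReal ((2 : ℝ) ^ (n : ℝ)) *
        blockSq (fun ξ l => a ξ * ‖kappa l‖ₑ) n := hX n
    _ = ENNReal.ofReal ((2 : ℝ) ^ (n : ℝ)) *
        ((∫⁻ ξ, a ξ ^ 2) * ∫⁻ l in dyadic n, ‖kappa l‖ₑ ^ 2) := by
        rw [blockSq, ← lintegral_mul_const _ (ha.pow_const 2)]
        congr 1
        refine lintegral_congr fun ξ => ?_
        rw [← lintegral_const_mul _ (hk.pow_const 2)]
        simp only [mul_pow]
    _ ≤ ENNReal.ofReal ((2 : ℝ) ^ (n : ℝ)) *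
        (A ^ 2 * ENNReal.ofReal ((16 * C * ((2 ^ n) ^ 4)⁻¹) ^ 2 * (2 * 2 ^ n))) := by gcongr
    _ = ENNReal.ofReal (2 ^ n * ((16 * C * ((2 ^ n) ^ 4)⁻¹) ^ 2 * (2 * 2 ^ n))) * A ^ 2 := by
        rw [Real.rpow_natCast, ENNReal.ofReal_mul (p := 2 ^ n) (by positivity)]
        ring
    _ ≤ ENNReal.ofReal ((32 * C * (1 / 2) ^ n) ^ 2) * A ^ 2 := by
        gcongr
        rw [one_div, inv_pow]
        have hy : (1 : ℝ) ≤ 2 ^ n := one_le_pow₀ (by norm_num)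
        generalize (2 : ℝ) ^ n = y at hy
        have hy0 : y ≠ 0 := by positivity
        have h3 : y * ((16 * C * (y ^ 4)⁻¹) ^ 2 * (2 * y)) = 512 * C ^ 2 * (y ^ 6)⁻¹ := by
          field_simp
          ring
        have h4 : (y ^ 6)⁻¹ ≤ (y ^ 2)⁻¹ :=
          inv_anti₀ (by positivity) (pow_le_pow_right₀ hy (by norm_num))
        have h5 : 0 ≤ (y ^ 2)⁻¹ := by positivity
        calc y * ((16 * C * (y ^ 4)⁻¹) ^ 2 * (2 * y)) = 512 * C ^ 2 * (y ^ 6)⁻¹ := h3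
          _ ≤ 1024 * C ^ 2 * (y ^ 2)⁻¹ := by
            gcongr
            norm_num
          _ = _ := by
            rw [mul_pow, mul_pow, inv_pow]
            norm_num
    _ = (ENNReal.ofReal (32 * C * (1 / 2) ^ n) * A) ^ 2 := by
        rw [ENNReal.ofReal_pow (by positivity), mul_pow]

/-- The kernel bound at scale `2^{-k}` applied to the weighted size `B` of the right-hand side, at
each fixed frequency; it controls the weighted size of the Duhamel term. -/
def duhamelSize (k : ℕ) (B : Space → ℝ → ℝ≥0∞) (ξ : Space) (l : ℝ) : ℝ≥0∞ :=
  ∫⁻ ν, (prodKernel ((2 : ℝ) ^ (-(k : ℝ))) l ν + diagKernel ((2 : ℝ) ^ (-(k : ℝ))) l ν) * B ξ ν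

theorem measurable_duhamelSize (k : ℕ) {B : Space → ℝ → ℝ≥0∞}
    (hB : Measurable (Function.uncurry B)) : Measurable (Function.uncurry (duhamelSize k B)) := by
  have hsnd : Measurable fun p : (Space × ℝ) × ℝ => (p.1.2, p.2) := by fun_prop
  have h1 := (measurable_prodKernel ((2 : ℝ) ^ (-(k : ℝ)))).comp hsnd
  have h2 := (measurable_diagKernel ((2 : ℝ) ^ (-(k : ℝ)))).comp hsnd
  have h3 : Measurable fun p : (Space × ℝ) × ℝ => B p.1.1 p.2 :=
    hB.comp (f := fun p : (Space × ℝ) × ℝ => (p.1.1, p.2)) (by fun_prop)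
  exact ((h1.add h2).mul h3).lintegral_prod_right' (ν := volume)

theorem exists_fiberSize_solutionHat_le : ∃ C : ℝ≥0∞, C ≠ ⊤ ∧ ∀ (h : Space → ℝ) (σ s : ℝ) (k : ℕ)
    (a : Space → ℂ) (G : SpaceTime → ℂ) (ξ : Space) (l : ℝ),
    fiberSize h σ s (solutionHat h ((2 : ℝ) ^ (-(k : ℝ))) a G) ξ l ≤
      C * (ENNReal.ofReal (weight σ s ξ) * ‖a ξ‖ₑ * ‖kappa l‖ₑ +
        duhamelSize k (fiberSize h σ s G) ξ l) := by
  obtain ⟨C, hC, hK⟩ := exists_enorm_duhamelKernel_le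
  refine ⟨ENNReal.ofReal (2 * Real.pi) + C, by finiteness, fun h σ s k a G ξ l => ?_⟩
  set δ := (2 : ℝ) ^ (-(k : ℝ)) with hδe
  have hδ : 0 < δ := by positivity
  have h1 : ‖duhamel δ (fiber h G ξ) l‖ₑ ≤
      C * ∫⁻ ν, (prodKernel δ l ν + diagKernel δ l ν) * ‖fiber h G ξ ν‖ₑ := by
    rw [← lintegral_const_mul' _ _ hC]
    refine (enorm_integral_le_lintegral_enorm _).trans (lintegral_mono fun ν => ?_)
    rw [enorm_mul, ← mul_assoc]
    gcongr
    exact hK δ l ν hδ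
  have h2 : duhamelSize k (fiberSize h σ s G) ξ l = ENNReal.ofReal (weight σ s ξ) *
      ∫⁻ ν, (prodKernel δ l ν + diagKernel δ l ν) * ‖fiber h G ξ ν‖ₑ := by
    rw [duhamelSize, ← lintegral_const_mul' _ _ ENNReal.ofReal_ne_top]
    refine lintegral_congr fun ν => ?_
    rw [fiberSize, fiber, ← hδe]
    ring
  have h3 : ‖(2 * Real.pi * a ξ * kappa l : ℂ)‖ₑ =
      ENNReal.ofReal (2 * Real.pi) * (‖a ξ‖ₑ * ‖kappa l‖ₑ) := by
    rw [enorm_mul, enorm_mul, mul_assoc, ← ofReal_norm (2 * Real.pi : ℂ), norm_mul,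
      Complex.norm_real, Real.norm_of_nonneg Real.pi_pos.le]
    norm_num
  have h4 : fiberSize h σ s (solutionHat h δ a G) ξ l =
      ENNReal.ofReal (weight σ s ξ) * ‖solution δ (a ξ) (fiber h G ξ) l‖ₑ := by
    rw [← fiber_solutionHat]
    rfl
  rw [h4, h2, mul_assoc (ENNReal.ofReal (weight σ s ξ)) ‖a ξ‖ₑ, mul_add]
  calc ENNReal.ofReal (weight σ s ξ) * ‖solution δ (a ξ) (fiber h G ξ) l‖ₑ
      ≤ ENNReal.ofReal (weight σ s ξ) * (ENNReal.ofReal (2 * Real.pi) * (‖a ξ‖ₑ * ‖kappa l‖ₑ) +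
        C * ∫⁻ ν, (prodKernel δ l ν + diagKernel δ l ν) * ‖fiber h G ξ ν‖ₑ) := by
        gcongr
        rw [← h3]
        exact (enorm_add_le _ _).trans (add_le_add_right h1 _)
    _ = ENNReal.ofReal (2 * Real.pi) * (ENNReal.ofReal (weight σ s ξ) * (‖a ξ‖ₑ * ‖kappa l‖ₑ)) +
        C * (ENNReal.ofReal (weight σ s ξ) *
          ∫⁻ ν, (prodKernel δ l ν + diagKernel δ l ν) * ‖fiber h G ξ ν‖ₑ) := by ring
    _ ≤ _ := by
        refine add_le_add ?_ ?_
        · exact mul_le_mul_left le_self_add _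
        · exact mul_le_mul_left le_add_self _

theorem blockSq_le_of_le {C : ℝ≥0∞} (hC : C ≠ ⊤) {B B₁ B₂ : Space → ℝ → ℝ≥0∞}
    (hB₁ : Measurable (Function.uncurry B₁))
    (h : ∀ ξ l, B ξ l ≤ C * (B₁ ξ l + B₂ ξ l)) (n : ℕ) :
    blockSq B n ≤ (2 * C ^ 2) * (blockSq B₁ n + blockSq B₂ n) := by
  have hB : ∀ ξ, Measurable (B₁ ξ) := fun ξ => hB₁.of_uncurry_left
  have ht : 2 * C ^ 2 ≠ ⊤ := by finiteness
  calc blockSq B n ≤ ∫⁻ ξ, ∫⁻ l in dyadic n, (2 * C ^ 2) * (B₁ ξ l ^ 2 + B₂ ξ l ^ 2) := by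
        refine lintegral_mono fun ξ => lintegral_mono fun l => ?_
        calc B ξ l ^ 2 ≤ (C * (B₁ ξ l + B₂ ξ l)) ^ 2 := by
              gcongr
              exact h ξ l
          _ = C ^ 2 * (B₁ ξ l + B₂ ξ l) ^ 2 := mul_pow _ _ _
          _ ≤ C ^ 2 * (2 * (B₁ ξ l ^ 2 + B₂ ξ l ^ 2)) := by
              gcongr
              exact add_sq_le_two_mul _ _
          _ = _ := by ring
    _ = (2 * C ^ 2) * ∫⁻ ξ, ((∫⁻ l in dyadic n, B₁ ξ l ^ 2) + ∫⁻ l in dyadic n, B₂ ξ l ^ 2) := by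
        rw [← lintegral_const_mul' _ _ ht]
        refine lintegral_congr fun ξ => ?_
        rw [lintegral_const_mul' _ _ ht, lintegral_add_left ((hB ξ).pow_const 2)]
    _ = _ := by rw [lintegral_add_left (measurable_block hB₁ n), blockSq, blockSq]

/-- The linear estimate, for functions on the Fourier side and for time scales `2^{-k}`. -/
theorem exists_tsum_solutionHat_le {b : ℝ} (hb : -(1 / 2 : ℝ) < b) (hb' : b < 1 / 2) :
    ∃ C : ℝ≥0∞, C ≠ ⊤ ∧ ∀ (h : Space → ℝ) (σ s : ℝ) (k : ℕ) (a : Space → ℂ) (G : SpaceTime → ℂ)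
      (A N : ℝ≥0∞) (X : ℕ → ℝ≥0∞), Continuous h → Measurable a → Measurable G →
      ∫⁻ ξ, (ENNReal.ofReal (weight σ s ξ) * ‖a ξ‖ₑ) ^ 2 ≤ A ^ 2 →
      (∀ n : ℕ, ENNReal.ofReal ((2 : ℝ) ^ (2 * b * n)) * blockSq (fiberSize h σ s G) n ≤ N ^ 2) →
      (∀ n : ℕ, X n ^ 2 ≤ ENNReal.ofReal ((2 : ℝ) ^ (n : ℝ)) *
        blockSq (fiberSize h σ s (solutionHat h ((2 : ℝ) ^ (-(k : ℝ))) a G)) n) →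
      ∑' n, X n ≤ C * (A + ENNReal.ofReal ((2 : ℝ) ^ (-((k : ℝ) * (1 / 2 + b)))) * N) := by
  obtain ⟨η, hη, hη1, hη2⟩ := exists_margin hb hb'
  -- `C₁` serves the initial value; `C₂`, `C₃`, `C₄` serve the passage from `ℓ¹` to the output
  -- weights, the kernel estimate, and the passage from the input weights to `ℓ^∞`
  obtain ⟨C₀, hC₀, h0⟩ := exists_fiberSize_solutionHat_le
  obtain ⟨C₁, hC₁, h1⟩ := exists_tsum_kappa_le
  obtain ⟨C₂, hC₂, h2⟩ := tsum_sq_le_lintegral_outSum hη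
  obtain ⟨C₃, hC₃, h3⟩ := outSum_kernel_le hη hη1 hη2
  obtain ⟨C₄, hC₄, h4⟩ := lintegral_inSum_le b hη
  refine ⟨2 * C₀ * (C₁ + (C₂ * (C₃ * C₄)) ^ (1 / 2 : ℝ)), ?_, ?_⟩
  · have : (C₂ * (C₃ * C₄)) ^ (1 / 2 : ℝ) ≠ ⊤ :=
      ENNReal.rpow_ne_top_of_nonneg (by norm_num) (by finiteness)
    finiteness
  intro h σ s k a G A N X hh ha hG hA hN hX
  have hw := (continuous_weight σ s).measurable
  have hwa : Measurable fun ξ => ENNReal.ofReal (weight σ s ξ) * ‖a ξ‖ₑ := by fun_prop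
  have hGm := measurable_fiberSize hh σ s hG
  have hk : Measurable fun l => ‖kappa l‖ₑ := kappa.continuous.measurable.enorm
  have hB₁ : Measurable (Function.uncurry fun (ξ : Space) (l : ℝ) =>
      ENNReal.ofReal (weight σ s ξ) * ‖a ξ‖ₑ * ‖kappa l‖ₑ) :=
    (hwa.comp measurable_fst).mul (hk.comp measurable_snd)
  set B₁ : Space → ℝ → ℝ≥0∞ := fun ξ l => ENNReal.ofReal (weight σ s ξ) * ‖a ξ‖ₑ * ‖kappa l‖ₑ
  set B₂ := duhamelSize k (fiberSize h σ s G) with hB₂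
  have hB₂m : Measurable (Function.uncurry B₂) := measurable_duhamelSize k hGm
  let Y : (Space → ℝ → ℝ≥0∞) → ℕ → ℝ≥0∞ := fun B n =>
    (ENNReal.ofReal ((2 : ℝ) ^ (n : ℝ)) * blockSq B n) ^ (1 / 2 : ℝ)
  have hY : ∀ B n, Y B n ^ 2 = ENNReal.ofReal ((2 : ℝ) ^ (n : ℝ)) * blockSq B n := fun B n =>
    rpow_half_sq _
  have hXY : ∀ n, X n ≤ 2 * C₀ * (Y B₁ n + Y B₂ n) := by
    intro n
    refine (ENNReal.pow_le_pow_left_iff two_ne_zero).1 ((hX n).trans ?_)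
    calc ENNReal.ofReal ((2 : ℝ) ^ (n : ℝ)) *
          blockSq (fiberSize h σ s (solutionHat h ((2 : ℝ) ^ (-(k : ℝ))) a G)) n
        ≤ ENNReal.ofReal ((2 : ℝ) ^ (n : ℝ)) * ((2 * C₀ ^ 2) * (blockSq B₁ n + blockSq B₂ n)) := by
          gcongr
          exact blockSq_le_of_le hC₀ hB₁ (fun ξ l => h0 h σ s k a G ξ l) n
      _ = 2 * C₀ ^ 2 * (Y B₁ n ^ 2 + Y B₂ n ^ 2) := by
          rw [hY, hY]
          ring
      _ ≤ 2 * C₀ ^ 2 * (2 * (Y B₁ n + Y B₂ n) ^ 2) := by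
          have : Y B₁ n ^ 2 + Y B₂ n ^ 2 ≤ 2 * (Y B₁ n + Y B₂ n) ^ 2 := by
            rw [two_mul]
            gcongr
            · exact le_self_add
            · exact le_add_self
          gcongr
      _ = (2 * C₀ * (Y B₁ n + Y B₂ n)) ^ 2 := by ring
  have hY1 : ∑' n, Y B₁ n ≤ C₁ * A := h1 _ A (Y B₁) hwa hA fun n => (hY B₁ n).le
  have hY2 : ∑' n, Y B₂ n ≤ (C₂ * (C₃ * C₄)) ^ (1 / 2 : ℝ) *
      (ENNReal.ofReal ((2 : ℝ) ^ (-((k : ℝ) * (1 / 2 + b)))) * N) := by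
    refine le_rpow_mul_of_sq_le ((h2 k B₂ (Y B₂) hB₂m fun n => (hY B₂ n).le).trans ?_)
    have h5 : ENNReal.ofReal ((2 : ℝ) ^ (-((k : ℝ) * (1 + 2 * b)))) =
        ENNReal.ofReal ((2 : ℝ) ^ (-((k : ℝ) * (1 / 2 + b)))) ^ 2 := by
      rw [← ENNReal.ofReal_pow (by positivity), ← Real.rpow_natCast _ 2,
        ← Real.rpow_mul (by norm_num)]
      congr 2
      push_cast
      ring
    calc C₂ * ∫⁻ ξ, outSum η k (B₂ ξ)
        ≤ C₂ * ∫⁻ ξ, C₃ * ENNReal.ofReal ((2 : ℝ) ^ (-((k : ℝ) * (1 + 2 * b)))) *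
            inSum b η k (fiberSize h σ s G ξ) := by
          gcongr with ξ
          exact h3 k _ hGm.of_uncurry_left
      _ = C₂ * (C₃ * ENNReal.ofReal ((2 : ℝ) ^ (-((k : ℝ) * (1 + 2 * b)))) *
            ∫⁻ ξ, inSum b η k (fiberSize h σ s G ξ)) := by
          rw [lintegral_const_mul' _ _ (by finiteness)]
      _ ≤ C₂ * (C₃ * ENNReal.ofReal ((2 : ℝ) ^ (-((k : ℝ) * (1 + 2 * b)))) * (C₄ * N ^ 2)) := by
          gcongr
          exact h4 k _ N hGm hN
      _ = _ := by
          rw [h5]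
          ring
  calc ∑' n, X n ≤ ∑' n, 2 * C₀ * (Y B₁ n + Y B₂ n) := ENNReal.tsum_le_tsum hXY
    _ = 2 * C₀ * (∑' n, Y B₁ n + ∑' n, Y B₂ n) := by rw [ENNReal.tsum_mul_left, ENNReal.tsum_add]
    _ ≤ 2 * C₀ * (C₁ * A + (C₂ * (C₃ * C₄)) ^ (1 / 2 : ℝ) *
        (ENNReal.ofReal ((2 : ℝ) ^ (-((k : ℝ) * (1 / 2 + b)))) * N)) := by gcongr
    _ ≤ 2 * C₀ * ((C₁ + (C₂ * (C₃ * C₄)) ^ (1 / 2 : ℝ)) * A +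
        (C₁ + (C₂ * (C₃ * C₄)) ^ (1 / 2 : ℝ)) *
        (ENNReal.ofReal ((2 : ℝ) ^ (-((k : ℝ) * (1 / 2 + b)))) * N)) := by
        gcongr
        · exact le_self_add
        · exact le_add_self
    _ = _ := by ring

/-- For almost every frequency the Duhamel operator may be applied to the right-hand side. -/
theorem ae_duhamelIntegrable {b : ℝ} (hb : -(1 / 2 : ℝ) < b) (hb' : b < 1 / 2) {h : Space → ℝ}
    (hh : Continuous h) (σ s : ℝ) (k : ℕ) {G : SpaceTime → ℂ} (hG : Measurable G) {N : ℝ≥0∞}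
    (hNt : N ≠ ⊤)
    (hN : ∀ n : ℕ, ENNReal.ofReal ((2 : ℝ) ^ (2 * b * n)) * blockSq (fiberSize h σ s G) n ≤ N ^ 2) :
    ∀ᵐ ξ, DuhamelIntegrable ((2 : ℝ) ^ (-(k : ℝ))) (fiber h G ξ) := by
  obtain ⟨η, hη, hη1, hη2⟩ := exists_margin hb hb'
  obtain ⟨C, hC, h1⟩ := lintegral_low_sq_le hη hη1 hη2
  obtain ⟨C', hC', h2⟩ := lintegral_inSum_le b hη
  have hGm := measurable_fiberSize hh σ s hG
  have hm : Measurable fun ξ => inSum b η k (fiberSize h σ s G ξ) := by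
    unfold inSum
    exact Measurable.tsum fun n => (measurable_block hGm n).const_mul _
  have h3 : ∫⁻ ξ, inSum b η k (fiberSize h σ s G ξ) ≠ ⊤ :=
    ne_top_of_le_ne_top (by finiteness) (h2 k _ N hGm hN)
  filter_upwards [ae_lt_top hm h3] with ξ hξ
  refine ⟨(measurable_fiber_uncurry hh hG).of_uncurry_left, fun ht => ?_⟩
  have h4 := h1 k (fiberSize h σ s G ξ) hGm.of_uncurry_left
  have h5 : ∫⁻ ν, ENNReal.ofReal (1 + (2 : ℝ) ^ (-(k : ℝ)) * |ν|)⁻¹ * fiberSize h σ s G ξ ν =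
      ENNReal.ofReal (weight σ s ξ) *
        ∫⁻ ν, ENNReal.ofReal (1 + (2 : ℝ) ^ (-(k : ℝ)) * |ν|)⁻¹ * ‖fiber h G ξ ν‖ₑ := by
    rw [← lintegral_const_mul' _ _ ENNReal.ofReal_ne_top]
    refine lintegral_congr fun ν => ?_
    rw [fiberSize, fiber]
    ring
  rw [h5, ht, ENNReal.mul_top (by simpa using weight_pos σ s ξ)] at h4
  have h6 : C * ENNReal.ofReal ((2 : ℝ) ^ ((k : ℝ) * (1 - 2 * b))) *
      inSum b η k (fiberSize h σ s G ξ) ≠ ⊤ := by finiteness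
  exact h6 (top_le_iff.1 (by simpa using h4))

/-! ### The equation on the Fourier side -/

theorem PolyL2.mul_of_le {h : Space → ℝ} (hgr : PolynomialGrowth h) {g : SpaceTime → ℂ}
    (hg : Measurable g) (hp : PolyL2 g) {r : SpaceTime → ℝ} (hr : Measurable r)
    (hle : ∀ z, |r z| ≤ 1 + |z.fst| + |h z.snd|) : PolyL2 fun z => (r z : ℂ) * g z := by
  obtain ⟨C, N, hC, hb⟩ := exists_one_add_abs_add_le hgr
  refine hp.of_norm_le (Measurable.aestronglyMeasurable (by fun_prop)) (C := C) (N := N)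
    (Eventually.of_forall fun z => ?_)
  rw [norm_mul, Complex.norm_real, Real.norm_eq_abs]
  gcongr
  exact (hle z).trans (hb z)

/-- The left-hand side of the equation, on the Fourier side, is multiplication by `τ + h(ξ)`. -/
theorem equation_apply {h : Space → ℝ} (hh : Continuous h) (hgr : PolynomialGrowth h)
    {u w : 𝓢'(SpaceTime, ℂ)} {g : SpaceTime → ℂ} (hg : Measurable g) (hp : PolyL2 g)
    (hu : IsFunction (hat u) g) (hw : IsFunction (hat w) fun z => (h z.snd : ℂ) * g z)
    (φ : 𝓢(SpaceTime, ℂ)) :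
    (-Complex.I • timeDeriv u + w) φ =
      ∫ z, schwartzHatInv SpaceTime φ z * (((z.fst + h z.snd : ℝ) : ℂ) * g z) := by
  have h1 : PolyL2 fun z => ((z.fst : ℝ) : ℂ) * g z :=
    hp.mul_of_le hgr hg (by fun_prop) fun z => by linarith [abs_nonneg (h z.snd)]
  have h2 : PolyL2 fun z => ((h z.snd : ℝ) : ℂ) * g z :=
    hp.mul_of_le hgr hg (by fun_prop) fun z => by linarith [abs_nonneg z.fst]
  have h3 : timeDeriv u φ = Complex.I *
      ∫ z, schwartzHatInv SpaceTime φ z * (((z.fst : ℝ) : ℂ) * g z) := by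
    rw [timeDeriv, TemperedDistribution.lineDerivOp_apply_apply, map_neg, apply_eq_integral hu hp,
      ← integral_neg, ← integral_const_mul]
    refine integral_congr_ae (Eventually.of_forall fun z => ?_)
    simp only
    rw [schwartzHatInv_lineDeriv, WithLp.prod_inner_apply]
    have h4 : (inner ℝ z.fst (1 : ℝ) + inner ℝ z.snd (0 : Space) : ℝ) = z.fst := by simp
    change -(-(Complex.I * ((inner ℝ z.fst (1 : ℝ) + inner ℝ z.snd (0 : Space) : ℝ) : ℂ)) *
      _ * _) = _
    rw [h4]
    ring
  have h5 : (-Complex.I • timeDeriv u + w) φ = -Complex.I * timeDeriv u φ + w φ := rfl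
  rw [h5, h3, apply_eq_integral hw h2, ← mul_assoc, neg_mul, Complex.I_mul_I, neg_neg, one_mul,
    ← integral_add (h1.integrable_mul _) (h2.integrable_mul _)]
  refine integral_congr_ae (Eventually.of_forall fun z => ?_)
  simp only
  push_cast
  ring

/-- Along the fibre over `ξ`, in the variable `l = τ + h(ξ)`, the inverse Fourier transform of a
test function is the Fourier integral in time of `e^{-ith(ξ)} φ̌(t, ξ)`, which has the same support
in time as `φ`. -/
theorem schwartzHatInv_fiber_eq (h : Space → ℝ) (φ : 𝓢(SpaceTime, ℂ)) (ξ : Space) (l : ℝ) :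
    fiber h (schwartzHatInv SpaceTime φ) ξ l = ∫ t : ℝ, Complex.exp (Complex.I * (t * l : ℝ)) *
      (Complex.exp (-(Complex.I * (t * h ξ : ℝ))) * partialHatInv φ t ξ) := by
  rw [fiber, schwartzHatInv_eq_integral_partialHatInv]
  refine integral_congr_ae (Eventually.of_forall fun t => ?_)
  simp only
  rw [← mul_assoc, ← Complex.exp_add]
  congr 2
  push_cast
  ring

theorem exists_abs_mul_norm_fiber_le {h : Space → ℝ} (hgr : PolynomialGrowth h)
    (ψ : 𝓢(SpaceTime, ℂ)) : ∃ B : ℝ, ∀ ξ l, |l| * ‖fiber h ψ ξ l‖ ≤ B := by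
  obtain ⟨C, N, hC, hb⟩ := exists_one_add_abs_add_le hgr
  refine ⟨C * (2 ^ (2 * N) * (Finset.Iic (2 * N, 0)).sup
    (fun m : ℕ × ℕ => SchwartzMap.seminorm ℝ m.1 m.2) ψ), fun ξ l => ?_⟩
  have h1 := SchwartzMap.one_add_le_sup_seminorm_apply (𝕜 := ℝ) (m := (2 * N, 0)) (k := 2 * N)
    (n := 0) le_rfl le_rfl ψ (WithLp.toLp 2 (l - h ξ, ξ))
  rw [norm_iteratedFDeriv_zero] at h1
  have h2 := hb (WithLp.toLp 2 (l - h ξ, ξ))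
  change 1 + |l - h ξ| + |h ξ| ≤ _ at h2
  have h3 : |l| ≤ 1 + |l - h ξ| + |h ξ| := by
    have := abs_add_le (l - h ξ) (h ξ)
    rw [sub_add_cancel] at this
    linarith
  rw [fiber]
  generalize (WithLp.toLp 2 (l - h ξ, ξ) : SpaceTime) = z at h1 h2
  have h4 : (1 + ‖z‖ ^ 2) ^ N ≤ (1 + ‖z‖) ^ (2 * N) := by
    rw [pow_mul]
    gcongr
    nlinarith [norm_nonneg z]
  calc |l| * ‖ψ z‖ ≤ C * (1 + ‖z‖ ^ 2) ^ N * ‖ψ z‖ := by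
        gcongr
        exact h3.trans h2
    _ ≤ C * ((1 + ‖z‖) ^ (2 * N) * ‖ψ z‖) := by
        rw [mul_assoc]
        gcongr
    _ ≤ _ := by gcongr

theorem integral_schwartzHatInv_mul_fiber (h : Space → ℝ) {g : SpaceTime → ℂ} (hp : PolyL2 g)
    (φ : 𝓢(SpaceTime, ℂ)) : ∫ z, schwartzHatInv SpaceTime φ z * g z =
      ∫ ξ, ∫ l, fiber h (schwartzHatInv SpaceTime φ) ξ l * fiber h g ξ l := by
  rw [integral_schwartzHatInv_mul hp]
  refine integral_congr_ae (Eventually.of_forall fun ξ => ?_)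
  exact (integral_sub_right_eq_self
    (fun τ : ℝ => schwartzHatInv SpaceTime φ (WithLp.toLp 2 (τ, ξ)) * g (WithLp.toLp 2 (τ, ξ)))
    (h ξ)).symm

theorem integral_fiber (h : Space → ℝ) (g : SpaceTime → ℂ) (ξ : Space) :
    ∫ l, fiber h g ξ l = timeTransform g 0 ξ := by
  unfold timeTransform
  simp only [zero_mul, Complex.ofReal_zero, mul_zero, Complex.exp_zero, one_mul]
  exact integral_sub_right_eq_self (fun τ : ℝ => g (WithLp.toLp 2 (τ, ξ))) (h ξ)

/-- The function `solutionHat` satisfies the equation on the slab. -/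
theorem integral_mul_solutionHat {h : Space → ℝ} (hh : Continuous h) (hgr : PolynomialGrowth h)
    {δ D : ℝ} (hδ : δ ≤ D) (hD : 0 < D) (hD1 : D ≤ 1) {a : Space → ℂ} {G : SpaceTime → ℂ}
    (ha : Measurable a) (hG : Measurable G) (hGp : PolyL2 G) (hV : PolyL2 (solutionHat h D a G))
    (hD' : ∀ᵐ ξ, DuhamelIntegrable D (fiber h G ξ)) {φ : 𝓢(SpaceTime, ℂ)}
    (hφ : tsupport φ ⊆ slab δ) :
    ∫ z, schwartzHatInv SpaceTime φ z * (((z.fst + h z.snd : ℝ) : ℂ) * solutionHat h D a G z) =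
      ∫ z, schwartzHatInv SpaceTime φ z * G z := by
  have h1 : PolyL2 fun z => ((z.fst + h z.snd : ℝ) : ℂ) * solutionHat h D a G z :=
    hV.mul_of_le hgr (measurable_solutionHat hh D ha hG) (by fun_prop) fun z => by
      linarith [abs_add_le z.fst (h z.snd)]
  rw [integral_schwartzHatInv_mul_fiber h h1, integral_schwartzHatInv_mul_fiber h hGp]
  obtain ⟨B, hB⟩ := exists_abs_mul_norm_fiber_le hgr (schwartzHatInv SpaceTime φ)
  refine integral_congr_ae ?_
  filter_upwards [hD'] with ξ hξ
  have hq : Integrable fun t : ℝ =>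
      Complex.exp (-(Complex.I * (t * h ξ : ℝ))) * partialHatInv φ t ξ := by
    refine (integrable_partialHatInv φ ξ).bdd_mul (c := 1) (by fun_prop)
      (Eventually.of_forall fun t => ?_)
    rw [← mul_neg, ← Complex.ofReal_neg, norm_exp_I_mul]
  have hPm : Measurable (fiber h (schwartzHatInv SpaceTime φ) ξ) :=
    (measurable_fiber_uncurry hh (schwartzHatInv SpaceTime φ).continuous.measurable).of_uncurry_left
  have h2 := integral_id_mul_solution hD hD1 (a ξ) hξ hq
    (fun t ht => by rw [partialHatInv_eq_zero hφ (hδ.trans ht), mul_zero])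
    (schwartzHatInv_fiber_eq h φ ξ) hPm (hB ξ)
  have h3 : ∀ l, fiber h (fun z => ((z.fst + h z.snd : ℝ) : ℂ) * solutionHat h D a G z) ξ l =
      l * solution D (a ξ) (fiber h G ξ) l := by
    intro l
    rw [← fiber_solutionHat]
    change ((l - h ξ + h ξ : ℝ) : ℂ) * _ = _
    rw [sub_add_cancel]
    rfl
  simp only [h3]
  rw [← (integral_congr_ae (Eventually.of_forall fun l => mul_comm _ _) : _ = ∫ l,
    fiber h (schwartzHatInv SpaceTime φ) ξ l * (l * solution D (a ξ) (fiber h G ξ) l)), h2]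
  exact integral_congr_ae (Eventually.of_forall fun l => mul_comm _ _)

/-- Existence of a solution on `(-δ, δ)`, with the estimate in the norms on the whole space-time,
for the time scale `2^{-k} ≥ δ`. -/
theorem exists_solution {b : ℝ} (hb : -(1 / 2 : ℝ) < b) (hb' : b < 1 / 2) :
    ∃ C : ℝ≥0∞, C ≠ ⊤ ∧ ∀ (h : Space → ℝ), Continuous h → PolynomialGrowth h →
      ∀ (σ s δ : ℝ) (k : ℕ), 0 ≤ σ → δ ≤ (2 : ℝ) ^ (-(k : ℝ)) →
      ∀ f : 𝓢'(Space, ℂ), MemG σ s f → ∀ F : 𝓢'(SpaceTime, ℂ), MemX h σ s b ⊤ F →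
        ∃ u : 𝓢'(SpaceTime, ℂ), MemX h σ s (1 / 2) 1 u ∧ SolvesIVP h σ s δ f F u ∧
          xNorm h σ s (1 / 2) 1 u ≤ C * (gNorm σ s f +
            ENNReal.ofReal ((2 : ℝ) ^ (-((k : ℝ) * (1 / 2 + b)))) * xNorm h σ s b ⊤ F) := by
  obtain ⟨C, hC, hest⟩ := exists_tsum_solutionHat_le hb hb'
  refine ⟨C, hC, fun h hh hgr σ s δ k hσ hδ f hf F hF => ?_⟩
  obtain ⟨a, ham, ha, -⟩ := hf.exists_measurable hσ
  obtain ⟨G, hGm, hG, hGp, hGN⟩ := hF.exists_measurable_top hh hgr hσ hb.le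
  have hD0 : (0 : ℝ) < (2 : ℝ) ^ (-(k : ℝ)) := by positivity
  have hD1 : (2 : ℝ) ^ (-(k : ℝ)) ≤ 1 :=
    Real.rpow_le_one_of_one_le_of_nonpos (by norm_num) (by simp)
  have hA : ∫⁻ ξ, (ENNReal.ofReal (weight σ s ξ) * ‖a ξ‖ₑ) ^ 2 ≤ gNorm σ s f ^ 2 :=
    (gNorm_sq σ s ha).ge
  have hDI := ae_duhamelIntegrable hb hb' hh σ s k hGm hF.2.ne hGN
  set V := solutionHat h ((2 : ℝ) ^ (-(k : ℝ))) a G with hV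
  have hVm : Measurable V := measurable_solutionHat hh _ ham hGm
  have hVf := measurable_fiberSize hh σ s hVm
  set R := C * (gNorm σ s f +
    ENNReal.ofReal ((2 : ℝ) ^ (-((k : ℝ) * (1 / 2 + b)))) * xNorm h σ s b ⊤ F) with hR
  have hRt : R ≠ ⊤ := by
    have := hf.2.ne
    have := hF.2.ne
    finiteness
  -- `X n` is the dyadic piece of the solution; it is named before the distribution `u` is
  -- available, because the estimate is what makes `V` the Fourier transform of a distribution
  let X : ℕ → ℝ≥0∞ := fun n =>
    (ENNReal.ofReal ((2 : ℝ) ^ (n : ℝ)) * blockSq (fiberSize h σ s V) n) ^ (1 / 2 : ℝ)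
  have hX : ∀ n, X n ^ 2 = ENNReal.ofReal ((2 : ℝ) ^ (n : ℝ)) * blockSq (fiberSize h σ s V) n :=
    fun n => rpow_half_sq _
  have hXR : ∑' n, X n ≤ R := hest h σ s k a G _ _ X hh ham hGm hA hGN fun n => (hX n).le
  have hVp : PolyL2 V := by
    refine polyL2_of_fiberSize hh hgr hσ s hVm
      (lintegral_inv_mul_sq_lt_top (b := 1 / 2) (by norm_num) hRt hVf fun n => ?_)
    rw [mul_one_div_cancel two_ne_zero, one_mul, ← hX]
    gcongr
    exact (ENNReal.le_tsum n).trans hXR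
  have hVT : TimeL1 σ s V := by
    have h1 := lintegral_lintegral_sq_le (X := X) hVf fun n => (hX n).ge
    simp only [lintegral_fiberSize h σ s V] at h1
    exact h1.trans_lt (ENNReal.pow_lt_top (ENNReal.mul_lt_top (by norm_num)
      (hXR.trans_lt hRt.lt_top)))
  obtain ⟨u, hu⟩ := hVp.exists_isFunction_hat
  have hhV : PolyL2 fun z => ((h z.snd : ℝ) : ℂ) * V z :=
    hVp.mul_of_le hgr hVm (by fun_prop) fun z => by linarith [abs_nonneg z.fst]
  obtain ⟨w, hw⟩ := hhV.exists_isFunction_hat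
  have hnorm : xNorm h σ s (1 / 2) 1 u ≤ R := by
    rw [xNorm_one]
    refine hest h σ s k a G _ _ _ hh ham hGm hA hGN fun n => ?_
    rw [xPiece_sq hh σ s (1 / 2) hVm (hatFun_ae_eq hu), mul_one_div_cancel two_ne_zero, one_mul]
  obtain ⟨U, hU, hUhat⟩ := exists_isCurve hσ hVm hu hVp hVT
  refine ⟨u, ⟨⟨V, hu⟩, hnorm.trans_lt hRt.lt_top⟩, ⟨⟨w, ⟨⟨V, hu⟩, ?_⟩, fun φ hφ => ?_⟩, U, hU, ?_⟩,
    hnorm⟩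
  · refine hw.congr ?_
    filter_upwards [hatFun_ae_eq hu] with z hz
    rw [hz]
  · change (-Complex.I • timeDeriv u + w) φ - F φ = 0
    rw [equation_apply hh hgr hVm hVp hu hw, apply_eq_integral hG hGp,
      integral_mul_solutionHat hh hgr hδ hD0 hD1 ham hGm hGp hVp hDI hφ, sub_self]
  · refine eq_of_hat_ae_eq (hUhat 0) ha ?_
    filter_upwards [hDI] with ξ hξ
    rw [← integral_fiber h V ξ]
    simp only [hV, fiber_solutionHat]
    rw [integral_solution hD0 _ hξ, inv_mul_cancel_left₀]
    exact mul_ne_zero two_ne_zero (by exact_mod_cast Real.pi_ne_zero)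

/-! ### Uniqueness at a fixed frequency -/

theorem eq_zero_of_rat {f : ℝ → ℂ} (hf : Continuous f) {δ : ℝ}
    (h : ∀ r : ℚ, |(r : ℝ)| < δ → f r = 0) {t : ℝ} (ht : |t| < δ) : f t = 0 := by
  have ho : IsOpen {x : ℝ | |x| < δ} := isOpen_lt continuous_abs continuous_const
  have h1 := Rat.isDenseEmbedding_coe_real.dense.open_subset_closure_inter ho ht
  refine closure_minimal (t := {x | f x = 0}) ?_ (isClosed_eq hf continuous_const) h1
  rintro _ ⟨hx, r, rfl⟩
  exact h r hx

theorem continuous_integral_exp_mul {f : ℝ → ℂ} (hf : Integrable f) :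
    Continuous fun t : ℝ => ∫ x : ℝ, Complex.exp (Complex.I * (t * x : ℝ)) * f x := by
  refine continuous_of_dominated (bound := fun x => ‖f x‖)
    (fun t => (integrable_exp_mul hf t).aestronglyMeasurable)
    (fun t => Eventually.of_forall fun x => ?_) hf.norm (Eventually.of_forall fun x => ?_)
  · rw [norm_mul, norm_exp_I_mul, one_mul]
  · fun_prop

/-- If the inverse Fourier transform `W` of `f` satisfies `-i W' + c W = 0` on `(-δ, δ)`, then `|W|`
is constant there. -/
theorem norm_integral_exp_mul_eq {f : ℝ → ℂ} (hf : Integrable f)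
    (hf' : Integrable fun x : ℝ => (x : ℂ) * f x) {c δ : ℝ}
    (h : ∀ t : ℝ, |t| < δ →
      ∫ x : ℝ, Complex.exp (Complex.I * (t * x : ℝ)) * (((x + c : ℝ) : ℂ) * f x) = 0)
    {t : ℝ} (ht : |t| < δ) :
    ‖∫ x : ℝ, Complex.exp (Complex.I * (t * x : ℝ)) * f x‖ = ‖∫ x : ℝ, f x‖ := by
  set W : ℝ → ℂ := fun t => ∫ x : ℝ, Complex.exp (Complex.I * (t * x : ℝ)) * f x with hW
  have h1 : ∀ r : ℝ, |r| < δ → HasDerivAt W (-(Complex.I * c) * W r) r := by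
    intro r hr
    convert hasDerivAt_integral_exp_mul hf hf' r using 1
    have h2 := h r hr
    have h3 : ∀ x : ℝ, Complex.exp (Complex.I * (r * x : ℝ)) * (((x + c : ℝ) : ℂ) * f x) =
        Complex.exp (Complex.I * (r * x : ℝ)) * (x * f x) +
          c * (Complex.exp (Complex.I * (r * x : ℝ)) * f x) := fun x => by
      push_cast
      ring
    have h4 : ∀ x : ℝ, Complex.exp (Complex.I * (r * x : ℝ)) * (Complex.I * (x * f x)) =
        Complex.I * (Complex.exp (Complex.I * (r * x : ℝ)) * (x * f x)) := fun x => by ring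
    simp only [h3] at h2
    rw [integral_add (integrable_exp_mul hf' r) ((integrable_exp_mul hf r).const_mul _),
      integral_const_mul] at h2
    simp only [h4]
    rw [integral_const_mul]
    change -(Complex.I * c) * (∫ x : ℝ, Complex.exp (Complex.I * (r * x : ℝ)) * f x) = _
    linear_combination (-Complex.I) * h2
  -- `e^{irc} W(r)` is constant
  have h2 : ∀ r ∈ Set.Ioo (-δ) δ,
      HasDerivAt (fun r : ℝ => Complex.exp (Complex.I * (r * c : ℝ)) * W r) 0 r := by
    intro r hr
    have h3 : HasDerivAt (fun r : ℝ => Complex.I * ((r * c : ℝ) : ℂ)) (Complex.I * c) r := by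
      have h4 : HasDerivAt (fun r : ℝ => r * c) c r := by
        simpa using (hasDerivAt_id r).mul_const c
      exact h4.ofReal_comp.const_mul Complex.I
    refine (h3.cexp.mul (h1 r (abs_lt.2 hr))).congr_deriv ?_
    ring
  have hδ : 0 < δ := (abs_nonneg t).trans_lt ht
  have h3 : Complex.exp (Complex.I * (t * c : ℝ)) * W t =
      Complex.exp (Complex.I * (0 * c : ℝ)) * W 0 :=
    isOpen_Ioo.is_const_of_deriv_eq_zero isPreconnected_Ioo
      (fun r hr => (h2 r hr).differentiableAt.differentiableWithinAt) (fun r hr => (h2 r hr).deriv)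
      (abs_lt.1 ht) ⟨by linarith, hδ⟩
  have h4 := congrArg norm h3
  rw [norm_mul, norm_mul, norm_exp_I_mul, norm_exp_I_mul, one_mul, one_mul] at h4
  rw [h4, hW]
  simp

/-- A regularised form of the uniqueness of solutions of `-i W' + c W = 0`, `W(0) = 0`, where `W` is
the inverse Fourier transform of `f`. -/
theorem integral_exp_mul_eq_zero {f : ℝ → ℂ} (hf : Integrable f) (h0 : ∫ x, f x = 0)
    {m : ℕ → ℝ → ℂ} (hm : ∀ n, Continuous (m n)) (hm1 : ∀ n x, ‖m n x‖ ≤ 1)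
    (hmS : ∀ n, ∃ S : ℝ, ∀ x : ℝ, |x| * ‖m n x‖ ≤ S)
    (hlim : ∀ x, Tendsto (fun n => m n x) atTop (𝓝 1)) {ε : ℕ → ℝ}
    (hε : Tendsto ε atTop (𝓝 0)) {c δ : ℝ}
    (h : ∀ (n : ℕ) (r : ℚ), |(r : ℝ)| < δ - ε n →
      ∫ x : ℝ, Complex.exp (Complex.I * ((r : ℝ) * x : ℝ)) *
        (((x + c : ℝ) : ℂ) * (m n x * f x)) = 0)
    {t : ℝ} (ht : |t| < δ) :
    ∫ x : ℝ, Complex.exp (Complex.I * (t * x : ℝ)) * f x = 0 := by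
  have hi : ∀ n, Integrable fun x => m n x * f x := fun n =>
    hf.bdd_mul (hm n).aestronglyMeasurable (Eventually.of_forall (hm1 n))
  have hi' : ∀ n, Integrable fun x : ℝ => (x : ℂ) * (m n x * f x) := fun n => by
    obtain ⟨S, hS⟩ := hmS n
    have hc := hm n
    refine (hf.bdd_mul (f := fun x : ℝ => (x : ℂ) * m n x) (c := S)
      (Continuous.aestronglyMeasurable (by fun_prop)) (Eventually.of_forall fun x => ?_)).congr
      (Eventually.of_forall fun x => mul_assoc _ _ _)
    rw [norm_mul, Complex.norm_real, Real.norm_eq_abs]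
    exact hS x
  have hdom : ∀ r : ℝ, Tendsto (fun n => ∫ x : ℝ, Complex.exp (Complex.I * (r * x : ℝ)) *
      (m n x * f x)) atTop (𝓝 (∫ x : ℝ, Complex.exp (Complex.I * (r * x : ℝ)) * f x)) := by
    intro r
    refine tendsto_integral_of_dominated_convergence (fun x => ‖f x‖)
      (fun n => (integrable_exp_mul (hi n) r).aestronglyMeasurable) hf.norm
      (fun n => Eventually.of_forall fun x => ?_) (Eventually.of_forall fun x => ?_)
    · rw [norm_mul, norm_exp_I_mul, one_mul, norm_mul]
      exact mul_le_of_le_one_left (norm_nonneg _) (hm1 n x)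
    · simpa using ((hlim x).mul_const (f x)).const_mul (Complex.exp (Complex.I * (r * x : ℝ)))
  have h1 : ∀ᶠ n in atTop, ‖∫ x : ℝ, Complex.exp (Complex.I * (t * x : ℝ)) * (m n x * f x)‖ =
      ‖∫ x : ℝ, Complex.exp (Complex.I * ((0 : ℝ) * x : ℝ)) * (m n x * f x)‖ := by
    have h2 : ∀ᶠ n in atTop, ε n < δ - |t| := hε.eventually_lt_const (by linarith)
    filter_upwards [h2] with n hn
    have hsum : Integrable fun x : ℝ => ((x + c : ℝ) : ℂ) * (m n x * f x) := by
      refine ((hi' n).add ((hi n).const_mul (c : ℂ))).congr (Eventually.of_forall fun x => ?_)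
      simp only [Pi.add_apply]
      push_cast
      ring
    rw [norm_integral_exp_mul_eq (hi n) (hi' n) (c := c) (δ := δ - ε n)
      (fun r hr => eq_zero_of_rat (continuous_integral_exp_mul hsum) (h n) hr) (by linarith)]
    simp
  have h3 := (hdom t).norm
  have h4 := (hdom 0).norm
  have h5 := tendsto_nhds_unique (h3.congr' h1) h4
  rw [← norm_eq_zero, h5]
  simp [h0]

/-! ### Test functions concentrated in time -/

/-- A smooth even bump function on the line of integral one, supported in
`[-(n + 1)⁻¹, (n + 1)⁻¹]`. -/
def timeBump (n : ℕ) : ℝ → ℝ :=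
  (⟨((n : ℝ) + 1)⁻¹ / 2, ((n : ℝ) + 1)⁻¹, by positivity, half_lt_self (by positivity)⟩ :
    ContDiffBump (0 : ℝ)).normed volume

theorem contDiff_timeBump (n : ℕ) : ContDiff ℝ ∞ (timeBump n) := ContDiffBump.contDiff_normed _

theorem hasCompactSupport_timeBump (n : ℕ) : HasCompactSupport (timeBump n) :=
  ContDiffBump.hasCompactSupport_normed _

theorem timeBump_nonneg (n : ℕ) (t : ℝ) : 0 ≤ timeBump n t := ContDiffBump.nonneg_normed _ _

theorem integral_timeBump (n : ℕ) : ∫ t, timeBump n t = 1 := ContDiffBump.integral_normed _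

theorem integrable_timeBump (n : ℕ) : Integrable (timeBump n) := ContDiffBump.integrable_normed _

theorem integrable_ofReal_timeBump (n : ℕ) : Integrable fun t => (timeBump n t : ℂ) :=
  (integrable_timeBump n).ofReal

theorem integral_ofReal_timeBump (n : ℕ) : ∫ t, (timeBump n t : ℂ) = 1 := by
  rw [integral_complex_ofReal, integral_timeBump, Complex.ofReal_one]

theorem tsupport_timeBump (n : ℕ) : tsupport (timeBump n) = Metric.closedBall 0 ((n : ℝ) + 1)⁻¹ :=
  ContDiffBump.tsupport_normed_eq _

theorem timeBump_eq_zero {n : ℕ} {t : ℝ} (ht : ((n : ℝ) + 1)⁻¹ < |t|) : timeBump n t = 0 := by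
  refine image_eq_zero_of_notMem_tsupport fun h => ?_
  rw [tsupport_timeBump, Metric.mem_closedBall, Real.dist_eq, sub_zero] at h
  exact absurd h (not_le.2 ht)

/-- The Fourier integral of `timeBump`. -/
def bumpHat (n : ℕ) (x : ℝ) : ℂ :=
  ∫ t : ℝ, Complex.exp (Complex.I * (t * x : ℝ)) * (timeBump n t : ℂ)

theorem bumpHat_eq (n : ℕ) (x : ℝ) : bumpHat n x = 2 * Real.pi * schwartzHatInv ℝ
    (testFunction (timeBump n) (contDiff_timeBump n) (hasCompactSupport_timeBump n)) x := by
  have h1 : (2 * Real.pi : ℂ) ≠ 0 := mul_ne_zero two_ne_zero (by exact_mod_cast Real.pi_ne_zero)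
  rw [schwartzHatInv_apply, Module.finrank_self, pow_one, Complex.ofReal_inv, Complex.ofReal_mul,
    Complex.ofReal_ofNat, mul_inv_cancel_left₀ h1, bumpHat]
  refine integral_congr_ae (Eventually.of_forall fun t => ?_)
  simp only [testFunction_apply]
  congr 4
  simp [mul_comm]

theorem continuous_bumpHat (n : ℕ) : Continuous (bumpHat n) := by
  have h1 : bumpHat n = fun x => 2 * Real.pi * schwartzHatInv ℝ
    (testFunction (timeBump n) (contDiff_timeBump n) (hasCompactSupport_timeBump n)) x :=
    funext (bumpHat_eq n)
  rw [h1]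
  have := (schwartzHatInv ℝ (testFunction (timeBump n) (contDiff_timeBump n)
    (hasCompactSupport_timeBump n))).continuous
  fun_prop

theorem norm_bumpHat_le (n : ℕ) (x : ℝ) : ‖bumpHat n x‖ ≤ 1 := by
  rw [bumpHat, ← integral_timeBump n]
  refine norm_integral_le_of_norm_le (integrable_timeBump n) (Eventually.of_forall fun t => ?_)
  rw [norm_mul, norm_exp_I_mul, one_mul, Complex.norm_real,
    Real.norm_of_nonneg (timeBump_nonneg n t)]

theorem exists_abs_mul_norm_bumpHat_le (n : ℕ) : ∃ S : ℝ, ∀ x : ℝ, |x| * ‖bumpHat n x‖ ≤ S := by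
  set f := schwartzHatInv ℝ
    (testFunction (timeBump n) (contDiff_timeBump n) (hasCompactSupport_timeBump n)) with hf
  refine ⟨2 * Real.pi * SchwartzMap.seminorm ℝ 1 0 f, fun x => ?_⟩
  have h1 := SchwartzMap.norm_pow_mul_le_seminorm ℝ f 1 x
  rw [pow_one, Real.norm_eq_abs] at h1
  rw [bumpHat_eq, ← hf, norm_mul, norm_mul, Complex.norm_real,
    Real.norm_of_nonneg Real.pi_pos.le, Complex.norm_ofNat, mul_left_comm]
  gcongr

theorem tendsto_bumpHat (x : ℝ) : Tendsto (fun n => bumpHat n x) atTop (𝓝 1) := by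
  have h1 : ∀ n : ℕ, ‖bumpHat n x - 1‖ ≤ |x| * ((n : ℝ) + 1)⁻¹ := by
    intro n
    have hint := integrable_exp_mul (integrable_ofReal_timeBump n) x
    have h2 : bumpHat n x - 1 =
        ∫ t : ℝ, (Complex.exp (Complex.I * (x * t : ℝ)) - 1) * (timeBump n t : ℂ) := by
      simp only [sub_mul, one_mul]
      rw [integral_sub hint (integrable_ofReal_timeBump n), integral_ofReal_timeBump, bumpHat]
      simp only [mul_comm]
    rw [h2]
    refine (norm_integral_le_of_norm_le ((integrable_timeBump n).const_mul (|x| * ((n : ℝ) + 1)⁻¹))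
      (Eventually.of_forall fun t => ?_)).trans ?_
    · rw [norm_mul, Complex.norm_real, Real.norm_of_nonneg (timeBump_nonneg n t)]
      rcases le_or_gt |t| ((n : ℝ) + 1)⁻¹ with ht | ht
      · refine mul_le_mul_of_nonneg_right (Real.norm_exp_I_mul_ofReal_sub_one_le.trans ?_)
          (timeBump_nonneg n t)
        rw [norm_mul, Real.norm_eq_abs, Real.norm_eq_abs]
        gcongr
      · rw [timeBump_eq_zero ht, mul_zero, mul_zero]
    · rw [integral_const_mul, integral_timeBump, mul_one]
  rw [tendsto_iff_norm_sub_tendsto_zero]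
  refine squeeze_zero (fun n => norm_nonneg _) h1 ?_
  simpa [one_div] using (tendsto_one_div_add_atTop_nhds_zero_nat (𝕜 := ℝ)).const_mul |x|

theorem partialHatInv_tensor {θ : ℝ → ℝ} (hθ : ContDiff ℝ ∞ θ) (hc : HasCompactSupport θ)
    (g : 𝓢(Space, ℂ)) (hg : HasCompactSupport g) (t : ℝ) (ξ : Space) :
    partialHatInv (tensor θ hθ hc g hg) t ξ =
      (2 * Real.pi : ℝ)⁻¹ * schwartzHatInv Space g ξ * (θ t : ℂ) := by
  rw [partialHatInv, slice_tensor, map_smul, smul_apply, smul_eq_mul]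
  ring

/-- The translate of `timeBump` to the time `r`. -/
def shiftedBump (n : ℕ) (r t : ℝ) : ℝ := timeBump n (t - r)

theorem contDiff_shiftedBump (n : ℕ) (r : ℝ) : ContDiff ℝ ∞ (shiftedBump n r) :=
  (contDiff_timeBump n).comp (contDiff_id.sub contDiff_const)

theorem hasCompactSupport_shiftedBump (n : ℕ) (r : ℝ) : HasCompactSupport (shiftedBump n r) :=
  (hasCompactSupport_timeBump n).comp_homeomorph (Homeomorph.subRight r)

theorem tsupport_shiftedBump_subset {n : ℕ} {r δ : ℝ} (hr : |r| < δ - ((n : ℝ) + 1)⁻¹) :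
    tsupport (shiftedBump n r) ⊆ Set.Ioo (-δ) δ := by
  have h1 : tsupport (shiftedBump n r) ⊆ Metric.closedBall r ((n : ℝ) + 1)⁻¹ := by
    refine closure_minimal (fun t ht => ?_) Metric.isClosed_closedBall
    rw [Metric.mem_closedBall, Real.dist_eq]
    by_contra h
    exact ht (timeBump_eq_zero (not_le.1 h))
  refine h1.trans fun t ht => abs_lt.1 ?_
  rw [Metric.mem_closedBall, Real.dist_eq] at ht
  have := abs_sub_abs_le_abs_sub t r
  linarith

theorem integral_exp_mul_shiftedBump (n : ℕ) (r x : ℝ) :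
    ∫ t : ℝ, Complex.exp (Complex.I * (t * x : ℝ)) * (shiftedBump n r t : ℂ) =
      Complex.exp (Complex.I * (r * x : ℝ)) * bumpHat n x := by
  rw [bumpHat, ← integral_const_mul, ← integral_sub_right_eq_self
    (fun t : ℝ => Complex.exp (Complex.I * (r * x : ℝ)) *
      (Complex.exp (Complex.I * (t * x : ℝ)) * (timeBump n t : ℂ))) r]
  refine integral_congr_ae (Eventually.of_forall fun t => ?_)
  simp only [shiftedBump]
  rw [← mul_assoc, ← Complex.exp_add]
  congr 2
  push_cast
  ring

/-! ### Uniqueness of the solution -/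

/-- A function in `PolyL2` that is orthogonal to the inverse Fourier transforms of test functions
vanishes. -/
theorem PolyL2.ae_eq_zero {E : Type*} [NormedAddCommGroup E] [InnerProductSpace ℝ E]
    [FiniteDimensional ℝ E] [MeasurableSpace E] [BorelSpace E] {B : E → ℂ} (hB : PolyL2 B)
    (h : ∀ g : 𝓢(E, ℂ), HasCompactSupport g → ∫ ξ, schwartzHatInv E g ξ * B ξ = 0) :
    B =ᵐ[volume] 0 := by
  obtain ⟨u, hu⟩ := hB.exists_isFunction_hat
  have h1 : u = 0 := tempered_ext_of_hasCompactSupport fun g hg => by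
    rw [apply_eq_integral hu hB, h g hg]
    rfl
  refine hu.ae_eq (g' := 0) ⟨locallyIntegrable_zero, fun φ _ => ?_⟩
  rw [h1, hat_apply]
  simp

/-- Regularising in time by a factor `q` that gains one power of `τ` makes the equation meaningful
at almost every fixed frequency. -/
theorem TimeL1.polyL2_integral {σ s : ℝ} (hσ : 0 ≤ σ) {h : Space → ℝ} (hh : Continuous h)
    (hgr : PolynomialGrowth h) {d : SpaceTime → ℂ} (hd : Measurable d) (hT : TimeL1 σ s d)
    {q : ℝ → ℂ} (hq : Measurable q) {S : ℝ} (hq1 : ∀ x, ‖q x‖ ≤ 1)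
    (hqS : ∀ x : ℝ, |x| * ‖q x‖ ≤ S) :
    PolyL2 fun ξ => ∫ τ : ℝ, q τ * (((τ + h ξ : ℝ) : ℂ) * d (WithLp.toLp 2 (τ, ξ))) := by
  obtain ⟨C, N, hC, hb⟩ := exists_one_add_abs_add_le hgr
  have hAm := measurable_lintegral_fiber hd
  set A : Space → ℝ≥0∞ := fun ξ => ∫⁻ τ : ℝ, ‖d (WithLp.toLp 2 (τ, ξ))‖ₑ with hA
  have hAp : PolyL2 fun ξ => ((A ξ).toReal : ℂ) := by
    refine polyL2_of_lintegral hσ s (Measurable.aestronglyMeasurable (by fun_prop))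
      (lt_of_le_of_lt (lintegral_mono fun ξ => ?_) hT)
    gcongr
    rw [← ofReal_norm, Complex.norm_real, Real.norm_of_nonneg ENNReal.toReal_nonneg]
    exact ENNReal.ofReal_toReal_le
  have hm : Measurable fun p : Space × ℝ =>
      q p.2 * (((p.2 + h p.1 : ℝ) : ℂ) * d (WithLp.toLp 2 (p.2, p.1))) := by
    have h1 : Measurable fun p : Space × ℝ => d (WithLp.toLp 2 (p.2, p.1)) :=
      hd.comp (continuous_toLp_prod.measurable.comp (by fun_prop))
    fun_prop
  refine hAp.of_norm_le
    (hm.stronglyMeasurable.integral_prod_right' (ν := volume)).aestronglyMeasurable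
    (C := |S| + C) (N := N) ?_
  filter_upwards [hT.ae_integrable hd] with ξ hξ
  have hAr : (A ξ).toReal = ∫ τ : ℝ, ‖d (WithLp.toLp 2 (τ, ξ))‖ :=
    (integral_norm_eq_lintegral_enorm hξ.aestronglyMeasurable).symm
  rw [Complex.norm_real, Real.norm_of_nonneg ENNReal.toReal_nonneg, hAr, ← integral_const_mul]
  refine norm_integral_le_of_norm_le (hξ.norm.const_mul _) (Eventually.of_forall fun τ => ?_)
  rw [← mul_assoc, norm_mul]
  gcongr
  have h1 := hb (WithLp.toLp 2 ((0 : ℝ), ξ))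
  have h2 : ‖(WithLp.toLp 2 ((0 : ℝ), ξ) : SpaceTime)‖ = ‖ξ‖ := by
    rw [WithLp.prod_norm_eq_of_L2]
    simp
  rw [h2] at h1
  change 1 + |(0 : ℝ)| + |h ξ| ≤ _ at h1
  rw [abs_zero] at h1
  have h3 : (1 : ℝ) ≤ (1 + ‖ξ‖ ^ 2) ^ N := one_le_pow₀ (by nlinarith [norm_nonneg ξ])
  calc ‖q τ * ((τ + h ξ : ℝ) : ℂ)‖ ≤ |τ| * ‖q τ‖ + |h ξ| * ‖q τ‖ := by
        rw [norm_mul, Complex.norm_real, Real.norm_eq_abs, ← add_mul, mul_comm]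
        gcongr
        exact abs_add_le _ _
    _ ≤ |S| * (1 + ‖ξ‖ ^ 2) ^ N + C * (1 + ‖ξ‖ ^ 2) ^ N := by
        refine add_le_add ?_ ?_
        · exact ((hqS τ).trans (le_abs_self S)).trans (le_mul_of_one_le_right (abs_nonneg S) h3)
        · refine (mul_le_of_le_one_right (abs_nonneg _) (hq1 τ)).trans ?_
          linarith
    _ = _ := by ring

/-- Uniqueness for the homogeneous problem, on the Fourier side: if `d` is the Fourier transform of
a solution on `(-δ, δ)` with zero initial value, then the solution vanishes on `(-δ, δ)`. -/
theorem ae_timeTransform_eq_zero {h : Space → ℝ} (hh : Continuous h) (hgr : PolynomialGrowth h)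
    {σ s δ : ℝ} (hσ : 0 ≤ σ) {d : SpaceTime → ℂ} (hd : Measurable d) (hp : PolyL2 d)
    (hT : TimeL1 σ s d)
    (heq : ∀ φ : 𝓢(SpaceTime, ℂ), tsupport φ ⊆ slab δ →
      ∫ z, schwartzHatInv SpaceTime φ z * (((z.fst + h z.snd : ℝ) : ℂ) * d z) = 0)
    (h0 : ∀ᵐ ξ, timeTransform d 0 ξ = 0) :
    ∀ᵐ ξ, ∀ t : ℝ, |t| < δ → timeTransform d t ξ = 0 := by
  have hdp : PolyL2 fun z => ((z.fst + h z.snd : ℝ) : ℂ) * d z :=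
    hp.mul_of_le hgr hd (by fun_prop) fun z => by linarith [abs_add_le z.fst (h z.snd)]
  have hpi : (((2 * Real.pi)⁻¹ : ℝ) : ℂ) ≠ 0 := by
    exact_mod_cast (by positivity : (2 * Real.pi)⁻¹ ≠ (0 : ℝ))
  -- Testing with `ρₙ(t - r) g(x)` for all `g` gives the equation, averaged in time near `r`, at
  -- almost every frequency.  Only rational `r` are used, so that one null set of frequencies serves
  -- for all.
  have key : ∀ (n : ℕ) (r : ℚ), |(r : ℝ)| < δ - ((n : ℝ) + 1)⁻¹ →
      ∀ᵐ ξ, ∫ τ : ℝ, Complex.exp (Complex.I * ((r : ℝ) * τ : ℝ)) *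
        (((τ + h ξ : ℝ) : ℂ) * (bumpHat n τ * d (WithLp.toLp 2 (τ, ξ)))) = 0 := by
    intro n r hr
    obtain ⟨S, hS⟩ := exists_abs_mul_norm_bumpHat_le n
    have hqm : Measurable fun τ : ℝ =>
        Complex.exp (Complex.I * ((r : ℝ) * τ : ℝ)) * bumpHat n τ := by
      have := (continuous_bumpHat n).measurable
      fun_prop
    have hqn : ∀ τ : ℝ, ‖Complex.exp (Complex.I * ((r : ℝ) * τ : ℝ)) * bumpHat n τ‖ =
        ‖bumpHat n τ‖ := fun τ => by rw [norm_mul, norm_exp_I_mul, one_mul]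
    have hB := hT.polyL2_integral hσ hh hgr hd hqm (fun τ => (hqn τ).trans_le (norm_bumpHat_le n τ))
      (S := S) (fun τ => by rw [hqn]; exact hS τ)
    have hB0 := hB.ae_eq_zero fun g hg => by
      have h1 := heq (tensor (shiftedBump n r) (contDiff_shiftedBump n r)
        (hasCompactSupport_shiftedBump n r) g hg)
        (tsupport_tensor_subset _ _ g hg (tsupport_shiftedBump_subset hr))
      rw [integral_schwartzHatInv_mul hdp] at h1
      refine (mul_eq_zero.1 (Eq.trans ?_ h1)).resolve_left hpi
      rw [← integral_const_mul]
      refine integral_congr_ae (Eventually.of_forall fun ξ => ?_)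
      simp only
      rw [← integral_const_mul, ← integral_const_mul]
      refine integral_congr_ae (Eventually.of_forall fun τ => ?_)
      simp only [schwartzHatInv_eq_integral_partialHatInv, partialHatInv_tensor]
      have h2 : ∫ t : ℝ, Complex.exp (Complex.I * (t * τ : ℝ)) *
          ((2 * Real.pi : ℝ)⁻¹ * schwartzHatInv Space g ξ * (shiftedBump n r t : ℂ)) =
          (((2 * Real.pi)⁻¹ : ℝ) : ℂ) * schwartzHatInv Space g ξ *
            (Complex.exp (Complex.I * ((r : ℝ) * τ : ℝ)) * bumpHat n τ) := by
        rw [← integral_exp_mul_shiftedBump, ← integral_const_mul]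
        refine integral_congr_ae (Eventually.of_forall fun t => ?_)
        simp only
        push_cast
        ring
      rw [h2]
      change _ = _ * (((τ + h ξ : ℝ) : ℂ) * d (WithLp.toLp 2 (τ, ξ)))
      ring
    filter_upwards [hB0] with ξ hξ
    refine Eq.trans (integral_congr_ae (Eventually.of_forall fun τ => ?_)) hξ
    simp only
    ring
  have key' : ∀ᵐ ξ, ∀ (n : ℕ) (r : ℚ), |(r : ℝ)| < δ - ((n : ℝ) + 1)⁻¹ →
      ∫ τ : ℝ, Complex.exp (Complex.I * ((r : ℝ) * τ : ℝ)) *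
        (((τ + h ξ : ℝ) : ℂ) * (bumpHat n τ * d (WithLp.toLp 2 (τ, ξ)))) = 0 := by
    rw [ae_all_iff]
    intro n
    rw [ae_all_iff]
    intro r
    by_cases hr : |(r : ℝ)| < δ - ((n : ℝ) + 1)⁻¹
    · filter_upwards [key n r hr] with ξ hξ _ using hξ
    · exact Eventually.of_forall fun ξ h => absurd h hr
  filter_upwards [key', h0, hT.ae_integrable hd] with ξ h1 h2 h3 t ht
  refine integral_exp_mul_eq_zero h3 ?_ continuous_bumpHat norm_bumpHat_le
    exists_abs_mul_norm_bumpHat_le tendsto_bumpHat (ε := fun n => ((n : ℝ) + 1)⁻¹) ?_ h1 ht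
  · simpa [timeTransform] using h2
  · simpa [one_div] using tendsto_one_div_add_atTop_nhds_zero_nat (𝕜 := ℝ)

theorem SolvesIVP.exists_measurable {h : Space → ℝ} {σ s δ : ℝ} {f : 𝓢'(Space, ℂ)}
    {F u : 𝓢'(SpaceTime, ℂ)} {g : SpaceTime → ℂ} (hu : IsFunction (hat u) g)
    (hs : SolvesIVP h σ s δ f F u) : ∃ w, IsFunction (hat w) (fun z => (h z.snd : ℂ) * g z) ∧
      EqOnSlab δ (-Complex.I • timeDeriv u + w) F := by
  obtain ⟨⟨w, ⟨-, hw⟩, hE⟩, -⟩ := hs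
  refine ⟨w, hw.congr ?_, hE⟩
  filter_upwards [hatFun_ae_eq hu] with z hz
  rw [hz]

/-- Uniqueness of the solution on `(-δ, δ)`. The right-hand sides need to agree only on the slab, so
that solutions built from different extensions of the same `F` can be compared. -/
theorem SolvesIVP.eqOnSlab {h : Space → ℝ} (hh : Continuous h) (hgr : PolynomialGrowth h)
    {σ s δ : ℝ} (hσ : 0 ≤ σ) {f : 𝓢'(Space, ℂ)} {F F' u v : 𝓢'(SpaceTime, ℂ)}
    (hF : EqOnSlab δ F F')
    (hu : MemX h σ s (1 / 2) 1 u) (hv : MemX h σ s (1 / 2) 1 v)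
    (hus : SolvesIVP h σ s δ f F u) (hvs : SolvesIVP h σ s δ f F' v) : EqOnSlab δ u v := by
  obtain ⟨g, hgm, hg, hgp, hgT⟩ := hu.exists_measurable_one hh hgr hσ
  obtain ⟨g', hgm', hg', hgp', hgT'⟩ := hv.exists_measurable_one hh hgr hσ
  obtain ⟨w, hw, hE⟩ := hus.exists_measurable hg
  obtain ⟨w', hw', hE'⟩ := hvs.exists_measurable hg'
  have hdm : Measurable fun z => g z - g' z := hgm.sub hgm'
  have hdp := hgp.sub hgp'
  have hdT := hgT.sub hgm hgT'
  have hd : IsFunction (hat (u - v)) fun z => g z - g' z := by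
    rw [hat_sub]
    exact hg.sub hg'
  have hprod : ∀ {g : SpaceTime → ℂ}, Measurable g → PolyL2 g →
      PolyL2 fun z => ((z.fst + h z.snd : ℝ) : ℂ) * g z := fun hm hp =>
    hp.mul_of_le hgr hm (by fun_prop) fun z => by linarith [abs_add_le z.fst (h z.snd)]
  have heq : ∀ φ : 𝓢(SpaceTime, ℂ), tsupport φ ⊆ slab δ →
      ∫ z, schwartzHatInv SpaceTime φ z * (((z.fst + h z.snd : ℝ) : ℂ) * (g z - g' z)) = 0 := by
    intro φ hφ
    have h1 : (-Complex.I • timeDeriv u + w) φ - F φ = 0 := hE φ hφ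
    have h2 : (-Complex.I • timeDeriv v + w') φ - F' φ = 0 := hE' φ hφ
    have h3 : F φ - F' φ = 0 := hF φ hφ
    rw [equation_apply hh hgr hgm hgp hg hw] at h1
    rw [equation_apply hh hgr hgm' hgp' hg' hw'] at h2
    simp only [mul_sub]
    rw [integral_sub ((hprod hgm hgp).integrable_mul _) ((hprod hgm' hgp').integrable_mul _)]
    linear_combination h1 - h2 + h3
  -- both solutions have the curve of `exists_isCurve`, hence equal transforms of the value at time
  -- `0`
  have h0 : ∀ᵐ ξ, timeTransform (fun z => g z - g' z) 0 ξ = 0 := by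
    have hinit : ∀ {u F : 𝓢'(SpaceTime, ℂ)} {g : SpaceTime → ℂ}, Measurable g →
        IsFunction (hat u) g → PolyL2 g → TimeL1 σ s g → SolvesIVP h σ s δ f F u →
        IsFunction (hat f) fun ξ => (2 * Real.pi : ℂ)⁻¹ * timeTransform g 0 ξ := by
      intro u F g hgm hg hgp hgT hs
      obtain ⟨U, hU, hUhat⟩ := exists_isCurve hσ hgm hg hgp hgT
      obtain ⟨-, V, hV, hV0⟩ := hs
      rw [← hV0, ← hU.eq hσ hV 0]
      exact hUhat 0
    filter_upwards [(hinit hgm hg hgp hgT hus).ae_eq (hinit hgm' hg' hgp' hgT' hvs),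
      hgT.ae_integrable hgm, hgT'.ae_integrable hgm'] with ξ h1 h2 h3
    have h4 := mul_left_cancel₀ (inv_ne_zero
      (mul_ne_zero two_ne_zero (by exact_mod_cast Real.pi_ne_zero))) h1
    unfold timeTransform at h4 ⊢
    simp only [mul_sub]
    rw [integral_sub (integrable_exp_mul h2 0) (integrable_exp_mul h3 0), h4, sub_self]
  have hz := ae_timeTransform_eq_zero hh hgr hσ hdm hdp hdT heq h0
  intro φ hφ
  rw [apply_eq_integral_timeTransform hdm hd hdp hdT]
  refine integral_eq_zero_of_ae ?_
  filter_upwards [hz] with ξ hξ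
  refine integral_eq_zero_of_ae (Eventually.of_forall fun t => ?_)
  rcases lt_or_ge |t| δ with ht | ht
  · simp [hξ t ht]
  · simp [partialHatInv_eq_zero hφ ht]

end GevreyBourgain

end

open GevreyBourgain

theorem mainTheorem8 (b : ℝ) (hb : -(1 / 2 : ℝ) < b) (hb' : b < 1 / 2) :
    ∃ c : ℝ, 0 < c ∧
      ∀ (h : Space → ℝ), Continuous h → PolynomialGrowth h →
      ∀ (σ s δ : ℝ), 0 ≤ σ → 0 < δ → δ ≤ 1 →
      ∀ f : 𝓢'(Space, ℂ), MemG σ s f →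
      ∀ F : 𝓢'(SpaceTime, ℂ), MemX h σ s b ⊤ F →
        ∃ u : 𝓢'(SpaceTime, ℂ),
          MemX h σ s (1 / 2) 1 u ∧ SolvesIVP h σ s δ f F u ∧
          (∀ v : 𝓢'(SpaceTime, ℂ), MemX h σ s (1 / 2) 1 v → SolvesIVP h σ s δ f F v →
            EqOnSlab δ v u) ∧
          xNormOn h σ s (1 / 2) 1 δ u ≤
            ENNReal.ofReal c *
              (gNorm σ s f + ENNReal.ofReal (δ ^ (1 / 2 + b)) * xNormOn h σ s b ⊤ δ F) := by
  obtain ⟨C, hC, hex⟩ := exists_solution hb hb'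
  -- `M` is the price of replacing `δ` by the dyadic scale `2^{-k} ≤ 2δ`
  set M : ℝ := 2 ^ (1 / 2 + b) with hM
  have hM1 : 1 ≤ M := Real.one_le_rpow (by norm_num) (by linarith)
  refine ⟨(C.toReal + 1) * M, by positivity, fun h hh hgr σ s δ hσ hδ hδ1 f hf F hF => ?_⟩
  obtain ⟨k, hk1, hk2⟩ := exists_two_rpow_neg_nat hδ hδ1
  obtain ⟨u, hu, hus, -⟩ := hex h hh hgr σ s δ k hσ hk1 f hf F hF
  have h0 : EqOnSlab δ F F := fun φ _ => by simp
  refine ⟨u, hu, hus, fun v hv hvs => hvs.eqOnSlab hh hgr hσ h0 hv hu hus, ?_⟩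
  set c := ENNReal.ofReal ((C.toReal + 1) * M) with hc
  have hcC : C * ENNReal.ofReal M ≤ c := by
    rw [hc, ENNReal.ofReal_mul (by positivity)]
    gcongr
    exact ENNReal.le_ofReal_iff_toReal_le hC (by positivity) |>.2 (by linarith)
  have hc0 : c ≠ 0 := by
    rw [hc, ne_eq, ENNReal.ofReal_eq_zero, not_le]
    positivity
  have hscale : ENNReal.ofReal ((2 : ℝ) ^ (-((k : ℝ) * (1 / 2 + b)))) ≤
      ENNReal.ofReal M * ENNReal.ofReal (δ ^ (1 / 2 + b)) := by
    rw [← ENNReal.ofReal_mul (by positivity), hM, ← Real.mul_rpow (by norm_num) hδ.le, ← neg_mul,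
      Real.rpow_mul (by norm_num)]
    refine ENNReal.ofReal_le_ofReal (Real.rpow_le_rpow (by positivity) hk2 (by linarith))
  -- the solution built from another extension `v` of `F` equals `u` on the slab
  have hest : ∀ v, MemX h σ s b ⊤ v → EqOnSlab δ F v → xNormOn h σ s (1 / 2) 1 δ u ≤
      c * (gNorm σ s f + ENNReal.ofReal (δ ^ (1 / 2 + b)) * xNorm h σ s b ⊤ v) := by
    intro v hv hFv
    obtain ⟨u', hu', hus', hle⟩ := hex h hh hgr σ s δ k hσ hk1 f hf v hv
    refine (iInf_le_of_le u' (iInf_le_of_le hu'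
      (iInf_le_of_le (hus.eqOnSlab hh hgr hσ hFv hu hu' hus') le_rfl))).trans (hle.trans ?_)
    calc C * (gNorm σ s f +
          ENNReal.ofReal ((2 : ℝ) ^ (-((k : ℝ) * (1 / 2 + b)))) * xNorm h σ s b ⊤ v)
        ≤ C * (ENNReal.ofReal M * gNorm σ s f +
          (ENNReal.ofReal M * ENNReal.ofReal (δ ^ (1 / 2 + b))) * xNorm h σ s b ⊤ v) := by
          gcongr
          exact le_mul_of_one_le_left zero_le (ENNReal.one_le_ofReal.2 hM1)
      _ = C * ENNReal.ofReal M * (gNorm σ s f +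
          ENNReal.ofReal (δ ^ (1 / 2 + b)) * xNorm h σ s b ⊤ v) := by ring
      _ ≤ _ := by gcongr
  -- pass to the infimum over the extensions `v` of `F`
  have hfin : c * gNorm σ s f ≠ ⊤ := ENNReal.mul_ne_top ENNReal.ofReal_ne_top hf.2.ne
  have hd0 : c * ENNReal.ofReal (δ ^ (1 / 2 + b)) ≠ 0 :=
    mul_ne_zero hc0 (by
      rw [ne_eq, ENNReal.ofReal_eq_zero, not_le]
      positivity)
  have hdt : c * ENNReal.ofReal (δ ^ (1 / 2 + b)) ≠ ⊤ :=
    ENNReal.mul_ne_top ENNReal.ofReal_ne_top ENNReal.ofReal_ne_top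
  have hinf : (xNormOn h σ s (1 / 2) 1 δ u - c * gNorm σ s f) /
      (c * ENNReal.ofReal (δ ^ (1 / 2 + b))) ≤ xNormOn h σ s b ⊤ δ F := by
    refine le_iInf fun v => le_iInf fun hv => le_iInf fun hFv => ?_
    rw [ENNReal.div_le_iff hd0 hdt, tsub_le_iff_left]
    refine (hest v hv hFv).trans (le_of_eq ?_)
    ring
  rw [ENNReal.div_le_iff hd0 hdt, tsub_le_iff_left] at hinf
  refine hinf.trans (le_of_eq ?_)
  ring
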